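/- **Setting: the linear quantum $\lambda$-calculus.** Fix a finite set of symbols $\mathsf U$, each with an arity $n\ge 1$ and denoting a unitary operator on $n$ qubits. Types are $A,B::=\mathbb B\mid\mathbb Q\mid A\multimap B\mid A\otimes B$, and terms are $$t,u,v::=x\mid r\mid \lambda x^A.t\mid tu\mid\langle t,u\rangle\mid \mathsf{let}\,\langle x,y\rangle=t\,\mathsf{in}\,u\mid\mathsf{new}\mid\mathsf{tt}\mid\mathsf{ff}\mid\mathsf{meas}\mid\mathsf U\mid\mathsf{if}\,t\,\mathsf{then}\,u\,\mathsf{else}\,v$$ with $r$ ranging over quantum variables; terms are linearly typed by judgments $\Theta,V\vdash t:A$ ($\Theta$ types $\lambda$-variables, $V$ is a finite set of quantum variables, contexts of different premises are disjoint and used exactly), where the branches of an $\mathsf{if}$ are typed in the empty context, $\mathsf{new}:\mathbb Q$, $\mathsf{meas}:\mathbb Q\multimap\mathbb B$, $\mathsf U_n:\mathbb Q^{\otimes n}\multimap\mathbb Q^{\otimes n}$. Bound variables of abstractions carry their type, so a judgment determines its derivation. Values are $a,b::=r\mid\lambda x^A.t\mid\langle a,b\rangle\mid\mathsf{new}\mid\mathsf{tt}\mid\mathsf{ff}\mid\mathsf{meas}\mid\mathsf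 U$; evaluation contexts are $E::=[\cdot]\mid E\,t\mid a\,E\mid\langle E,t\rangle\mid\langle a,E\rangle\mid\mathsf{let}\,\langle x,y\rangle=E\,\mathsf{in}\,t\mid\mathsf{if}\,E\,\mathsf{then}\,t\,\mathsf{else}\,u$. A *quantum closure* of type $A$ is a pair $[Q,t]$ with $V\vdash t:A$ and $Q$ a normalized vector of the Hilbert space with basis $\{0,1\}^V$, modulo renaming of quantum variables. One-step reduction $\mapsto$ relates closures to finite distributions: $[Q,E[(\lambda x^A.t)u]]\mapsto\{[Q,E[t\{u/x\}]]^1\}$; $[Q,E[\mathsf{let}\,\langle x,y\rangle=\langle t,u\rangle\,\mathsf{in}\,v]]\mapsto\{[Q,E[v\{t,u/x,y\}]]^1\}$; $\mathsf{if}\,\mathsf{tt}$ and $\mathsf{if}\,\mathsf{ff}$ select the first and the second branch; $[Q,E[\mathsf{new}]]\mapsto\{[Q\otimes|r\leftarrow0\rangle,E[r]]^1\}$ with $r$ fresh; $[Q,E[\mathsf U_n\langle r_1,\dots,r_n\rangle]]\mapsto\{[\mathsf U_n^{r_1,\dots,r_n}(Q),E[\langle r_1,\dots,r_n\rangle]]^1\}$;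 and $[Q,E[\mathsf{meas}\,r]]\mapsto\{[Q_0,E[\mathsf{tt}]]^{p_0},[Q_1,E[\mathsf{ff}]]^{p_1}\}$, where $p_b$ is the probability of observing $b$ for $r$ in $Q$, $Q_b$ is the normalized resulting state on $V\setminus\{r\}$, and outcomes of probability $0$ are omitted. Multi-step reduction $\Rightarrow$ is generated by: $C\Rightarrow\{C^1\}$; and if $C\mapsto\{D_1^{p_1},\dots,D_n^{p_n}\}$ and $D_i\Rightarrow\mathscr D_i$ for all $i$, then $C\Rightarrow\sum_ip_i\mathscr D_i$. **Setting: quantum nets.** A QSMLL *structure* is a graph with edges labelled by formulas of multiplicative linear logic with units, built from $\mathsf{ax}$, $\mathsf{cut}$, $\otimes$, $\wp$ (par) and $\mathsf{one}$ links, *sync* links (with corresponding premises $e_i$ and conclusions $f_i$ of the same formula, positive, $P::=1\mid P\otimes P$, or negative, $N::=\bot\mid N\wp N$, labelled by a unitary operator whose arity is the number of atoms of the formulas), and boxes of conclusions $\bot,\Gamma$ that contain two structures of conclusions $\Gamma$. It is a *net* if its depth-$0$ graph (boxes being nodes without premises) has no cyclic switching path, i.e. no simple cycle using at most one premise of each $\wp$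 and at most one out-edge (positive conclusion or negative premise) of each sync link, and the contents of its boxes are nets. A *quantum net* is a net together with a normalized register $Q$ whose variables correspond to some of its $\mathsf{one}$ links of depth $0$; quantum nets are taken up to isomorphism. One-step reduction $\hookrightarrow$ acts at depth $0$ by the rules $\mathsf{ax}/\mathsf{cut}$ and $\otimes/\wp $; the commutations of sync links with $\otimes$, $\wp$, $\mathsf{ax}$ (from the positive to the negative conclusion) and $\mathsf{cut}$ (from the negative to the positive premise), all with probability $1$ and $Q$ unchanged; and the following rules: a $\mathsf{one}$ link not associated with the register becomes associated with a fresh variable $r$, and $Q$ becomes $Q\otimes|r\leftarrow0\rangle$; a sync link labelled $U$ whose premises are conclusions of $\mathsf{one}$ links associated with $r_1,\dots,r_n$ is erased, and $Q$ becomes $U^{r_1,\dots,r_n}(Q)$; if the lock of a box is cut against a $\mathsf{one}$ link associated with $r$, then $r$ is measured, and with probability $p_b$ the box is opened with its first content and $Q_0$ (for $b=0$) or its second content and $Q_1$ (for $b=1$). Multi-step reduction $\leadsto$ is generated from $\hookrightarrow$ as $\Rightarrow$ is from $\mapsto$. **Translation.** Put $\langle\mathbb B\rangle=\langle\mathbb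 Q\rangle=1$, $\langle A\multimap B\rangle=\langle A\rangle^\bot\wp \langle B\rangle$, $\langle A\otimes B\rangle=\langle A\rangle\otimes\langle B\rangle$. The derivation of $x_1:A_1,\dots,x_k:A_k,V\vdash t:B$ is translated to a net with conclusions $\langle A_1\rangle^\bot,\dots,\langle A_k\rangle^\bot,\langle B\rangle$: a variable is an axiom; $\lambda$ is a $\wp$ link, a pair a $\otimes$ link; an application $tu$ is a cut of $\langle t\rangle$ with the $\otimes$ of $\langle u\rangle$ and an axiom; a $\mathsf{let}$ is a cut of $\langle t\rangle$ with the $\wp$ of the conclusions of $\langle u\rangle$ for $x,y$; $r$ is a $\mathsf{one}$ link associated with $r$, $\mathsf{new}$ an unassociated $\mathsf{one}$ link; $\mathsf{tt}$ and $\mathsf{ff}$ are an unassociated $\mathsf{one}$ link followed by a sync link labelled by the identity, respectively by the negation gate $X$; $\mathsf U_n$ is the $\wp$ of the conclusions of an axiom on $1^{\otimes n}$ whose positive conclusion is followed by a sync link labelled $\mathsf U_n$; $\mathsf{meas}$ is the $\wp$ of the two conclusions of a box with contents $\langle\mathsf{tt}\rangle,\langle\mathsf{ff}\rangle$; $\mathsf{if}\,t\,\mathsf{then}\,u\,\mathsf{else}\,v$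 is the cut of $\langle t\rangle$ with the lock of a box with contents $\langle u\rangle,\langle v\rangle$. For a closure $C=[Q,t]$ of type $A$, $\langle C\rangle$ is the translation of $t$ with the register $Q$, and $\langle\mathscr D\rangle$ is the image of the distribution $\mathscr D$ under $\langle\cdot\rangle$. **Proposition (Simulation).** For every quantum closure $C$ of type $A$, $\langle C\rangle$ is a quantum net; and for every distribution $\mathscr D$ of quantum closures of type $A$, if $C\Rightarrow\mathscr D$, then $\langle C\rangle\leadsto\langle\mathscr D\rangle$. -/

import Mathlib

open scoped NNReal

noncomputable section

namespace QSMLL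

/-! ## Finite distributions and multi-step probabilistic reduction

A finite distribution written `{x₁^p₁, …, xₙ^pₙ}` is given as the list `[(p₁, x₁), …, (pₙ, xₙ)]`;
distributions as functions are finitely supported functions `X →₀ ℝ≥0`. -/

/-- Multi-step reduction generated by a one-step relation between points and distributions:
`x` reduces to `{x^1}`; and if `x` steps to `{y₁^p₁, …, yₙ^pₙ}` and every `yᵢ` reduces to `Eᵢ`,
then `x` reduces to `∑ᵢ pᵢ • Eᵢ`. -/
inductive Multi {X : Type*} (step : X → List (ℝ≥0 × X) → Prop) : X → (X →₀ ℝ≥0) → Prop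
  | refl (x : X) : Multi step x (Finsupp.single x 1)
  | step (x : X) (l : List (ℝ≥0 × X)) (E : Fin l.length → X →₀ ℝ≥0) :
      step x l → (∀ i, Multi step (l.get i).2 (E i)) →
      Multi step x (∑ i, (l.get i).1 • E i)

/-- Push a listed distribution forward along a map. -/
def mapList {X Y : Type*} (f : X → Y) (l : List (ℝ≥0 × X)) : List (ℝ≥0 × Y) :=
  l.map (fun q => (q.1, f q.2))

/-! ## Quantum registers

For a finite set `V` of quantum variables, a basis vector of `ℍ(SUB(V))`, that is, a function
`V → {0,1}`, is encoded by the set `s ⊆ V` of the variables to which it assigns `1`.  A vector is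
the function `Q` of its coordinates, zero on the sets that are not contained in `V`. -/

/-- Coordinates of a register. -/
abbrev Reg : Type := Finset ℕ → ℂ

namespace Reg

/-- `Q` is a normalized vector of `ℍ(SUB(V))`. -/
def IsState (V : Finset ℕ) (Q : Reg) : Prop :=
  (∀ s, ¬ s ⊆ V → Q s = 0) ∧ ∑ s ∈ V.powerset, ‖Q s‖ ^ 2 = 1

/-- `Q ⊗ |r ← 0⟩`, where `r` is a variable that is not in the register `Q`. -/
def addZero (Q : Reg) (r : ℕ) : Reg := fun s => if r ∈ s then 0 else Q s

/-- The probability of observing the bit `b` when measuring `r` in `Q`. -/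
def prob (V : Finset ℕ) (Q : Reg) (r : ℕ) (b : Bool) : ℝ≥0 :=
  ∑ s ∈ V.powerset.filter (fun s => decide (r ∈ s) = b), ‖Q s‖₊ ^ 2

/-- The state, on the variables `V \ {r}`, after the bit `b` has been observed for `r`: the
projection of `Q` into the subspace in which `r` is assigned to `b`, normalized. -/
def proj (V : Finset ℕ) (Q : Reg) (r : ℕ) (b : Bool) : Reg := fun s =>
  if r ∈ s then 0
  else Q (if b then insert r s else s) / (Real.sqrt (prob V Q r b) : ℂ)

/-- Overwrite the bits of the variables `rs 0, …, rs (n-1)` by `y 0, …, y (n-1)`. -/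
def setBits {n : ℕ} (rs : Fin n → ℕ) (y : Fin n → Bool) (s : Finset ℕ) : Finset ℕ :=
  (s \ Finset.univ.image rs) ∪ (Finset.univ.filter (fun i => y i = true)).image rs

/-- The operator `U` on `n` qubits applied to the (distinct) variables `rs 0, …, rs (n-1)`. -/
def apply {n : ℕ} (U : Matrix (Fin n → Bool) (Fin n → Bool) ℂ) (rs : Fin n → ℕ) (Q : Reg) : Reg :=
  fun s => ∑ y : Fin n → Bool, U (fun i => decide (rs i ∈ s)) y * Q (setBits rs y s)

/-- Change the names of the quantum variables along a bijection. -/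
def rename (τ : Equiv.Perm ℕ) (Q : Reg) : Reg := fun s => Q (s.map τ.symm.toEmbedding)

end Reg

/-- The unitary operators on `n` qubits. -/
abbrev QGate (n : ℕ) : Type := Matrix.unitaryGroup (Fin n → Bool) ℂ

/-- The distribution of the outcomes of a measurement; outcomes of probability `0` are left out. -/
def measList {X : Type*} (p : Bool → ℝ≥0) (x : Bool → X) : List (ℝ≥0 × X) :=
  open Classical in
  ([false, true].filter (fun b => decide (p b ≠ 0))).map (fun b => (p b, x b))

/-! ## The linear quantum λ-calculus -/

/-- A finite set of symbols, each denoting a unitary operator of positive arity. -/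
structure GateSet where
  Op : Type
  finite : Finite Op
  arity : Op → ℕ
  arity_pos : ∀ u, 0 < arity u
  den : ∀ u, QGate (arity u)

/-- Types `A, B ::= 𝔹 | ℚ | A ⊸ B | A ⊗ B`. -/
inductive Ty : Type
  | bool : Ty
  | qbit : Ty
  | arr : Ty → Ty → Ty
  | tens : Ty → Ty → Ty

/-- `A^{⊗ n} = A ⊗ (A ⊗ ⋯ )`, for `n ≥ 1`. -/
def Ty.pow (A : Ty) : ℕ → Ty
  | 0 => A
  | 1 => A
  | n + 2 => .tens A (Ty.pow A (n + 1))

/-- Terms.  λ-variables are de Bruijn indices; quantum variables are named by natural numbers.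
Abstractions `λx:A. t` carry the type of the bound variable, so that a typing judgment determines
its derivation and typable terms stand for type derivations.  In `letp t u`, i.e.
`let ⟨x, y⟩ = t in u`, the index `0` of `u` is `y` and the index `1` is `x`. -/
inductive Tm (G : GateSet) : Type
  | var : ℕ → Tm G
  | qvar : ℕ → Tm G
  | lam : Ty → Tm G → Tm G
  | app : Tm G → Tm G → Tm G
  | pair : Tm G → Tm G → Tm G
  | letp : Tm G → Tm G → Tm G
  | new : Tm G
  | tt : Tm G
  | ff : Tm G
  | meas : Tm G
  | gate : G.Op → Tm G
  | ite : Tm G → Tm G → Tm G → Tm G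

/-- Extend a map on de Bruijn indices with a value for the innermost variable. -/
def scons {α : Type*} (a : α) (f : ℕ → α) : ℕ → α
  | 0 => a
  | n + 1 => f n

/-- Environments: partial maps from λ-variables to types. -/
abbrev Ctx : Type := ℕ → Option Ty

/-- The empty environment. -/
def Ctx.nil : Ctx := fun _ => none

/-- `Γ` is the disjoint union of `Γ₁` and `Γ₂`. -/
def Ctx.Split (Γ Γ₁ Γ₂ : Ctx) : Prop :=
  ∀ i, (Γ₁ i = Γ i ∧ Γ₂ i = none) ∨ (Γ₁ i = none ∧ Γ₂ i = Γ i)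

/-- Typing judgments `Γ, V ⊢ t : A`, with `Γ` an environment and `V` a set of quantum variables. -/
inductive HasType {G : GateSet} : Ctx → Finset ℕ → Tm G → Ty → Prop
  | var (i : ℕ) (A : Ty) : HasType (Function.update Ctx.nil i (some A)) ∅ (.var i) A
  | qvar (r : ℕ) : HasType Ctx.nil {r} (.qvar r) .qbit
  | lam {Γ V A B t} : HasType (scons (some A) Γ) V t B → HasType Γ V (.lam A t) (.arr A B)
  | app {Γ Γ₁ Γ₂ V₁ V₂ A B t u} : Ctx.Split Γ Γ₁ Γ₂ → Disjoint V₁ V₂ →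
      HasType Γ₁ V₁ t (.arr A B) → HasType Γ₂ V₂ u A → HasType Γ (V₁ ∪ V₂) (.app t u) B
  | pair {Γ Γ₁ Γ₂ V₁ V₂ A B t u} : Ctx.Split Γ Γ₁ Γ₂ → Disjoint V₁ V₂ →
      HasType Γ₁ V₁ t A → HasType Γ₂ V₂ u B → HasType Γ (V₁ ∪ V₂) (.pair t u) (.tens A B)
  | letp {Γ Γ₁ Γ₂ V₁ V₂ A B C t u} : Ctx.Split Γ Γ₁ Γ₂ → Disjoint V₁ V₂ →
      HasType Γ₁ V₁ t (.tens A B) → HasType (scons (some B) (scons (some A) Γ₂)) V₂ u C →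
      HasType Γ (V₁ ∪ V₂) (.letp t u) C
  | new : HasType Ctx.nil ∅ .new .qbit
  | tt : HasType Ctx.nil ∅ .tt .bool
  | ff : HasType Ctx.nil ∅ .ff .bool
  | meas : HasType Ctx.nil ∅ .meas (.arr .qbit .bool)
  | gate (u : G.Op) : HasType Ctx.nil ∅ (.gate u)
      (.arr (Ty.pow .qbit (G.arity u)) (Ty.pow .qbit (G.arity u)))
  | ite {Γ V A t u v} : HasType Γ V t .bool → HasType Ctx.nil ∅ u A → HasType Ctx.nil ∅ v A →
      HasType Γ V (.ite t u v) A

namespace Tm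

variable {G : GateSet}

/-- Apply `g` to the quantum variables. -/
def mapQ (g : ℕ → ℕ) : Tm G → Tm G
  | var i => var i
  | qvar r => qvar (g r)
  | lam A t => lam A (mapQ g t)
  | app t u => app (mapQ g t) (mapQ g u)
  | pair t u => pair (mapQ g t) (mapQ g u)
  | letp t u => letp (mapQ g t) (mapQ g u)
  | new => new
  | tt => tt
  | ff => ff
  | meas => meas
  | gate a => gate a
  | ite t u v => ite (mapQ g t) (mapQ g u) (mapQ g v)

/-- Replace the index `k` by a term `s` without free λ-variables (no λ-variable is free in a redex
of a closure, so that `s` never has to be lifted), and lower the indices above `k`. -/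
def subst (s : Tm G) : ℕ → Tm G → Tm G
  | k, var i => if i = k then s else if k < i then var (i - 1) else var i
  | _, qvar r => qvar r
  | k, lam A t => lam A (subst s (k + 1) t)
  | k, app t u => app (subst s k t) (subst s k u)
  | k, pair t u => pair (subst s k t) (subst s k u)
  | k, letp t u => letp (subst s k t) (subst s (k + 2) u)
  | _, new => new
  | _, tt => tt
  | _, ff => ff
  | _, meas => meas
  | _, gate a => gate a
  | k, ite t u v => ite (subst s k t) (subst s k u) (subst s k v)

/-- Values. -/
inductive IsValue : Tm G → Prop
  | qvar (r : ℕ) : IsValue (qvar r)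
  | lam (A : Ty) (t : Tm G) : IsValue (lam A t)
  | pair {a b : Tm G} : IsValue a → IsValue b → IsValue (pair a b)
  | new : IsValue new
  | tt : IsValue tt
  | ff : IsValue ff
  | meas : IsValue meas
  | gate (u : G.Op) : IsValue (gate u)

/-- The tuple `⟨r₁, ⟨r₂, ⋯ rₙ⟩⟩` of quantum variables, for `n ≥ 1`. -/
def tuple : List ℕ → Tm G
  | [] => tt
  | [r] => qvar r
  | r :: r' :: rs => pair (qvar r) (tuple (r' :: rs))

end Tm

/-- Evaluation contexts `E ::= [·] | E t | a E | ⟨E, t⟩ | ⟨a, E⟩ | let ⟨x,y⟩ = E in t |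
if E then t else u`, with `a` a value. -/
inductive EvalCtx (G : GateSet) : Type
  | hole : EvalCtx G
  | appL : EvalCtx G → Tm G → EvalCtx G
  | appR (a : Tm G) : a.IsValue → EvalCtx G → EvalCtx G
  | pairL : EvalCtx G → Tm G → EvalCtx G
  | pairR (a : Tm G) : a.IsValue → EvalCtx G → EvalCtx G
  | letp : EvalCtx G → Tm G → EvalCtx G
  | ite : EvalCtx G → Tm G → Tm G → EvalCtx G

/-- `E[t]`. -/
def EvalCtx.fill {G : GateSet} : EvalCtx G → Tm G → Tm G
  | hole, t => t
  | appL E u, t => .app (E.fill t) u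
  | appR a _ E, t => .app a (E.fill t)
  | pairL E u, t => .pair (E.fill t) u
  | pairR a _ E, t => .pair a (E.fill t)
  | letp E u, t => .letp (E.fill t) u
  | ite E u v, t => .ite (E.fill t) u v

/-- A register together with a term: `[Q, t]`, with `V` the set of variables of `Q`. -/
structure Raw (G : GateSet) where
  V : Finset ℕ
  Q : Reg
  t : Tm G

namespace Raw

variable {G : GateSet}

/-- Rename the quantum variables of a closure, in the register and in the term. -/
def rename (τ : Equiv.Perm ℕ) (c : Raw G) : Raw G :=
  ⟨c.V.map τ.toEmbedding, c.Q.rename τ, c.t.mapQ τ⟩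

/-- `[Q, t]` is a quantum closure of type `A`: `Q` is normalized in `ℍ(SUB(V))` and `V ⊢ t : A`. -/
def IsClosure (A : Ty) (c : Raw G) : Prop :=
  c.Q.IsState c.V ∧ HasType Ctx.nil c.V c.t A

/-- One-step reduction. -/
inductive Step : Raw G → List (ℝ≥0 × Raw G) → Prop
  | beta (V Q) (E : EvalCtx G) (A t u) :
      Step ⟨V, Q, E.fill (.app (.lam A t) u)⟩ [(1, ⟨V, Q, E.fill (Tm.subst u 0 t)⟩)]
  | letp (V Q) (E : EvalCtx G) (t u v) :
      Step ⟨V, Q, E.fill (.letp (.pair t u) v)⟩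
        [(1, ⟨V, Q, E.fill (Tm.subst t 0 (Tm.subst u 0 v))⟩)]
  | iteTT (V Q) (E : EvalCtx G) (t u) :
      Step ⟨V, Q, E.fill (.ite .tt t u)⟩ [(1, ⟨V, Q, E.fill t⟩)]
  | iteFF (V Q) (E : EvalCtx G) (t u) :
      Step ⟨V, Q, E.fill (.ite .ff t u)⟩ [(1, ⟨V, Q, E.fill u⟩)]
  | new (V Q) (E : EvalCtx G) (r) : r ∉ V →
      Step ⟨V, Q, E.fill .new⟩ [(1, ⟨insert r V, Q.addZero r, E.fill (.qvar r)⟩)]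
  | gate (V Q) (E : EvalCtx G) (a : G.Op) (rs : Fin (G.arity a) → ℕ) :
      Step ⟨V, Q, E.fill (.app (.gate a) (Tm.tuple (List.ofFn rs)))⟩
        [(1, ⟨V, Reg.apply (G.den a).1 rs Q, E.fill (Tm.tuple (List.ofFn rs))⟩)]
  | meas (V Q) (E : EvalCtx G) (r) :
      Step ⟨V, Q, E.fill (.app .meas (.qvar r))⟩
        (measList (Reg.prob V Q r) (fun b =>
          ⟨V.erase r, Reg.proj V Q r b, E.fill (if b then .ff else .tt)⟩))

end Raw

/-- Quantum closures of type `A`, modulo renaming of quantum variables. -/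
def Closure (G : GateSet) (A : Ty) : Type :=
  Quot (fun c d : {c : Raw G // c.IsClosure A} => ∃ τ : Equiv.Perm ℕ, d.1 = c.1.rename τ)

namespace Closure

variable {G : GateSet} {A : Ty}

/-- The quantum closure represented by `[Q, t]`. -/
def mk (c : {c : Raw G // c.IsClosure A}) : Closure G A := Quot.mk _ c

/-- One-step reduction `C ↦ 𝒟`. -/
def Step (C : Closure G A) (l : List (ℝ≥0 × Closure G A)) : Prop :=
  ∃ (c : {c : Raw G // c.IsClosure A}) (m : List (ℝ≥0 × {c : Raw G // c.IsClosure A})),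
    mk c = C ∧ c.1.Step (mapList Subtype.val m) ∧ mapList mk m = l

/-- Multi-step reduction `C ⇒ 𝒟`. -/
def Reduces : Closure G A → (Closure G A →₀ ℝ≥0) → Prop := Multi Step

end Closure

/-! ## Formulas and structures -/

/-- Formulas of multiplicative linear logic with units. -/
inductive Formula : Type
  | one : Formula
  | bot : Formula
  | var : ℕ → Formula
  | nvar : ℕ → Formula
  | tens : Formula → Formula → Formula
  | par : Formula → Formula → Formula
  deriving DecidableEq

namespace Formula

/-- Linear negation. -/
def neg : Formula → Formula
  | one => bot
  | bot => one
  | var n => nvar n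
  | nvar n => var n
  | tens A B => par A.neg B.neg
  | par A B => tens A.neg B.neg

/-- Positive formulas `P ::= 1 | P ⊗ P`. -/
def isPos : Formula → Bool
  | one => true
  | tens A B => A.isPos && B.isPos
  | _ => false

/-- Negative formulas `N ::= ⊥ | N ⅋ N`. -/
def isNeg : Formula → Bool
  | bot => true
  | par A B => A.isNeg && B.isNeg
  | _ => false

/-- The number of occurrences of atoms. -/
def atoms : Formula → ℕ
  | tens A B => A.atoms + B.atoms
  | par A B => A.atoms + B.atoms
  | _ => 1

end Formula

/-- Edges: a name (names are lists of numbers, which makes it easy to choose fresh ones) and the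
formula that labels the edge. -/
structure Edge : Type where
  name : List ℕ
  ty : Formula
  deriving DecidableEq

/-- Links (nodes) of structures with boxes, given with their conclusions and premises.
* `ax a b`: an axiom with conclusions `a`, `b`;  `cut a b`: a cut with premises `a`, `b`;
* `tens a b c`, `par a b c`: premises `a`, `b` and conclusion `c`;
* `one q e`: a link of sort `one` with conclusion `e`; `q = some r` says that the variable `r` of
  the quantum register is associated with the link, `q = none` that none is;
* `sync U [(e₁, f₁), …]`: a synchronization link labelled with the unitary operator `U`, with
  premises `e₁, …` and corresponding conclusions `f₁, …`;
* `box l Γ R S`: a box with lock `l` and other conclusions `Γ`, that contains the two structures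
  `R`, `S`, both with conclusions `Γ`. -/
inductive Link : Type
  | ax : Edge → Edge → Link
  | cut : Edge → Edge → Link
  | tens : Edge → Edge → Edge → Link
  | par : Edge → Edge → Edge → Link
  | one : Option ℕ → Edge → Link
  | sync : {n : ℕ} → QGate n → List (Edge × Edge) → Link
  | box : Edge → List Edge → List Link → List Link → Link

mutual
/-- Apply `f` to all edges and `g` to all quantum variables, inside boxes too. -/
def Link.map (f : Edge → Edge) (g : ℕ → ℕ) : Link → Link
  | .ax a b => .ax (f a) (f b)
  | .cut a b => .cut (f a) (f b)
  | .tens a b c => .tens (f a) (f b) (f c)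
  | .par a b c => .par (f a) (f b) (f c)
  | .one q e => .one (q.map g) (f e)
  | .sync U io => .sync U (io.map (fun x => (f x.1, f x.2)))
  | .box l Γ R S => .box (f l) (Γ.map f) (Link.mapList f g R) (Link.mapList f g S)
/-- The same for lists of links. -/
def Link.mapList (f : Edge → Edge) (g : ℕ → ℕ) : List Link → List Link
  | [] => []
  | x :: L => Link.map f g x :: Link.mapList f g L
end

mutual
/-- All edges attached to a link, including the edges in boxes. -/
def Link.edges : Link → List Edge
  | .ax a b => [a, b]
  | .cut a b => [a, b]
  | .tens a b c => [a, b, c]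
  | .par a b c => [a, b, c]
  | .one _ e => [e]
  | .sync _ io => io.map Prod.fst ++ io.map Prod.snd
  | .box l Γ R S => l :: Γ ++ Link.edgesList R ++ Link.edgesList S
/-- The same for lists of links. -/
def Link.edgesList : List Link → List Edge
  | [] => []
  | x :: L => Link.edges x ++ Link.edgesList L
end

mutual
/-- The conclusions of a link and those of the links in boxes; conclusions of the contents of a
box are counted only once, as conclusions of the box. -/
def Link.sources : Link → List Edge
  | .ax a b => [a, b]
  | .cut _ _ => []
  | .tens _ _ c => [c]
  | .par _ _ c => [c]
  | .one _ e => [e]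
  | .sync _ io => io.map Prod.snd
  | .box l Γ R S => l :: Γ ++ (Link.sourcesList R).filter (fun e => decide (e ∉ Γ)) ++
      (Link.sourcesList S).filter (fun e => decide (e ∉ Γ))
/-- The same for lists of links. -/
def Link.sourcesList : List Link → List Edge
  | [] => []
  | x :: L => Link.sources x ++ Link.sourcesList L
end

mutual
/-- The quantum variables associated with `one` links, at all depths. -/
def Link.qvars : Link → List ℕ
  | .one (some r) _ => [r]
  | .box _ _ R S => Link.qvarsList R ++ Link.qvarsList S
  | _ => []
/-- The same for lists of links. -/
def Link.qvarsList : List Link → List ℕ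
  | [] => []
  | x :: L => Link.qvars x ++ Link.qvarsList L
end

namespace Link

/-- The quantum variable associated with a `one` link. -/
def qvar? : Link → Option ℕ
  | one q _ => q
  | _ => none

/-- Premises of a node of the `0`-graph, where boxes count as nodes without premises. -/
def prems : Link → List Edge
  | cut a b => [a, b]
  | tens a b _ => [a, b]
  | par a b _ => [a, b]
  | sync _ io => io.map Prod.fst
  | _ => []

/-- Conclusions of a node of the `0`-graph. -/
def concls : Link → List Edge
  | ax a b => [a, b]
  | cut _ _ => []
  | tens _ _ c => [c]
  | par _ _ c => [c]
  | one _ e => [e]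
  | sync _ io => io.map Prod.snd
  | box l Γ _ _ => l :: Γ

/-- Edges of which a switching path uses at most one: the premises of a `par` link; the out-edges
of a sync link, that is, its positive conclusions and its negative premises. -/
def exclusive : Link → List Edge
  | par a b _ => [a, b]
  | sync _ io => io.map (fun x => if x.1.ty.isPos then x.2 else x.1)
  | _ => []

/-- The labels of the edges at a link are as the sort of the link requires. -/
def Typed : Link → Prop
  | ax a b => b.ty = a.ty.neg
  | cut a b => b.ty = a.ty.neg
  | tens a b c => c.ty = .tens a.ty b.ty
  | par a b c => c.ty = .par a.ty b.ty
  | one _ e => e.ty = .one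
  | sync (n := n) _ io =>
      (∀ x ∈ io, x.1.ty = x.2.ty ∧ (x.1.ty.isPos = true ∨ x.1.ty.isNeg = true)) ∧
      n = (io.map (fun x => x.1.ty.atoms)).sum
  | box l _ _ _ => l.ty = .bot

end Link

/-! ## Correctness -/

/-- The edge `e` joins the nodes `i` and `j` of the `0`-graph of `L`. -/
def Joins (L : List Link) (e : Edge) (i j : Fin L.length) : Prop :=
  (e ∈ (L.get i).concls ∧ e ∈ (L.get j).prems) ∨ (e ∈ (L.get j).concls ∧ e ∈ (L.get i).prems)

/-- There is a cyclic switching path in the `0`-graph of `L`: distinct nodes `v 0, …, v k` and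
distinct edges `e 0, …, e k`, with `e j` joining `v j` to the (cyclically) next node, that use at
most one of the premises of each `par` link and at most one out-edge of each sync link. -/
def SwitchingCycle (L : List Link) : Prop :=
  ∃ (k : ℕ) (v : Fin (k + 1) → Fin L.length) (e : Fin (k + 1) → Edge),
    Function.Injective v ∧ Function.Injective e ∧ (∀ j, Joins L (e j) (v j) (v (j + 1))) ∧
    ∀ x ∈ L, ∀ a ∈ x.exclusive, ∀ b ∈ x.exclusive,
      a ∈ Set.range e → b ∈ Set.range e → a = b

/-- `L` is a correct structure (a net) with conclusions `Γ`.  The conditions say: the labels fit;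
edges are distinct, inside and outside the boxes, and each is the conclusion of one link; each edge
of the `0`-graph is either the premise of one link or pending, the pending edges being `Γ`; the
`0`-graph has no switching cycle; and the contents of the boxes are correct. -/
inductive Correct : List Link → List Edge → Prop
  | intro (L : List Link) (Γ : List Edge) :
      (∀ x ∈ L, x.Typed) →
      (Link.sourcesList L).Nodup →
      (L.flatMap Link.prems ++ Γ).Perm (L.flatMap Link.concls) →
      ¬ SwitchingCycle L →
      (∀ l Δ R S, Link.box l Δ R S ∈ L → Correct R Δ) →
      (∀ l Δ R S, Link.box l Δ R S ∈ L → Correct S Δ) →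
      Correct L Γ

/-! ## Quantum nets -/

/-- A structure (links and conclusions) with a quantum register `Q` on the variables `V`. -/
structure QStruct : Type where
  links : List Link
  concl : List Edge
  V : Finset ℕ
  Q : Reg

/-- `N` is a quantum net: its structure is correct, `Q` is normalized in `ℍ(SUB(V))`, and the
variables in `V` correspond bijectively to some `one` links, all of depth `0`. -/
structure QStruct.IsNet (N : QStruct) : Prop where
  correct : Correct N.links N.concl
  state : N.Q.IsState N.V
  nodup : (N.links.filterMap Link.qvar?).Nodup
  vars : (N.links.filterMap Link.qvar?).toFinset = N.V
  depth : ∀ l Γ R S, Link.box l Γ R S ∈ N.links →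
    Link.qvarsList R = [] ∧ Link.qvarsList S = []

/-- Presentations of the same graph: the links are listed in another order, or the two edges at an
axiom or a cut are exchanged, inside boxes too. -/
inductive SameLinks : List Link → List Link → Prop
  | perm {L L'} : L.Perm L' → SameLinks L L'
  | ax (a b L) : SameLinks (.ax a b :: L) (.ax b a :: L)
  | cut (a b L) : SameLinks (.cut a b :: L) (.cut b a :: L)
  | box (l Γ L) {R R' S S'} : SameLinks R R' → SameLinks S S' →
      SameLinks (.box l Γ R S :: L) (.box l Γ R' S' :: L)
  | trans {L L' L''} : SameLinks L L' → SameLinks L' L'' → SameLinks L L''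

/-- Isomorphism: other presentations of the same graph, label-preserving injective renaming of the
edges, and renaming of the variables of the register. -/
inductive QStruct.Iso : QStruct → QStruct → Prop
  | same {L L'} (Γ V Q) : SameLinks L L' → QStruct.Iso ⟨L, Γ, V, Q⟩ ⟨L', Γ, V, Q⟩
  | edges (L Γ V Q) (f : Edge → Edge) : (∀ e, (f e).ty = e.ty) →
      Set.InjOn f {e | e ∈ Link.edgesList L ∨ e ∈ Γ} →
      QStruct.Iso ⟨L, Γ, V, Q⟩ ⟨Link.mapList f id L, Γ.map f, V, Q⟩
  | qvars (L Γ V Q) (τ : Equiv.Perm ℕ) :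
      QStruct.Iso ⟨L, Γ, V, Q⟩ ⟨Link.mapList id τ L, Γ, V.map τ.toEmbedding, Reg.rename τ Q⟩

/-- Quantum structures up to isomorphism. -/
def QNet : Type := Quot QStruct.Iso

/-- The class of a quantum structure. -/
def QNet.mk (N : QStruct) : QNet := Quot.mk _ N

/-- The class consists of quantum nets. -/
def QNet.IsNet (n : QNet) : Prop := ∃ N : QStruct, QNet.mk N = n ∧ N.IsNet

/-- `e` does not occur in `L` or in `Γ`. -/
def FreshEdge (e : Edge) (L : List Link) (Γ : List Edge) : Prop :=
  e ∉ Link.edgesList L ∧ e ∉ Γ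

/-- One-step reduction, at depth `0`.  The links displayed are the redex, `K` are the others. -/
inductive QStruct.Step : QStruct → List (ℝ≥0 × QStruct) → Prop
  /-- `ax/cut`: the edges `a` and `c` become one edge -/
  | axCut (a b c K Γ V Q) : a ≠ c →
      QStruct.Step ⟨.cut a b :: .ax b c :: K, Γ, V, Q⟩
        [(1, ⟨Link.mapList (Function.update id a c) id K, Γ, V, Q⟩)]
  /-- `⊗/⅋` -/
  | tensPar (a b c a' b' c' K Γ V Q) :
      QStruct.Step ⟨.cut c c' :: .tens a b c :: .par a' b' c' :: K, Γ, V, Q⟩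
        [(1, ⟨.cut a a' :: .cut b b' :: K, Γ, V, Q⟩)]
  /-- `sync/⊗` -/
  | syncTens (a b c f a' b' K Γ V Q) {n : ℕ} (U : QGate n) (io₁ io₂) :
      a'.ty = a.ty → b'.ty = b.ty → a' ≠ b' →
      FreshEdge a' (.tens a b c :: .sync U (io₁ ++ (c, f) :: io₂) :: K) Γ →
      FreshEdge b' (.tens a b c :: .sync U (io₁ ++ (c, f) :: io₂) :: K) Γ →
      QStruct.Step ⟨.tens a b c :: .sync U (io₁ ++ (c, f) :: io₂) :: K, Γ, V, Q⟩
        [(1, ⟨.tens a' b' f :: .sync U (io₁ ++ (a, a') :: (b, b') :: io₂) :: K, Γ, V, Q⟩)]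
  /-- `sync/⅋` -/
  | syncPar (a b c f a' b' K Γ V Q) {n : ℕ} (U : QGate n) (io₁ io₂) :
      a'.ty = a.ty → b'.ty = b.ty → a' ≠ b' →
      FreshEdge a' (.par a b c :: .sync U (io₁ ++ (c, f) :: io₂) :: K) Γ →
      FreshEdge b' (.par a b c :: .sync U (io₁ ++ (c, f) :: io₂) :: K) Γ →
      QStruct.Step ⟨.par a b c :: .sync U (io₁ ++ (c, f) :: io₂) :: K, Γ, V, Q⟩
        [(1, ⟨.par a' b' f :: .sync U (io₁ ++ (a, a') :: (b, b') :: io₂) :: K, Γ, V, Q⟩)]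
  /-- `ax/sync`: from the positive to the negative conclusion of an axiom -/
  | syncAx (e f g g' K Γ V Q) {n : ℕ} (U : QGate n) (io₁ io₂) :
      e.ty.isPos = true → g'.ty = g.ty →
      FreshEdge g' (.ax e g :: .sync U (io₁ ++ (e, f) :: io₂) :: K) Γ →
      QStruct.Step ⟨.ax e g :: .sync U (io₁ ++ (e, f) :: io₂) :: K, Γ, V, Q⟩
        [(1, ⟨.ax f g' :: .sync U (io₁ ++ (g', g) :: io₂) :: K, Γ, V, Q⟩)]
  /-- `cut/sync`: from the negative to the positive premise of a cut -/
  | syncCut (e f g g' K Γ V Q) {n : ℕ} (U : QGate n) (io₁ io₂) :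
      f.ty.isNeg = true → g'.ty = g.ty →
      FreshEdge g' (.cut f g :: .sync U (io₁ ++ (e, f) :: io₂) :: K) Γ →
      QStruct.Step ⟨.cut f g :: .sync U (io₁ ++ (e, f) :: io₂) :: K, Γ, V, Q⟩
        [(1, ⟨.cut e g' :: .sync U (io₁ ++ (g, g') :: io₂) :: K, Γ, V, Q⟩)]
  /-- a `one` link without quantum variable is linked to a new variable with value `0` -/
  | new (e r K Γ V Q) : r ∉ V →
      QStruct.Step ⟨.one none e :: K, Γ, V, Q⟩
        [(1, ⟨.one (some r) e :: K, Γ, insert r V, Reg.addZero Q r⟩)]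
  /-- a sync link all of whose premises come from `one` links linked to the register -/
  | syncOne {n : ℕ} (U : QGate n) (rs : Fin n → ℕ) (es fs : Fin n → Edge) (K Γ V Q) :
      QStruct.Step
        ⟨.sync U (List.ofFn (fun i => (es i, fs i))) ::
          (List.ofFn (fun i => Link.one (some (rs i)) (es i)) ++ K), Γ, V, Q⟩
        [(1, ⟨List.ofFn (fun i => Link.one (some (rs i)) (fs i)) ++ K, Γ, V,
          Reg.apply U.1 rs Q⟩)]
  /-- opening a box: the variable linked to the `one` link is measured, and the outcome `0`
  (`false`) selects the first content, the outcome `1` (`true`) the second -/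
  | box (r e l Δ R S K Γ V Q) :
      QStruct.Step ⟨.cut e l :: .one (some r) e :: .box l Δ R S :: K, Γ, V, Q⟩
        (measList (Reg.prob V Q r) (fun b =>
          ⟨(if b then S else R) ++ K, Γ, V.erase r, Reg.proj V Q r b⟩))

/-- One-step reduction of quantum nets. -/
def QNet.Step (n : QNet) (l : List (ℝ≥0 × QNet)) : Prop :=
  ∃ (N : QStruct) (m : List (ℝ≥0 × QStruct)),
    QNet.mk N = n ∧ N.Step m ∧ mapList QNet.mk m = l

/-- Multi-step reduction of quantum nets to distributions of quantum nets. -/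
def QNet.Reduces : QNet → (QNet →₀ ℝ≥0) → Prop := Multi QNet.Step

/-! ## The translation -/

/-- Translation of types. -/
def Ty.toFormula : Ty → Formula
  | .bool => .one
  | .qbit => .one
  | .arr A B => .par A.toFormula.neg B.toFormula
  | .tens A B => .tens A.toFormula B.toFormula

/-- The identity gate. -/
def gateI : QGate 1 := 1

/-- The matrix of the negation gate. -/
def matX : Matrix (Fin 1 → Bool) (Fin 1 → Bool) ℂ := fun a b => if a 0 = b 0 then 0 else 1

/-- The negation gate. -/
def gateX : QGate 1 := ⟨matX, by
  rw [Matrix.mem_unitaryGroup_iff]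
  ext a b
  have e : ∀ f : (Fin 1 → Bool) → ℂ, ∑ y, f y = f (fun _ => true) + f (fun _ => false) := fun f => by
    rw [← (Equiv.funUnique (Fin 1) Bool).symm.sum_comp]
    have h : ∀ b : Bool, (Equiv.funUnique (Fin 1) Bool).symm b = fun _ => b := fun b => by
      ext i; rw [Subsingleton.elim i default]; rfl
    simp [h]
  have hab : a = b ↔ a 0 = b 0 := ⟨fun h => by rw [h], fun h => by
    ext i; rw [Subsingleton.elim i 0, h]⟩
  rw [Matrix.mul_apply, e, Matrix.one_apply]
  cases ha : a 0 <;> cases hb : b 0 <;> simp [matX, Matrix.star_apply, hab, ha, hb]⟩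

variable {G : GateSet}

/-- The type of the unique derivation for `t`, given the types of the free λ-variables. -/
def tyOf : (ℕ → Ty) → Tm G → Ty
  | Γ, .var i => Γ i
  | _, .qvar _ => .qbit
  | Γ, .lam A t => .arr A (tyOf (scons A Γ) t)
  | Γ, .app t _ => match tyOf Γ t with
    | .arr _ B => B
    | _ => .bool
  | Γ, .pair t u => .tens (tyOf Γ t) (tyOf Γ u)
  | Γ, .letp t u => match tyOf Γ t with
    | .tens A B => tyOf (scons B (scons A Γ)) u
    | _ => .bool
  | _, .new => .qbit
  | _, .tt => .bool
  | _, .ff => .bool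
  | _, .meas => .arr .qbit .bool
  | _, .gate a => .arr (Ty.pow .qbit (G.arity a)) (Ty.pow .qbit (G.arity a))
  | _, .ite _ u _ => tyOf (fun _ => .bool) u

/-- The two components of a tensor type. -/
def Ty.components : Ty → Ty × Ty
  | .tens A B => (A, B)
  | _ => (.bool, .bool)

/-- A name and a type for each free λ-variable; the edge for a variable `x : A` with name `p` is
labelled by `⟨A⟩^⊥`. -/
abbrev Env : Type := ℕ → List ℕ × Ty

/-- The environment for terms without free λ-variables. -/
def Env.nil : Env := fun _ => ([], .bool)

/-- The types in an environment. -/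
def Env.tys (ρ : Env) : ℕ → Ty := fun i => (ρ i).2

/-- Nets for truth values: a `one` link followed by a sync link labelled by `I` for `tt` and by `X`
for `ff`; `p` is the name of the edge in between, `o` the name of the conclusion. -/
def bitNet (U : QGate 1) (p o : List ℕ) : List Link :=
  [.one none ⟨p, .one⟩, .sync U [(⟨p, .one⟩, ⟨o, .one⟩)]]

/-- The translation of the type derivation of `t`, with edges named after the position `p`: the
conclusion for the variable `i` is the edge with name and type given by `ρ i`, and the conclusion
for the type of `t` is named `o`. -/
def translate : Env → List ℕ → List ℕ → Tm G → List Link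
  | ρ, _, o, .var i =>
      [.ax ⟨(ρ i).1, (ρ i).2.toFormula.neg⟩ ⟨o, (ρ i).2.toFormula⟩]
  | _, _, o, .qvar r => [.one (some r) ⟨o, .one⟩]
  | ρ, p, o, .lam A t =>
      let ρ' : Env := scons (1 :: p, A) ρ
      let B := (tyOf ρ'.tys t).toFormula
      .par ⟨1 :: p, A.toFormula.neg⟩ ⟨0 :: p, B⟩ ⟨o, .par A.toFormula.neg B⟩ ::
        translate ρ' (0 :: p) (0 :: p) t
  | ρ, p, o, .app t u =>
      let A := (tyOf ρ.tys u).toFormula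
      let B := (tyOf ρ.tys (.app t u)).toFormula
      .cut ⟨0 :: p, (tyOf ρ.tys t).toFormula⟩ ⟨3 :: p, .tens A B.neg⟩ ::
        .tens ⟨1 :: p, A⟩ ⟨2 :: p, B.neg⟩ ⟨3 :: p, .tens A B.neg⟩ ::
        .ax ⟨2 :: p, B.neg⟩ ⟨o, B⟩ ::
        (translate ρ (0 :: p) (0 :: p) t ++ translate ρ (1 :: p) (1 :: p) u)
  | ρ, p, o, .pair t u =>
      let A := (tyOf ρ.tys t).toFormula
      let B := (tyOf ρ.tys u).toFormula
      .tens ⟨0 :: p, A⟩ ⟨1 :: p, B⟩ ⟨o, .tens A B⟩ ::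
        (translate ρ (0 :: p) (0 :: p) t ++ translate ρ (1 :: p) (1 :: p) u)
  | ρ, p, o, .letp t u =>
      let AB := tyOf ρ.tys t
      let A := AB.components.1
      let B := AB.components.2
      let C : Formula := .par A.toFormula.neg B.toFormula.neg
      .cut ⟨0 :: p, AB.toFormula⟩ ⟨3 :: p, C⟩ ::
        .par ⟨1 :: p, A.toFormula.neg⟩ ⟨2 :: p, B.toFormula.neg⟩ ⟨3 :: p, C⟩ ::
        (translate ρ (0 :: p) (0 :: p) t ++
          translate (scons (2 :: p, B) (scons (1 :: p, A) ρ)) (4 :: p) o u)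
  | _, _, o, .new => [.one none ⟨o, .one⟩]
  | _, p, o, .tt => bitNet gateI (0 :: p) o
  | _, p, o, .ff => bitNet gateX (0 :: p) o
  | _, p, o, .meas =>
      [.par ⟨0 :: p, .bot⟩ ⟨1 :: p, .one⟩ ⟨o, .par .bot .one⟩,
        .box ⟨0 :: p, .bot⟩ [⟨1 :: p, .one⟩]
          (bitNet gateI (2 :: p) (1 :: p)) (bitNet gateX (3 :: p) (1 :: p))]
  | _, p, o, .gate a =>
      let P := (Ty.pow .qbit (G.arity a)).toFormula
      [.par ⟨0 :: p, P.neg⟩ ⟨2 :: p, P⟩ ⟨o, .par P.neg P⟩,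
        .ax ⟨0 :: p, P.neg⟩ ⟨1 :: p, P⟩,
        .sync (G.den a) [(⟨1 :: p, P⟩, ⟨2 :: p, P⟩)]]
  | ρ, p, o, .ite t u v =>
      let A := (tyOf Env.nil.tys u).toFormula
      .cut ⟨0 :: p, .one⟩ ⟨1 :: p, .bot⟩ ::
        .box ⟨1 :: p, .bot⟩ [⟨o, A⟩]
          (translate Env.nil (2 :: p) o u) (translate Env.nil (3 :: p) o v) ::
        translate ρ (0 :: p) (0 :: p) t

/-- The quantum structure of a closure `[Q, t]` of type `A`. -/
def Raw.toQStruct (A : Ty) (c : Raw G) : QStruct :=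
  ⟨translate Env.nil [] [] c.t, [⟨[], A.toFormula⟩], c.V, c.Q⟩

theorem tyOf_mapQ (g : ℕ → ℕ) (Γ : ℕ → Ty) (t : Tm G) : tyOf Γ (t.mapQ g) = tyOf Γ t := by
  induction t generalizing Γ <;> simp_all [Tm.mapQ, tyOf]

theorem mapList_append (f : Edge → Edge) (g : ℕ → ℕ) (L L' : List Link) :
    Link.mapList f g (L ++ L') = Link.mapList f g L ++ Link.mapList f g L' := by
  induction L <;> simp_all [Link.mapList]

theorem translate_mapQ (g : ℕ → ℕ) (ρ : Env) (p o : List ℕ) (t : Tm G) :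
    translate ρ p o (t.mapQ g) = Link.mapList id g (translate ρ p o t) := by
  induction t generalizing ρ p o <;>
    simp_all [Tm.mapQ, translate, Link.mapList, Link.map, mapList_append, tyOf_mapQ, bitNet, tyOf]

/-- The translation of quantum closures into quantum nets. -/
def Closure.toNet {A : Ty} : Closure G A → QNet :=
  Quot.lift (fun c => QNet.mk (c.1.toQStruct A)) (by
    rintro ⟨⟨V, Q, t⟩, hc⟩ ⟨d, hd⟩ ⟨τ, rfl⟩
    refine Quot.sound ?_
    have h := QStruct.Iso.qvars (translate Env.nil [] [] t) [⟨[], A.toFormula⟩] V Q τ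
    rw [← translate_mapQ] at h
    exact h)

end QSMLL

end

noncomputable section

namespace QSMLL

variable {G : GateSet}

/-! ## Positions and names -/

-- The simulation is cut elimination read through the translation. A λ-variable is used exactly
-- once, so the net of a term with a free variable contains exactly one axiom for it. Cutting that
-- conclusion against the net of a closed term `s` is one `ax/cut` step, and the result is the net
-- of the substituted term (`HasType.translate_subst`, `QNet.Red.cut_subst`). A β-redex or a
-- `let`-redex is first turned into such cuts by a `⊗/⅋` step. An evaluation context only surrounds
-- the redex by links that depend on the type of the term in the hole (`EvalCtx.translate_fill`),
-- and net reduction is local, so it suffices to treat redexes.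
--
-- For the quantum rules, `new` is a single net step. A gate applied to a tuple becomes a sync link
-- that commutes up the tree of `⊗` links until it rests on `one` links (`QNet.Red.sync_tensTree`,
-- `QNet.Red.gate`). A measurement opens a box with the same outcomes and probabilities as in the
-- calculus (`QNet.Reach.meas`). A conditional on a truth value also opens a box, but the measured
-- variable is fresh and in a basis state: one outcome has probability 1 and the register returns to
-- its former value (`Reg.prob_bit`, `Reg.proj_bit`, `QNet.Red.ite`). Each term step thus becomes
-- steps of probability one, or such steps followed by one branching step. This is the relation
-- `QNet.Reach`, which composes with further reduction of the outcomes; induction on the multi-step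
-- reduction concludes.
--
-- That translations are nets is shown by induction on typing. Labels and counts of premises and
-- conclusions are direct. Acyclicity holds because a translation is assembled from pieces that
-- share one edge, or whose shared edges are premises of one `⅋` (`Acyclic.append`).
--
-- Names carry the bookkeeping. Positions form a tree, every internal edge is named below the
-- position of its term, and `dig` gives the branch in which a name lies. Disjointness and freshness
-- reduce to comparing branches, and since nets are taken up to isomorphism a subnet may be moved to
-- another position (`QNet.mk_relocate`).

/-- The entry of the name `z` just before its suffix `p`, if `z` properly extends `p`. -/
def dig (p z : List ℕ) : Option ℕ := if p <:+ z then z.reverse[p.length]? else none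

theorem dig_eq_some {p z : List ℕ} {a : ℕ} : dig p z = some a ↔ ∃ w, z = w ++ a :: p := by
  unfold dig
  constructor
  · intro h
    split_ifs at h with hp
    obtain ⟨w, rfl⟩ := hp
    rcases List.eq_nil_or_concat w with rfl | ⟨w, b, rfl⟩
    · simp at h
    · simp at h
      exact ⟨w, by simp [h]⟩
  · rintro ⟨w, rfl⟩
    have : p <:+ w ++ a :: p := ⟨w ++ [a], by simp⟩
    rw [if_pos this]
    simp

@[simp] theorem dig_append (p w : List ℕ) (a : ℕ) : dig p (w ++ a :: p) = some a :=
  dig_eq_some.2 ⟨w, rfl⟩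

@[simp] theorem dig_one (p : List ℕ) (a : ℕ) : dig p (a :: p) = some a :=
  dig_eq_some.2 ⟨[], rfl⟩

@[simp] theorem dig_two (p : List ℕ) (a b : ℕ) : dig p (b :: a :: p) = some a :=
  dig_eq_some.2 ⟨[b], rfl⟩

@[simp] theorem dig_self (p : List ℕ) : dig p p = none := by
  rw [Option.eq_none_iff_forall_ne_some]
  intro a h
  obtain ⟨w, h⟩ := dig_eq_some.1 h
  have := congrArg List.length h
  simp at this
  omega

@[simp] theorem dig_nil (p : List ℕ) : dig p [] = none := by
  rw [Option.eq_none_iff_forall_ne_some]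
  intro a h
  obtain ⟨w, h⟩ := dig_eq_some.1 h
  simp at h

/-- Positions are extended at the front, so `a :: p` is the child of `p` in direction `a`, and
anything strictly below the child lies in that direction from `p`. With its contrapositive
`dig_cons_none` this settles nearly all questions of freshness. -/
theorem dig_cons {p z : List ℕ} {a : ℕ} (h : dig (a :: p) z ≠ none) : dig p z = some a := by
  obtain ⟨b, hb⟩ := Option.ne_none_iff_exists'.1 h
  obtain ⟨w, rfl⟩ := dig_eq_some.1 hb
  exact dig_eq_some.2 ⟨w ++ [b], by simp⟩

theorem dig_cons_none {p z : List ℕ} {a : ℕ} (h : dig p z ≠ some a) : dig (a :: p) z = none := by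
  by_contra h'
  exact h (dig_cons h')

theorem dig_ne_none_of_append {p z w : List ℕ} (h : dig (w ++ p) z ≠ none) : dig p z ≠ none := by
  obtain ⟨b, hb⟩ := Option.ne_none_iff_exists'.1 h
  obtain ⟨w', rfl⟩ := dig_eq_some.1 hb
  rcases List.eq_nil_or_concat w with rfl | ⟨w, c, rfl⟩
  · simp
  · have : dig p ((w' ++ b :: w) ++ c :: p) = some c := dig_append ..
    simp at this
    simp [this]

/-! ## Edges of links -/

theorem Link.mem_edgesList {L : List Link} {e : Edge} :
    e ∈ Link.edgesList L ↔ ∃ x ∈ L, e ∈ x.edges := by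
  induction L <;> simp_all [Link.edgesList]

theorem Link.edgesList_append (L L' : List Link) :
    Link.edgesList (L ++ L') = Link.edgesList L ++ Link.edgesList L' := by
  induction L <;> simp_all [Link.edgesList]

theorem Link.sourcesList_append (L L' : List Link) :
    Link.sourcesList (L ++ L') = Link.sourcesList L ++ Link.sourcesList L' := by
  induction L <;> simp_all [Link.sourcesList]

theorem Link.qvarsList_append (L L' : List Link) :
    Link.qvarsList (L ++ L') = Link.qvarsList L ++ Link.qvarsList L' := by
  induction L <;> simp_all [Link.qvarsList]

mutual
theorem Link.sources_subset : ∀ (x : Link), x.sources ⊆ x.edges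
  | .ax a b => by simp [Link.sources, Link.edges]
  | .cut a b => by simp [Link.sources, Link.edges]
  | .tens a b c => by simp [Link.sources, Link.edges]
  | .par a b c => by simp [Link.sources, Link.edges]
  | .one _ e => by simp [Link.sources, Link.edges]
  | .sync _ io => by simp [Link.sources, Link.edges]
  | .box l Γ R S => by
    have hR := Link.sourcesList_subset R
    have hS := Link.sourcesList_subset S
    intro e he
    simp only [Link.sources, Link.edges, List.mem_append, List.mem_cons, List.mem_filter] at he ⊢
    rcases he with (he | he) | he
    · exact Or.inl (Or.inl he)
    · exact Or.inl (Or.inr (hR he.1))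
    · exact Or.inr (hS he.1)
theorem Link.sourcesList_subset : ∀ (L : List Link), Link.sourcesList L ⊆ Link.edgesList L
  | [] => by simp [Link.sourcesList]
  | x :: L => by
    have h1 := Link.sources_subset x
    have h2 := Link.sourcesList_subset L
    intro e he
    simp only [Link.sourcesList, Link.edgesList, List.mem_append] at he ⊢
    exact he.imp (fun h => h1 h) (fun h => h2 h)
end

theorem Link.prems_subset (x : Link) : x.prems ⊆ x.edges := by
  cases x <;> simp [Link.prems, Link.edges]

theorem Link.concls_subset (x : Link) : x.concls ⊆ x.edges := by
  cases x <;> simp [Link.concls, Link.edges, List.subset_def] <;> grind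

mutual
theorem Link.map_congr {f f' : Edge → Edge} {g : ℕ → ℕ} :
    ∀ (x : Link), (∀ e ∈ x.edges, f e = f' e) → x.map f g = x.map f' g
  | .ax a b, h => by simp_all [Link.map, Link.edges]
  | .cut a b, h => by simp_all [Link.map, Link.edges]
  | .tens a b c, h => by simp_all [Link.map, Link.edges]
  | .par a b c, h => by simp_all [Link.map, Link.edges]
  | .one _ e, h => by simp_all [Link.map, Link.edges]
  | .sync _ io, h => by
    simp only [Link.map, Link.sync.injEq, heq_eq_eq, true_and]
    apply List.map_congr_left
    intro x hx
    rw [h x.1 (by simp only [Link.edges, List.mem_append]; exact Or.inl (List.mem_map_of_mem hx)),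
      h x.2 (by simp only [Link.edges, List.mem_append]; exact Or.inr (List.mem_map_of_mem hx))]
  | .box l Γ R S, h => by
    simp only [Link.edges, List.mem_append, List.mem_cons] at h
    simp only [Link.map, Link.box.injEq]
    exact ⟨h _ (by simp), List.map_congr_left fun e he => h e (by simp [he]),
      Link.mapList_congr R fun e he => h e (by simp [he]),
      Link.mapList_congr S fun e he => h e (by simp [he])⟩
theorem Link.mapList_congr {f f' : Edge → Edge} {g : ℕ → ℕ} :
    ∀ (L : List Link), (∀ e ∈ Link.edgesList L, f e = f' e) →
      Link.mapList f g L = Link.mapList f' g L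
  | [], h => rfl
  | x :: L, h => by
    simp only [Link.edgesList, List.mem_append] at h
    simp only [Link.mapList]
    rw [Link.map_congr x fun e he => h e (Or.inl he),
      Link.mapList_congr L fun e he => h e (Or.inr he)]
end

mutual
theorem Link.map_id' : ∀ (x : Link), x.map id id = x
  | .ax a b => by simp [Link.map]
  | .cut a b => by simp [Link.map]
  | .tens a b c => by simp [Link.map]
  | .par a b c => by simp [Link.map]
  | .one _ e => by simp [Link.map]
  | .sync _ io => by simp [Link.map]
  | .box l Γ R S => by simp [Link.map, Link.mapList_id R, Link.mapList_id S]
theorem Link.mapList_id : ∀ (L : List Link), Link.mapList id id L = L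
  | [] => rfl
  | x :: L => by simp [Link.mapList, Link.map_id' x, Link.mapList_id L]
end

theorem Link.mapList_eq_self {f : Edge → Edge} {L : List Link}
    (h : ∀ e ∈ Link.edgesList L, f e = e) : Link.mapList f id L = L := by
  rw [Link.mapList_congr (f' := id) L h, Link.mapList_id]

theorem Link.edgesList_perm {L L' : List Link} (h : L.Perm L') {e : Edge} :
    e ∈ Link.edgesList L ↔ e ∈ Link.edgesList L' := by
  simp only [Link.mem_edgesList, h.mem_iff]

theorem Formula.neg_neg (A : Formula) : A.neg.neg = A := by
  induction A <;> simp_all [Formula.neg]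

/-! ## Typing and environments -/

theorem Ctx.Split.left {Γ Γ₁ Γ₂ : Ctx} (h : Ctx.Split Γ Γ₁ Γ₂) {i A} (hi : Γ₁ i = some A) :
    Γ i = some A := by
  rcases h i with ⟨h1, h2⟩ | ⟨h1, h2⟩ <;> simp_all

theorem Ctx.Split.right {Γ Γ₁ Γ₂ : Ctx} (h : Ctx.Split Γ Γ₁ Γ₂) {i A} (hi : Γ₂ i = some A) :
    Γ i = some A := by
  rcases h i with ⟨h1, h2⟩ | ⟨h1, h2⟩ <;> simp_all

theorem Ctx.Split.nil {Γ₁ Γ₂ : Ctx} (h : Ctx.Split Ctx.nil Γ₁ Γ₂) :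
    Γ₁ = Ctx.nil ∧ Γ₂ = Ctx.nil := by
  constructor <;> funext i <;> rcases h i with ⟨h1, h2⟩ | ⟨h1, h2⟩ <;> simp_all [Ctx.nil]

/-- The types `τ` agree with the environment `Γ`. -/
def Agree (Γ : Ctx) (τ : ℕ → Ty) : Prop := ∀ i A, Γ i = some A → τ i = A

theorem Agree.nil (τ : ℕ → Ty) : Agree Ctx.nil τ := by intro i A h; simp [Ctx.nil] at h

theorem Agree.left {Γ Γ₁ Γ₂ : Ctx} {τ} (h : Agree Γ τ) (hs : Ctx.Split Γ Γ₁ Γ₂) : Agree Γ₁ τ :=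
  fun i A hi => h i A (hs.left hi)

theorem Agree.right {Γ Γ₁ Γ₂ : Ctx} {τ} (h : Agree Γ τ) (hs : Ctx.Split Γ Γ₁ Γ₂) : Agree Γ₂ τ :=
  fun i A hi => h i A (hs.right hi)

theorem Agree.scons {Γ : Ctx} {τ} (h : Agree Γ τ) (A : Ty) :
    Agree (QSMLL.scons (some A) Γ) (QSMLL.scons A τ) := by
  rintro (_ | i) B hi
  · simpa [QSMLL.scons] using hi
  · exact h i B hi

@[simp] theorem Env.tys_scons (n : List ℕ) (A : Ty) (ρ : Env) :
    Env.tys (scons (n, A) ρ) = scons A ρ.tys := by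
  funext i; cases i <;> rfl

/-- The functions read by `tyOf` are total and arbitrary off the domain of `Γ`; agreement on the
domain is enough. This turns the computed labels in `translate` into the types of the derivation. -/
theorem HasType.tyOf_eq {Γ V} {t : Tm G} {B} (h : HasType Γ V t B) :
    ∀ {τ}, Agree Γ τ → tyOf τ t = B := by
  induction h with
  | var i A => intro τ hτ; exact hτ i A (by simp)
  | qvar | new | tt | ff | meas | gate => intros; rfl
  | lam _ ih => intro τ hτ; simp [tyOf, ih (hτ.scons _)]
  | app hs _ _ _ ih₁ ih₂ => intro τ hτ; simp [tyOf, ih₁ (hτ.left hs)]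
  | pair hs _ _ _ ih₁ ih₂ => intro τ hτ; simp [tyOf, ih₁ (hτ.left hs), ih₂ (hτ.right hs)]
  | letp hs _ _ _ ih₁ ih₂ =>
    intro τ hτ; simp [tyOf, ih₁ (hτ.left hs), ih₂ (((hτ.right hs).scons _).scons _)]
  | ite _ _ _ _ ih₂ _ => intro τ hτ; simp [tyOf, ih₂ (Agree.nil _)]

/-- `ρ` names the variables of `Γ` injectively and by names that are not below `p` and differ from
`o`, which is not below `p` either. -/
structure Fits (Γ : Ctx) (ρ : Env) (p o : List ℕ) : Prop where
  ty : Agree Γ ρ.tys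
  fresh : ∀ i A, Γ i = some A → dig p (ρ i).1 = none
  ne : ∀ i A, Γ i = some A → (ρ i).1 ≠ o
  inj : ∀ i j A B, Γ i = some A → Γ j = some B → (ρ i).1 = (ρ j).1 → i = j
  out : dig p o = none

namespace Fits

variable {Γ Γ₁ Γ₂ : Ctx} {ρ : Env} {p o : List ℕ}

theorem nil (ρ : Env) (h : dig p o = none) : Fits Ctx.nil ρ p o :=
  ⟨Agree.nil _, by simp [Ctx.nil], by simp [Ctx.nil], by simp [Ctx.nil], h⟩

theorem mono (h : Fits Γ ρ p o) (hs : ∀ i A, Γ₁ i = some A → Γ i = some A) : Fits Γ₁ ρ p o :=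
  ⟨fun i A hi => h.ty i A (hs i A hi), fun i A hi => h.fresh i A (hs i A hi),
    fun i A hi => h.ne i A (hs i A hi),
    fun i j A B hi hj => h.inj i j A B (hs i A hi) (hs j B hj), h.out⟩

/-- For subterms whose output is their own position: a name is not strictly below itself, and no
variable is named `c :: p` because that lies below `p`. -/
theorem child (h : Fits Γ ρ p o) (c : ℕ) : Fits Γ ρ (c :: p) (c :: p) :=
  ⟨h.ty, fun i A hi => dig_cons_none (by simp [h.fresh i A hi]),
    fun i A hi he => by simpa [he] using h.fresh i A hi, h.inj, dig_self _⟩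

/-- For parts that keep the output of the whole term: the body of a `let` and the contents of a box.
-/
theorem childOut (h : Fits Γ ρ p o) (c : ℕ) : Fits Γ ρ (c :: p) o :=
  ⟨h.ty, fun i A hi => dig_cons_none (by simp [h.fresh i A hi]), h.ne, h.inj,
    dig_cons_none (by simp [h.out])⟩

theorem left (h : Fits Γ ρ p o) (hs : Ctx.Split Γ Γ₁ Γ₂) : Fits Γ₁ ρ p o :=
  h.mono fun _ _ => hs.left

theorem right (h : Fits Γ ρ p o) (hs : Ctx.Split Γ Γ₁ Γ₂) : Fits Γ₂ ρ p o :=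
  h.mono fun _ _ => hs.right

theorem scons (h : Fits Γ ρ p o) (A : Ty) {n : List ℕ} (hn : dig p n = none) (hno : n ≠ o)
    (hi : ∀ i A, Γ i = some A → (ρ i).1 ≠ n) :
    Fits (QSMLL.scons (some A) Γ) (QSMLL.scons (n, A) ρ) p o where
  ty := by rw [Env.tys_scons]; exact h.ty.scons A
  fresh := by rintro (_ | i) B hB; exacts [hn, h.fresh i B hB]
  ne := by rintro (_ | i) B hB; exacts [hno, h.ne i B hB]
  inj := by
    rintro (_ | i) (_ | j) B C hB hC he
    · rfl
    · exact absurd he.symm (hi j C hC)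
    · exact absurd he (hi i B hB)
    · exact congrArg _ (h.inj i j B C hB hC he)
  out := h.out

theorem lam (h : Fits Γ ρ p o) (A : Ty) :
    Fits (QSMLL.scons (some A) Γ) (QSMLL.scons (1 :: p, A) ρ) (0 :: p) (0 :: p) :=
  (h.child 0).scons A (dig_cons_none (by simp)) (by simp)
    fun i B hi he => by simpa [he] using h.fresh i B hi

theorem letp (h : Fits Γ ρ p o) (A B : Ty) :
    Fits (QSMLL.scons (some B) (QSMLL.scons (some A) Γ))
      (QSMLL.scons (2 :: p, B) (QSMLL.scons (1 :: p, A) ρ)) (4 :: p) o :=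
  have ho : ∀ a, a :: p ≠ o := fun a he => by simpa [← he] using h.out
  ((h.childOut 4).scons A (dig_cons_none (by simp)) (ho 1)
    fun i B hi he => by simpa [he] using h.fresh i B hi).scons B (dig_cons_none (by simp)) (ho 2) <| by
    rintro (_ | i) C hi he
    · simp [QSMLL.scons] at he
    · have : (ρ i).1 = 2 :: p := he
      simpa [this] using h.fresh i C hi

end Fits

/-- The conclusion for the variable `i`. -/
def Env.edge (ρ : Env) (i : ℕ) : Edge := ⟨(ρ i).1, (ρ i).2.toFormula.neg⟩

/-- Names of the edges in a translation. -/
theorem HasType.edges {Γ V} {t : Tm G} {B} (h : HasType Γ V t B) :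
    ∀ {ρ p o}, Agree Γ ρ.tys → ∀ e ∈ Link.edgesList (translate ρ p o t),
      e = ⟨o, B.toFormula⟩ ∨ dig p e.name ≠ none ∨ ∃ i A, Γ i = some A ∧ e = ρ.edge i := by
  have key : ∀ {p z : List ℕ} {c}, dig (c :: p) z ≠ none → dig p z ≠ none := by
    intro p z c h; rw [dig_cons h]; simp
  induction h with
  | var i A =>
    intro ρ p o hρ e he
    have := hρ i A (by simp)
    simp only [Env.tys] at this
    simp only [translate, Link.edgesList, Link.edges, List.mem_append, List.mem_cons,
      List.not_mem_nil, or_false, this] at he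
    rcases he with rfl | rfl
    · exact Or.inr (Or.inr ⟨i, A, by simp, by simp [Env.edge, this]⟩)
    · exact Or.inl rfl
  | qvar | new | tt | ff =>
    intro ρ p o hρ e he
    simp [translate, bitNet, Link.edgesList, Link.edges, Ty.toFormula] at he ⊢
    try rcases he with rfl | rfl | rfl <;> simp
    try simp [he]
  | meas | gate =>
    intro ρ p o hρ e he
    simp [translate, bitNet, Link.edgesList, Link.edges, Ty.toFormula, Formula.neg] at he ⊢
    rcases he with rfl | rfl | rfl | rfl | rfl | rfl | rfl | rfl | rfl | rfl | rfl | rfl <;> simp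
  | @lam Γ V A B t h ih =>
    intro ρ p o hρ e he
    have ha : Agree (scons (some A) Γ) (Env.tys (scons (1 :: p, A) ρ)) := by
      rw [Env.tys_scons]; exact hρ.scons A
    simp only [translate, Link.edgesList, Link.edges, List.mem_append, List.mem_cons,
      List.not_mem_nil, or_false] at he
    rcases he with (rfl | rfl | rfl) | he
    · simp
    · simp
    · simp [h.tyOf_eq (hρ.scons A), Ty.toFormula]
    · rcases ih ha e he with rfl | he | ⟨i, C, hi, rfl⟩
      · simp
      · exact Or.inr (Or.inl (key he))
      -- Index `0` is the bound variable, whose edge `1 :: p` is internal to the abstraction; the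
      -- other indices are conclusions for `Γ`.
      · rcases i with _ | i
        · simp [Env.edge, scons]
        · exact Or.inr (Or.inr ⟨i, C, hi, rfl⟩)
  | app hs _ h1 h2 ih1 ih2 =>
    intro ρ p o hρ e he
    simp only [translate, Link.edgesList, Link.edges, List.mem_append, List.mem_cons,
      List.not_mem_nil, or_false, Link.edgesList_append] at he
    rcases he with (rfl | rfl) | (rfl | rfl | rfl) | (rfl | rfl) | he | he
    all_goals try simp; done
    · simp [tyOf, h1.tyOf_eq (hρ.left hs)]
    · rcases ih1 (hρ.left hs) e he with rfl | he | ⟨i, C, hi, rfl⟩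
      · simp
      · exact Or.inr (Or.inl (key he))
      · exact Or.inr (Or.inr ⟨i, C, hs.left hi, rfl⟩)
    · rcases ih2 (hρ.right hs) e he with rfl | he | ⟨i, C, hi, rfl⟩
      · simp
      · exact Or.inr (Or.inl (key he))
      · exact Or.inr (Or.inr ⟨i, C, hs.right hi, rfl⟩)
  | pair hs _ h1 h2 ih1 ih2 =>
    intro ρ p o hρ e he
    simp only [translate, Link.edgesList, Link.edges, List.mem_append, List.mem_cons,
      List.not_mem_nil, or_false, Link.edgesList_append] at he
    rcases he with (rfl | rfl | rfl) | he | he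
    all_goals try simp; done
    · simp [h1.tyOf_eq (hρ.left hs), h2.tyOf_eq (hρ.right hs), Ty.toFormula]
    · rcases ih1 (hρ.left hs) e he with rfl | he | ⟨i, C, hi, rfl⟩
      · simp
      · exact Or.inr (Or.inl (key he))
      · exact Or.inr (Or.inr ⟨i, C, hs.left hi, rfl⟩)
    · rcases ih2 (hρ.right hs) e he with rfl | he | ⟨i, C, hi, rfl⟩
      · simp
      · exact Or.inr (Or.inl (key he))
      · exact Or.inr (Or.inr ⟨i, C, hs.right hi, rfl⟩)
  | @letp Γ Γ₁ Γ₂ V₁ V₂ A B C t u hs _ h1 h2 ih1 ih2 =>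
    intro ρ p o hρ e he
    simp only [translate, Link.edgesList, Link.edges, List.mem_append, List.mem_cons,
      List.not_mem_nil, or_false, Link.edgesList_append, h1.tyOf_eq (hρ.left hs), Ty.components]
      at he
    rcases he with (rfl | rfl) | (rfl | rfl | rfl) | he | he
    all_goals try simp; done
    · rcases ih1 (hρ.left hs) e he with rfl | he | ⟨i, C, hi, rfl⟩
      · simp
      · exact Or.inr (Or.inl (key he))
      · exact Or.inr (Or.inr ⟨i, C, hs.left hi, rfl⟩)
    · have ha : Agree (scons (some B) (scons (some A) Γ₂))
          (Env.tys (scons (2 :: p, B) (scons (1 :: p, A) ρ))) := by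
        simp only [Env.tys_scons]; exact ((hρ.right hs).scons A).scons B
      rcases ih2 ha e he with rfl | he | ⟨i, C, hi, rfl⟩
      · simp
      · exact Or.inr (Or.inl (key he))
      · rcases i with _ | _ | i
        · simp [Env.edge, scons]
        · simp [Env.edge, scons]
        · exact Or.inr (Or.inr ⟨i, C, hs.right hi, rfl⟩)
  | ite h1 h2 h3 ih1 ih2 ih3 =>
    intro ρ p o hρ e he
    simp only [translate, Link.edgesList, Link.edges, List.mem_append, List.mem_cons,
      List.not_mem_nil, or_false, h2.tyOf_eq (Agree.nil _)] at he
    rcases he with (rfl | rfl) | (((rfl | rfl) | he) | he) | he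
    all_goals try simp; done
    · rcases ih2 (Agree.nil _) e he with rfl | he | ⟨i, C, hi, rfl⟩
      · simp
      · exact Or.inr (Or.inl (key he))
      · simp [Ctx.nil] at hi
    · rcases ih3 (Agree.nil _) e he with rfl | he | ⟨i, C, hi, rfl⟩
      · simp
      · exact Or.inr (Or.inl (key he))
      · simp [Ctx.nil] at hi
    · rcases ih1 hρ e he with rfl | he | ⟨i, C, hi, rfl⟩
      · simp
      · exact Or.inr (Or.inl (key he))
      · exact Or.inr (Or.inr ⟨i, C, hi, rfl⟩)

/-! ## Translations are correct -/

/-- Where an edge of a part of a translation at position `p` with output `o` may be found: below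
`p` in a direction from `D`, among the conclusions for the variables of `Γ`, or, if `b` holds, at
the output. -/
def Zone (Γ : Ctx) (ρ : Env) (p o : List ℕ) (D : List ℕ) (b : Prop) (e : Edge) : Prop :=
  (∃ c ∈ D, dig p e.name = some c) ∨ (∃ i A, Γ i = some A ∧ e = ρ.edge i) ∨ (e.name = o ∧ b)

namespace Zone

variable {Γ Γ₁ Γ₂ : Ctx} {ρ : Env} {p o : List ℕ} {D D' : List ℕ} {b b' : Prop} {e : Edge}

/-- `Fits` keeps variable names and the output out of the region below `p`, so only the first
alternative of `Zone` remains. -/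
theorem mem (hz : Zone Γ ρ p o D b e) (hf : Fits Γ ρ p o) {c} (h : dig p e.name = some c) :
    c ∈ D := by
  rcases hz with ⟨d, hd, he⟩ | ⟨i, A, hi, rfl⟩ | ⟨he, hb⟩
  · rw [h] at he; cases he; exact hd
  · simp [Env.edge, hf.fresh i A hi] at h
  · simp [he, hf.out] at h

theorem isOut (hz : Zone Γ ρ p o D b e) (hf : Fits Γ ρ p o) (h : e.name = o) : b := by
  rcases hz with ⟨d, hd, he⟩ | ⟨i, A, hi, rfl⟩ | ⟨he, hb⟩
  · simp [h, hf.out] at he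
  · exact absurd h (hf.ne i A hi)
  · exact hb

/-- The three regions of a zone are pairwise disjoint, so a common edge would lie in the same region
on both sides. Directions are separated by `hD`, the output by `hb`, and variables by the
injectivity of `ρ` together with linearity. -/
theorem disjoint (hf : Fits Γ ρ p o) (hs : Ctx.Split Γ Γ₁ Γ₂) (hz : Zone Γ₁ ρ p o D b e)
    (hz' : Zone Γ₂ ρ p o D' b' e) (hD : ∀ c ∈ D, c ∉ D') (hb : b → ¬ b') : False := by
  rcases hz with ⟨d, hd, he⟩ | ⟨i, A, hi, rfl⟩ | ⟨he, h⟩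
  · exact hD d hd (hz'.mem (hf.right hs) he)
  · rcases hz' with ⟨d, hd, he⟩ | ⟨j, B, hj, he⟩ | ⟨he, h⟩
    · simp [Env.edge, hf.fresh i A (hs.left hi)] at he
    · have := hf.inj i j A B (hs.left hi) (hs.right hj) (congrArg Edge.name he)
      subst this
      rcases hs i with ⟨h1, h2⟩ | ⟨h1, h2⟩ <;> simp_all
    · exact hf.ne i A (hs.left hi) he
  · exact hb h (hz'.isOut (hf.right hs) he)

end Zone

theorem HasType.zone_child {Γ V} {t : Tm G} {B} (h : HasType Γ V t B) {ρ p o}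
    (ha : Agree Γ ρ.tys) (c : ℕ) {e} (he : e ∈ Link.edgesList (translate ρ (c :: p) (c :: p) t)) :
    Zone Γ ρ p o [c] False e := by
  rcases h.edges ha e he with rfl | he | he
  · exact Or.inl ⟨c, by simp, by simp⟩
  · exact Or.inl ⟨c, by simp, dig_cons he⟩
  · exact Or.inr (Or.inl he)

theorem HasType.zone_childOut {Γ V} {t : Tm G} {B} (h : HasType Γ V t B) {ρ p o}
    (ha : Agree Γ ρ.tys) (c : ℕ) {e} (he : e ∈ Link.edgesList (translate ρ (c :: p) o t)) :
    Zone Γ ρ p o [c] True e := by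
  rcases h.edges ha e he with rfl | he | he
  · exact Or.inr (Or.inr ⟨rfl, trivial⟩)
  · exact Or.inl ⟨c, by simp, dig_cons he⟩
  · exact Or.inr (Or.inl he)

/-- The body occupies direction `0`; direction `1` is added by the edge of the bound variable. For a
`let` the bound variables likewise add `1` and `2` to the direction `4` of the body. -/
theorem HasType.zone_lam {Γ V A} {t : Tm G} {B} (h : HasType (scons (some A) Γ) V t B) {ρ : Env} {p o}
    (ha : Agree Γ ρ.tys) {e}
    (he : e ∈ Link.edgesList (translate (scons (1 :: p, A) ρ) (0 :: p) (0 :: p) t)) :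
    Zone Γ ρ p o [0, 1] False e := by
  rcases h.edges (by rw [Env.tys_scons]; exact ha.scons A) e he with rfl | he | ⟨_ | i, C, hi, rfl⟩
  · exact Or.inl ⟨0, by simp, by simp⟩
  · exact Or.inl ⟨0, by simp, dig_cons he⟩
  · exact Or.inl ⟨1, by simp, by simp [Env.edge, scons]⟩
  · exact Or.inr (Or.inl ⟨i, C, hi, rfl⟩)

theorem HasType.zone_letp {Γ V A B} {t : Tm G} {C}
    (h : HasType (scons (some B) (scons (some A) Γ)) V t C) {ρ : Env} {p o}
    (ha : Agree Γ ρ.tys) {e}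
    (he : e ∈ Link.edgesList
      (translate (scons (2 :: p, B) (scons (1 :: p, A) ρ)) (4 :: p) o t)) :
    Zone Γ ρ p o [1, 2, 4] True e := by
  rcases h.edges (by simp only [Env.tys_scons]; exact (ha.scons A).scons B) e he with
    rfl | he | ⟨_ | _ | i, C, hi, rfl⟩
  · exact Or.inr (Or.inr ⟨rfl, trivial⟩)
  · exact Or.inl ⟨4, by simp, dig_cons he⟩
  · exact Or.inl ⟨2, by simp, by simp [Env.edge, scons]⟩
  · exact Or.inl ⟨1, by simp, by simp [Env.edge, scons]⟩
  · exact Or.inr (Or.inl ⟨i, C, hi, rfl⟩)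

-- Labels and distinctness of edges

theorem Ty.pow_isPos : ∀ n, (Ty.pow .qbit n).toFormula.isPos = true
  | 0 | 1 => rfl
  | n + 2 => by simp [Ty.pow, Ty.toFormula, Formula.isPos, Ty.pow_isPos (n + 1)]

/-- The exponent is shifted because `Ty.pow A 0` is also a single factor. Gates have positive arity,
so the size of a sync link matches its arity. -/
theorem Ty.pow_atoms : ∀ n, (Ty.pow .qbit (n + 1)).toFormula.atoms = n + 1
  | 0 => rfl
  | n + 1 => by simp [Ty.pow, Ty.toFormula, Formula.atoms, Ty.pow_atoms n]; omega

theorem HasType.typed {Γ V} {t : Tm G} {B} (h : HasType Γ V t B) :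
    ∀ {ρ p o}, Agree Γ ρ.tys → ∀ x ∈ translate ρ p o t, x.Typed := by
  induction h with
  | var i A =>
    intro ρ p o hρ x hx
    simp only [translate, List.mem_singleton] at hx
    simp [hx, Link.Typed, Formula.neg_neg]
  | qvar | new =>
    intro ρ p o hρ x hx
    simp only [translate, List.mem_singleton] at hx
    simp [hx, Link.Typed]
  | tt | ff =>
    intro ρ p o hρ x hx
    simp only [translate, bitNet, List.mem_cons, List.not_mem_nil, or_false] at hx
    rcases hx with rfl | rfl <;> simp [Link.Typed, Formula.isPos, Formula.atoms]
  | meas =>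
    intro ρ p o hρ x hx
    simp only [translate, List.mem_cons, List.not_mem_nil, or_false] at hx
    rcases hx with rfl | rfl <;> simp [Link.Typed]
  | gate u =>
    intro ρ p o hρ x hx
    simp only [translate, List.mem_cons, List.not_mem_nil, or_false] at hx
    have := Ty.pow_isPos (G.arity u)
    obtain ⟨n, hn⟩ := Nat.exists_eq_add_of_le' (G.arity_pos u)
    have ha := Ty.pow_atoms n
    rw [← hn] at ha
    rcases hx with rfl | rfl | rfl <;> simp [Link.Typed, Formula.neg_neg, this, ha]
  | @lam Γ V A B t h ih =>
    intro ρ p o hρ x hx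
    simp only [translate, List.mem_cons] at hx
    rcases hx with rfl | hx
    · simp [Link.Typed]
    · exact ih (by rw [Env.tys_scons]; exact hρ.scons A) x hx
  | app hs _ h1 h2 ih1 ih2 =>
    intro ρ p o hρ x hx
    simp only [translate, List.mem_cons, List.mem_append, tyOf, h1.tyOf_eq (hρ.left hs),
      h2.tyOf_eq (hρ.right hs)] at hx
    rcases hx with rfl | rfl | rfl | hx | hx
    · simp [Link.Typed, Ty.toFormula, Formula.neg, Formula.neg_neg]
    · simp [Link.Typed]
    · simp [Link.Typed, Formula.neg_neg]
    · exact ih1 (hρ.left hs) x hx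
    · exact ih2 (hρ.right hs) x hx
  | pair hs _ h1 h2 ih1 ih2 =>
    intro ρ p o hρ x hx
    simp only [translate, List.mem_cons, List.mem_append] at hx
    rcases hx with rfl | hx | hx
    · simp [Link.Typed]
    · exact ih1 (hρ.left hs) x hx
    · exact ih2 (hρ.right hs) x hx
  | @letp Γ Γ₁ Γ₂ V₁ V₂ A B C t u hs _ h1 h2 ih1 ih2 =>
    intro ρ p o hρ x hx
    simp only [translate, List.mem_cons, List.mem_append, h1.tyOf_eq (hρ.left hs),
      Ty.components] at hx
    rcases hx with rfl | rfl | hx | hx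
    · simp [Link.Typed, Ty.toFormula, Formula.neg]
    · simp [Link.Typed]
    · exact ih1 (hρ.left hs) x hx
    · refine ih2 ?_ x hx
      simp only [Env.tys_scons]; exact ((hρ.right hs).scons A).scons B
  | ite h1 h2 h3 ih1 ih2 ih3 =>
    intro ρ p o hρ x hx
    simp only [translate, List.mem_cons] at hx
    rcases hx with rfl | rfl | hx
    · simp [Link.Typed, Formula.neg]
    · simp [Link.Typed]
    · exact ih1 hρ x hx

theorem HasType.sources_nodup {Γ V} {t : Tm G} {B} (h : HasType Γ V t B) :
    ∀ {ρ p o}, Fits Γ ρ p o → (Link.sourcesList (translate ρ p o t)).Nodup := by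
  have hne : ∀ {Γ ρ p o} (a : ℕ), Fits Γ ρ p o → a :: p ≠ o :=
    fun a hf he => by simpa [← he] using hf.out
  induction h with
  | var i A =>
    intro ρ p o hf
    have := hf.ne i A (by simp)
    simp [translate, Link.sourcesList, Link.sources, this]
  | qvar | new => intros; simp [translate, Link.sourcesList, Link.sources]
  | tt | ff =>
    intro ρ p o hf
    simp [translate, Link.sourcesList, Link.sources, bitNet, hne 0 hf]
  | meas =>
    intro ρ p o hf
    simp [translate, Link.sourcesList, Link.sources, bitNet, (hne 0 hf).symm, (hne 1 hf).symm,
      (hne 2 hf).symm, (hne 3 hf).symm]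
  | gate u =>
    intro ρ p o hf
    simp [translate, Link.sourcesList, Link.sources, (hne 0 hf).symm, (hne 1 hf).symm,
      (hne 2 hf).symm]
  | @lam Γ V A B t h ih =>
    intro ρ p o hf
    simp only [translate, Link.sourcesList, Link.sources, List.singleton_append, List.nodup_cons]
    refine ⟨fun he => ?_, ih (hf.lam A)⟩
    exact (h.zone_lam hf.ty (Link.sourcesList_subset _ he)).isOut hf rfl
  | app hs _ h1 h2 ih1 ih2 =>
    intro ρ p o hf
    have z1 := fun {e} he => h1.zone_child (p := p) (o := o) (e := e) (hf.left hs).ty 0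
      (Link.sourcesList_subset _ he)
    have z2 := fun {e} he => h2.zone_child (p := p) (o := o) (e := e) (hf.right hs).ty 1
      (Link.sourcesList_subset _ he)
    simp only [translate, Link.sourcesList, Link.sources, Link.sourcesList_append,
      List.nil_append, List.cons_append, List.nodup_cons, List.mem_cons, List.mem_append, not_or]
    refine ⟨⟨by simp, by simp [hne 3 hf], fun he => ?_, fun he => ?_⟩, ⟨by simp [hne 2 hf],
      fun he => ?_, fun he => ?_⟩, ⟨fun he => ?_, fun he => ?_⟩,
      List.nodup_append.2 ⟨ih1 ((hf.left hs).child 0), ih2 ((hf.right hs).child 1), ?_⟩⟩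
    · simpa using (z1 he).mem (hf.left hs) (dig_one _ 3)
    · simpa using (z2 he).mem (hf.right hs) (dig_one _ 3)
    · simpa using (z1 he).mem (hf.left hs) (dig_one _ 2)
    · simpa using (z2 he).mem (hf.right hs) (dig_one _ 2)
    · exact (z1 he).isOut (hf.left hs) rfl
    · exact (z2 he).isOut (hf.right hs) rfl
    · rintro e he _ he' rfl
      exact (z1 he).disjoint hf hs (z2 he') (by simp) (by simp)
  | pair hs _ h1 h2 ih1 ih2 =>
    intro ρ p o hf
    have z1 := fun {e} he => h1.zone_child (p := p) (o := o) (e := e) (hf.left hs).ty 0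
      (Link.sourcesList_subset _ he)
    have z2 := fun {e} he => h2.zone_child (p := p) (o := o) (e := e) (hf.right hs).ty 1
      (Link.sourcesList_subset _ he)
    simp only [translate, Link.sourcesList, Link.sources, Link.sourcesList_append,
      List.nil_append, List.cons_append, List.nodup_cons, List.mem_append, not_or]
    refine ⟨⟨fun he => ?_, fun he => ?_⟩,
      List.nodup_append.2 ⟨ih1 ((hf.left hs).child 0), ih2 ((hf.right hs).child 1), ?_⟩⟩
    · exact (z1 he).isOut (hf.left hs) rfl
    · exact (z2 he).isOut (hf.right hs) rfl
    · rintro e he _ he' rfl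
      exact (z1 he).disjoint hf hs (z2 he') (by simp) (by simp)
  | @letp Γ Γ₁ Γ₂ V₁ V₂ A B C t u hs _ h1 h2 ih1 ih2 =>
    intro ρ p o hf
    have z1 := fun {e} he => h1.zone_child (p := p) (o := o) (e := e) (hf.left hs).ty 0
      (Link.sourcesList_subset _ he)
    have z2 := fun {e} he => h2.zone_letp (ρ := ρ) (p := p) (o := o) (e := e) (hf.right hs).ty
      (Link.sourcesList_subset _ he)
    simp only [translate, Link.sourcesList, Link.sources, Link.sourcesList_append,
      List.nil_append, List.cons_append, List.nodup_cons, List.mem_append, not_or,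
      h1.tyOf_eq (hf.left hs).ty, Ty.components]
    refine ⟨⟨fun he => ?_, fun he => ?_⟩,
      List.nodup_append.2 ⟨ih1 ((hf.left hs).child 0), ih2 ((hf.right hs).letp A B), ?_⟩⟩
    · simpa using (z1 he).mem (hf.left hs) (dig_one _ 3)
    · simpa using (z2 he).mem (hf.right hs) (dig_one _ 3)
    · rintro e he _ he' rfl
      exact (z1 he).disjoint hf hs (z2 he') (by simp) (by simp)
  | @ite Γ V A t u v h1 h2 h3 ih1 ih2 ih3 =>
    intro ρ p o hf
    have fn := Fits.nil (p := p) (o := o) Env.nil hf.out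
    have z1 := fun {e} he => h1.zone_child (p := p) (o := o) (e := e) hf.ty 0
      (Link.sourcesList_subset _ he)
    have z2 := fun {e} he => h2.zone_childOut (p := p) (o := o) (e := e) fn.ty 2
      (Link.sourcesList_subset _ he)
    have z3 := fun {e} he => h3.zone_childOut (p := p) (o := o) (e := e) fn.ty 3
      (Link.sourcesList_subset _ he)
    simp only [translate, Link.sourcesList, Link.sources, List.nil_append, List.cons_append,
      List.nodup_cons, List.mem_append, not_or, List.mem_cons, List.mem_filter, List.not_mem_nil,
      or_false, not_and, decide_eq_true_eq, h2.tyOf_eq fn.ty]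
    refine ⟨⟨by simp [hne 1 hf], ⟨fun he => ?_, fun he => ?_⟩, fun he => ?_⟩,
      ⟨⟨by simp, by simp⟩, fun he => ?_⟩, List.nodup_append.2 ⟨List.nodup_append.2
        ⟨(ih2 (fn.childOut 2)).filter _, (ih3 (fn.childOut 3)).filter _, ?_⟩,
        ih1 (hf.child 0), ?_⟩⟩
    · simpa using (z2 he).mem fn (dig_one _ 1)
    · simpa using (z3 he).mem fn (dig_one _ 1)
    · simpa using (z1 he).mem hf (dig_one _ 1)
    · exact (z1 he).isOut hf rfl
    -- The two contents share the output `o`, but the filter in `Link.sources` has removed it. All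
    -- other edges lie in direction `2` for one content and `3` for the other.
    · rintro e he _ he' rfl
      simp only [List.mem_filter, decide_eq_true_eq] at he he'
      rcases h2.edges fn.ty _ (Link.sourcesList_subset _ he.1) with h | h | ⟨i, C, hi, _⟩
      · exact he.2 (by simp [h])
      · simpa using (z3 he'.1).mem fn (dig_cons h)
      · simp [Ctx.nil] at hi
    · rintro e he _ he' rfl
      simp only [List.mem_append, List.mem_filter, decide_eq_true_eq] at he
      have z1' := z1 he'
      rcases he with ⟨he, he0⟩ | ⟨he, he0⟩
      · rcases h2.edges fn.ty _ (Link.sourcesList_subset _ he) with h | h | ⟨i, C, hi, _⟩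
        · exact he0 (by simp [h])
        · simpa using z1'.mem hf (dig_cons h)
        · simp [Ctx.nil] at hi
      · rcases h3.edges fn.ty _ (Link.sourcesList_subset _ he) with h | h | ⟨i, C, hi, _⟩
        · exact he0 (by simp [h])
        · simpa using z1'.mem hf (dig_cons h)
        · simp [Ctx.nil] at hi

-- Acyclicity

/-- The edge `e` joins the nodes `x` and `y`. -/
def Link.Joins (e : Edge) (x y : Link) : Prop :=
  (e ∈ x.concls ∧ e ∈ y.prems) ∨ (e ∈ y.concls ∧ e ∈ x.prems)

theorem Link.Joins.left {e x y} (h : Link.Joins e x y) : e ∈ x.edges :=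
  h.elim (fun h => x.concls_subset h.1) (fun h => x.prems_subset h.2)

theorem Link.Joins.right {e x y} (h : Link.Joins e x y) : e ∈ y.edges :=
  h.elim (fun h => y.prems_subset h.2) (fun h => y.concls_subset h.1)

/-- There is no closed walk through nodes of `L` that uses distinct edges and satisfies the
conditions for switching paths. -/
def Acyclic (L : List Link) : Prop :=
  ¬ ∃ (k : ℕ) (v : Fin (k + 1) → Link) (e : Fin (k + 1) → Edge),
    Function.Injective e ∧ (∀ j, v j ∈ L) ∧ (∀ j, Link.Joins (e j) (v j) (v (j + 1))) ∧
    ∀ x ∈ L, ∀ a ∈ x.exclusive, ∀ b ∈ x.exclusive,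
      a ∈ Set.range e → b ∈ Set.range e → a = b

/-- `Acyclic` forbids more, since nodes may repeat. It also speaks of links rather than of indices
into the list, which makes it depend on membership only and so convenient for regrouping a
translation. -/
theorem Acyclic.not_switchingCycle {L : List Link} (h : Acyclic L) : ¬ SwitchingCycle L := by
  rintro ⟨k, v, e, -, he, hj, hx⟩
  exact h ⟨k, fun j => L.get (v j), e, he, fun j => L.get_mem _, hj, hx⟩

theorem Acyclic.congr {L L' : List Link} (h : Acyclic L) (hm : ∀ x, x ∈ L ↔ x ∈ L') :
    Acyclic L' := by
  rintro ⟨k, v, e, he, hv, hj, hx⟩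
  exact h ⟨k, v, e, he, fun j => (hm _).2 (hv j), hj, fun x hxL => hx x ((hm x).1 hxL)⟩

/-- A walk confined to `x` uses an edge that is both a premise and a conclusion of `x`. -/
theorem Acyclic.single {x : Link} (h : ∀ e ∈ x.concls, e ∉ x.prems) : Acyclic [x] := by
  rintro ⟨k, v, e, he, hv, hj, hx⟩
  have hv : ∀ j, v j = x := by simpa using hv
  rcases hj 0 with h' | h' <;> rw [hv, hv] at h' <;> exact h _ h'.1 h'.2

open Fin.NatCast Fin.CommRing in
theorem exists_succ_of_cyclic {k : ℕ} {P : Fin (k + 1) → Prop} {i j : Fin (k + 1)} (hi : P i)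
    (hj : ¬ P j) : ∃ l, P l ∧ ¬ P (l + 1) := by
  by_contra! hc
  have : ∀ n : ℕ, P (i + (n : Fin (k + 1))) := by
    intro n
    induction n with
    | zero => simpa using hi
    | succ n ih => simpa [add_assoc] using hc _ ih
  -- Every index is reached from `i` by adding `1`, here `j - i` times modulo `k + 1`.
  have := this (j - i).val
  simp only [Fin.cast_val_eq_self, add_sub_cancel] at this
  exact hj this

/-- Acyclic structures joined by edges no two of which lie on a switching path form an acyclic
structure. -/
theorem Acyclic.append {L L' : List Link} (h : Acyclic L) (h' : Acyclic L')
    (hx : ∀ e e', e ∈ Link.edgesList L → e ∈ Link.edgesList L' → e' ∈ Link.edgesList L →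
      e' ∈ Link.edgesList L' → e ≠ e' → ∃ x ∈ L ++ L', e ∈ x.exclusive ∧ e' ∈ x.exclusive) :
    Acyclic (L ++ L') := by
  rintro ⟨k, v, e, he, hv, hj, hex⟩
  by_cases h1 : ∀ j, v j ∈ L
  · exact h ⟨k, v, e, he, h1, hj, fun x hxL => hex x (List.mem_append_left _ hxL)⟩
  by_cases h2 : ∀ j, v j ∈ L'
  · exact h' ⟨k, v, e, he, h2, hj, fun x hxL => hex x (List.mem_append_right _ hxL)⟩
  push Not at h1 h2
  have hv' : ∀ j, v j ∉ L → v j ∈ L' := fun j hjL => (List.mem_append.1 (hv j)).resolve_left hjL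
  obtain ⟨j1, h1⟩ := h1
  obtain ⟨j2, h2⟩ := h2
  have h2 : v j2 ∈ L := (List.mem_append.1 (hv j2)).resolve_right h2
  -- A closed walk that stays in neither part leaves `L` along some edge `e a` and comes back along
  -- some `e b`. Both edges are shared, and they differ because edges are not repeated, so some link
  -- forbids using both.
  obtain ⟨a, ha, ha'⟩ := exists_succ_of_cyclic (P := fun j => v j ∈ L) h2 h1
  obtain ⟨b, hb, hb'⟩ := exists_succ_of_cyclic (P := fun j => v j ∉ L) h1 (not_not.2 h2)
  have hab : e a ≠ e b := fun hab => by rw [he hab] at ha; exact hb ha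
  obtain ⟨x, hxL, hxa, hxb⟩ := hx (e a) (e b) (Link.mem_edgesList.2 ⟨_, ha, (hj a).left⟩)
    (Link.mem_edgesList.2 ⟨_, hv' _ ha', (hj a).right⟩)
    (Link.mem_edgesList.2 ⟨_, not_not.1 hb', (hj b).right⟩)
    (Link.mem_edgesList.2 ⟨_, hv' _ hb, (hj b).left⟩) hab
  exact hab (hex x hxL _ hxa _ hxb ⟨a, rfl⟩ ⟨b, rfl⟩)

/-- A closed walk without repeated edges cannot leave and come back through a single edge. -/
theorem Acyclic.append_one {L L' : List Link} (h : Acyclic L) (h' : Acyclic L') (e₀ : Edge)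
    (hx : ∀ e, e ∈ Link.edgesList L → e ∈ Link.edgesList L' → e = e₀) :
    Acyclic (L ++ L') :=
  h.append h' fun e e' h1 h2 h3 h4 hne => absurd ((hx e h1 h2).trans (hx e' h3 h4).symm) hne

/-- Both premises of the `⅋` may lead into `L`, but a switching path uses only one of them; the
conclusion does not meet `L`. -/
theorem Acyclic.cons_par {a b c : Edge} {L : List Link} (h : Acyclic L)
    (hc : c ∉ Link.edgesList L) (hca : c ≠ a) (hcb : c ≠ b) : Acyclic (.par a b c :: L) := by
  refine Acyclic.append (L := [.par a b c])
    (Acyclic.single (by simp [Link.concls, Link.prems, hca, hcb])) h ?_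
  intro e e' h1 h2 h3 h4 _
  refine ⟨_, List.mem_append_left _ (List.mem_singleton_self _), ?_⟩
  simp only [Link.edgesList, Link.edges, List.append_nil, List.mem_cons, List.not_mem_nil,
    or_false] at h1 h3
  have : e ≠ c := fun h => hc (h ▸ h2)
  have : e' ≠ c := fun h => hc (h ▸ h4)
  simp_all [Link.exclusive]

theorem bitNet_acyclic (U : QGate 1) {p o : List ℕ} (h : p ≠ o) : Acyclic (bitNet U p o) := by
  refine Acyclic.append_one (L := [_]) (Acyclic.single (by simp [Link.prems]))
    (Acyclic.single (by simp [Link.prems, Link.concls, h.symm])) ⟨p, .one⟩ ?_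
  simp +contextual [Link.edgesList, Link.edges]

/-- Every term constructor glues the nets of its subterms in a tree-like way, except that a `⅋` may
attach by both premises. In each case the pieces are added one at a time and the shared edge is
found by comparing zones. -/
theorem HasType.acyclic {Γ V} {t : Tm G} {B} (h : HasType Γ V t B) :
    ∀ {ρ p o}, Fits Γ ρ p o → Acyclic (translate ρ p o t) := by
  have hne : ∀ {Γ ρ p o} (a : ℕ), Fits Γ ρ p o → o ≠ a :: p :=
    fun a hf he => by simpa [he] using hf.out
  induction h with
  | var i A =>
    intro ρ p o hf
    exact Acyclic.single (by simp [Link.prems])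
  | qvar | new => intros; exact Acyclic.single (by simp [Link.prems])
  | tt | ff => intro ρ p o hf; exact bitNet_acyclic _ (hne 0 hf).symm
  | meas =>
    intro ρ p o hf
    -- The box meets the `⅋` in two edges, its lock and its other conclusion, which are precisely
    -- the two exclusive premises.
    refine Acyclic.append (L := [_]) (Acyclic.single ?_) (Acyclic.single (by simp [Link.prems])) ?_
    · simp [Link.prems, Link.concls, hne 0 hf, hne 1 hf]
    · intro e e' h1 h2 h3 h4 _
      refine ⟨_, List.mem_append_left _ (List.mem_singleton_self _), ?_⟩
      simp [Link.edgesList, Link.edges, bitNet] at h1 h2 h3 h4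
      have : ∀ a, (⟨o, Formula.bot.par .one⟩ : Edge) ≠ ⟨a :: p, .bot⟩ := by simp
      have : ∀ a, (⟨o, Formula.bot.par .one⟩ : Edge) ≠ ⟨a :: p, .one⟩ := by simp
      simp [Link.exclusive]
      grind
  | gate u =>
    intro ρ p o hf
    refine Acyclic.cons_par (Acyclic.append_one (L := [_]) (Acyclic.single (by simp [Link.prems]))
      (Acyclic.single (by simp [Link.prems, Link.concls]))
      ⟨1 :: p, (Ty.pow .qbit (G.arity u)).toFormula⟩ ?_) ?_ ?_ ?_
    · simp +contextual [Link.edgesList, Link.edges]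
    · simp [Link.edgesList, Link.edges, hne 0 hf, hne 1 hf, hne 2 hf]
    · simp [hne 0 hf]
    · simp [hne 2 hf]
  | @lam Γ V A B t h ih =>
    intro ρ p o hf
    exact Acyclic.cons_par (ih (hf.lam A)) (fun he => (h.zone_lam hf.ty he).isOut hf rfl)
      (by simp [hne 1 hf]) (by simp [hne 0 hf])
  | @app Γ Γ₁ Γ₂ V₁ V₂ A B t u hs _ h1 h2 ih1 ih2 =>
    intro ρ p o hf
    have z1 := fun {e} he => h1.zone_child (p := p) (o := o) (e := e) (hf.left hs).ty 0 he
    have z2 := fun {e} he => h2.zone_child (p := p) (o := o) (e := e) (hf.right hs).ty 1 he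
    simp only [translate]
    set Ft := (tyOf ρ.tys t).toFormula
    set Fu := (tyOf ρ.tys u).toFormula
    set Fo := (tyOf ρ.tys (.app t u)).toFormula
    -- The order of assembly makes each new piece meet the earlier ones in a single edge: the cut
    -- meets `t` in `0 :: p`, then the `⊗` attaches at `3 :: p`, the axiom at `2 :: p` and `u` at `1
    -- :: p`.
    have a1 : Acyclic (Link.cut ⟨0 :: p, Ft⟩ ⟨3 :: p, .tens Fu Fo.neg⟩ ::
        translate ρ (0 :: p) (0 :: p) t) := by
      refine Acyclic.append_one (L := [_]) (Acyclic.single (by simp [Link.concls]))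
        (ih1 ((hf.left hs).child 0)) ⟨0 :: p, Ft⟩ ?_
      intro e he he'
      simp only [Link.edgesList, Link.edges, List.append_nil, List.mem_cons, List.not_mem_nil,
        or_false] at he
      rcases he with rfl | rfl
      · rfl
      · simpa using (z1 he').mem (hf.left hs) (dig_one _ 3)
    have a2 := Acyclic.append_one (L := [Link.tens ⟨1 :: p, Fu⟩ ⟨2 :: p, Fo.neg⟩
      ⟨3 :: p, .tens Fu Fo.neg⟩]) (Acyclic.single (by simp [Link.concls, Link.prems])) a1
      ⟨3 :: p, .tens Fu Fo.neg⟩ (by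
        intro e he he'
        simp only [Link.edgesList, Link.edges, List.append_nil, List.mem_cons, List.not_mem_nil,
          or_false, List.mem_append] at he he'
        rcases he with rfl | rfl | rfl
        · rcases he' with he' | he'
          · simp at he'
          · simpa using (z1 he').mem (hf.left hs) (dig_one _ 1)
        · rcases he' with he' | he'
          · simp at he'
          · simpa using (z1 he').mem (hf.left hs) (dig_one _ 2)
        · rfl)
    have a3 := Acyclic.append_one (L := [Link.ax ⟨2 :: p, Fo.neg⟩ ⟨o, Fo⟩])
      (Acyclic.single (by simp [Link.prems])) a2 ⟨2 :: p, Fo.neg⟩ (by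
        intro e he he'
        simp only [Link.edgesList, Link.edges, List.append_nil, List.mem_cons, List.not_mem_nil,
          or_false, List.mem_append, List.singleton_append] at he he'
        rcases he with rfl | rfl
        · rfl
        · rcases he' with he' | he' | he'
          · simp [hne 1 hf, hne 2 hf, hne 3 hf] at he'
          · simp [hne 0 hf, hne 3 hf] at he'
          · exact ((z1 he').isOut (hf.left hs) rfl).elim)
    have a4 := Acyclic.append_one (ih2 ((hf.right hs).child 1)) a3 ⟨1 :: p, Fu⟩ (by
        intro e he he'
        have z2 := z2 he
        simp only [Link.edgesList, Link.edges, List.mem_cons, List.not_mem_nil,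
          or_false, List.mem_append, List.singleton_append] at he'
        rcases he' with (rfl | rfl) | (rfl | rfl | rfl) | (rfl | rfl) | he'
        · simpa using z2.mem (hf.right hs) (dig_one _ 2)
        · exact (z2.isOut (hf.right hs) rfl).elim
        · rfl
        · simpa using z2.mem (hf.right hs) (dig_one _ 2)
        · simpa using z2.mem (hf.right hs) (dig_one _ 3)
        · simpa using z2.mem (hf.right hs) (dig_one _ 0)
        · simpa using z2.mem (hf.right hs) (dig_one _ 3)
        · exact ((z1 he').disjoint hf hs z2 (by simp) (by simp)).elim)
    exact a4.congr fun x => by simp only [List.mem_append, List.mem_cons, List.not_mem_nil]; tauto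
  | @pair Γ Γ₁ Γ₂ V₁ V₂ A B t u hs _ h1 h2 ih1 ih2 =>
    intro ρ p o hf
    have z1 := fun {e} he => h1.zone_child (p := p) (o := o) (e := e) (hf.left hs).ty 0 he
    have z2 := fun {e} he => h2.zone_child (p := p) (o := o) (e := e) (hf.right hs).ty 1 he
    simp only [translate]
    set Ft := (tyOf ρ.tys t).toFormula
    set Fu := (tyOf ρ.tys u).toFormula
    have a1 := Acyclic.append_one (L := [Link.tens ⟨0 :: p, Ft⟩ ⟨1 :: p, Fu⟩ ⟨o, .tens Ft Fu⟩])
      (Acyclic.single (by simp [Link.concls, Link.prems, hne 0 hf, hne 1 hf]))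
      (ih1 ((hf.left hs).child 0)) ⟨0 :: p, Ft⟩ (by
        intro e he he'
        simp only [Link.edgesList, Link.edges, List.append_nil, List.mem_cons, List.not_mem_nil,
          or_false] at he
        rcases he with rfl | rfl | rfl
        · rfl
        · simpa using (z1 he').mem (hf.left hs) (dig_one _ 1)
        · exact ((z1 he').isOut (hf.left hs) rfl).elim)
    have a2 := Acyclic.append_one (ih2 ((hf.right hs).child 1)) a1 ⟨1 :: p, Fu⟩ (by
        intro e he he'
        have z2 := z2 he
        simp only [Link.edgesList, Link.edges, List.mem_cons, List.not_mem_nil,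
          or_false, List.mem_append, List.singleton_append] at he'
        rcases he' with (rfl | rfl | rfl) | he'
        · simpa using z2.mem (hf.right hs) (dig_one _ 0)
        · rfl
        · exact (z2.isOut (hf.right hs) rfl).elim
        · exact ((z1 he').disjoint hf hs z2 (by simp) (by simp)).elim)
    exact a2.congr fun x => by simp only [List.mem_append, List.mem_cons, List.not_mem_nil]; tauto
  | @letp Γ Γ₁ Γ₂ V₁ V₂ A B C t u hs _ h1 h2 ih1 ih2 =>
    intro ρ p o hf
    have z1 := fun {e} he => h1.zone_child (p := p) (o := o) (e := e) (hf.left hs).ty 0 he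
    have z2 := fun {e} he => h2.zone_letp (ρ := ρ) (p := p) (o := o) (e := e) (hf.right hs).ty he
    simp only [translate, h1.tyOf_eq (hf.left hs).ty, Ty.components]
    have a1 := Acyclic.cons_par (a := ⟨1 :: p, A.toFormula.neg⟩) (b := ⟨2 :: p, B.toFormula.neg⟩)
      (c := ⟨3 :: p, .par A.toFormula.neg B.toFormula.neg⟩) (ih2 ((hf.right hs).letp A B))
      (fun he => by simpa using (z2 he).mem (hf.right hs) (dig_one _ 3)) (by simp) (by simp)
    have a2 := Acyclic.append_one (L := [Link.cut ⟨0 :: p, (Ty.tens A B).toFormula⟩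
      ⟨3 :: p, .par A.toFormula.neg B.toFormula.neg⟩]) (Acyclic.single (by simp [Link.concls]))
      a1 ⟨3 :: p, .par A.toFormula.neg B.toFormula.neg⟩ (by
        intro e he he'
        simp only [Link.edgesList, Link.edges, List.append_nil, List.mem_cons, List.not_mem_nil,
          or_false, List.mem_append] at he he'
        rcases he with rfl | rfl
        · rcases he' with he' | he'
          · simp at he'
          · simpa using (z2 he').mem (hf.right hs) (dig_one _ 0)
        · rfl)
    have a3 := Acyclic.append_one (ih1 ((hf.left hs).child 0)) a2
      ⟨0 :: p, (Ty.tens A B).toFormula⟩ (by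
        intro e he he'
        have z1 := z1 he
        simp only [Link.edgesList, Link.edges, List.mem_cons, List.not_mem_nil,
          or_false, List.mem_append, List.singleton_append] at he'
        rcases he' with (rfl | rfl) | (rfl | rfl | rfl) | he'
        · rfl
        · simpa using z1.mem (hf.left hs) (dig_one _ 3)
        · simpa using z1.mem (hf.left hs) (dig_one _ 1)
        · simpa using z1.mem (hf.left hs) (dig_one _ 2)
        · simpa using z1.mem (hf.left hs) (dig_one _ 3)
        · exact (z1.disjoint hf hs (z2 he') (by simp) (by simp)).elim)
    exact a3.congr fun x => by simp only [List.mem_append, List.mem_cons, List.not_mem_nil]; tauto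
  | @ite Γ V A t u v h1 h2 h3 ih1 ih2 ih3 =>
    intro ρ p o hf
    have fn := Fits.nil (p := p) (o := o) Env.nil hf.out
    have z1 := fun {e} he => h1.zone_child (p := p) (o := o) (e := e) hf.ty 0 he
    have z2 := fun {e} he => h2.zone_childOut (p := p) (o := o) (e := e) fn.ty 2 he
    have z3 := fun {e} he => h3.zone_childOut (p := p) (o := o) (e := e) fn.ty 3 he
    simp only [translate, h2.tyOf_eq fn.ty]
    have a1 := Acyclic.append_one (L := [Link.cut ⟨0 :: p, .one⟩ ⟨1 :: p, .bot⟩])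
      (Acyclic.single (by simp [Link.concls])) (ih1 (hf.child 0)) ⟨0 :: p, .one⟩ (by
        intro e he he'
        simp only [Link.edgesList, Link.edges, List.append_nil, List.mem_cons, List.not_mem_nil,
          or_false] at he
        rcases he with rfl | rfl
        · rfl
        · simpa using (z1 he').mem hf (dig_one _ 1))
    have a2 := Acyclic.append_one (L := [Link.box ⟨1 :: p, .bot⟩ [⟨o, A.toFormula⟩]
      (translate Env.nil (2 :: p) o u) (translate Env.nil (3 :: p) o v)])
      (Acyclic.single (by simp [Link.prems])) a1 ⟨1 :: p, .bot⟩ (by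
        intro e he he'
        -- `Link.edgesList` also lists the edges inside the box, so both contents have to be located
        -- as well.
        have z : Zone Ctx.nil Env.nil p o [1, 2, 3] True e := by
          simp only [Link.edgesList, Link.edges, List.append_nil, List.mem_cons, List.not_mem_nil,
            or_false, List.mem_append] at he
          rcases he with ((rfl | rfl) | he) | he
          · exact Or.inl ⟨1, by simp, by simp⟩
          · exact Or.inr (Or.inr ⟨rfl, trivial⟩)
          · rcases z2 he with ⟨c, hc, he⟩ | he
            · exact Or.inl ⟨c, by simp_all, he⟩
            · exact Or.inr he
          · rcases z3 he with ⟨c, hc, he⟩ | he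
            · exact Or.inl ⟨c, by simp_all, he⟩
            · exact Or.inr he
        simp only [Link.edgesList, Link.edges, List.mem_cons, List.not_mem_nil,
          or_false, List.mem_append, List.singleton_append] at he'
        rcases he' with (rfl | rfl) | he'
        · simpa using z.mem fn (dig_one _ 0)
        · rfl
        · refine ((z1 he').disjoint (Γ := Γ) (Γ₂ := Ctx.nil) hf
            (fun i => Or.inl ⟨rfl, rfl⟩) (D' := [1, 2, 3]) (b' := True) ?_ (by simp) (by simp)).elim
          rcases z with z | ⟨i, B, hi, _⟩ | z
          · exact Or.inl z
          · simp [Ctx.nil] at hi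
          · exact Or.inr (Or.inr z))
    exact a2.congr fun x => by simp only [List.mem_append, List.mem_cons, List.not_mem_nil]; tauto

-- Premises, conclusions and pending edges

theorem Ctx.Split.perm {Γ Γ₁ Γ₂ : Ctx} (hs : Ctx.Split Γ Γ₁ Γ₂) {l : List ℕ} (hl : l.Nodup)
    (hm : ∀ i, i ∈ l ↔ (Γ i).isSome) : ∃ l₁ l₂, l.Perm (l₁ ++ l₂) ∧
      (l₁.Nodup ∧ ∀ i, i ∈ l₁ ↔ (Γ₁ i).isSome) ∧ (l₂.Nodup ∧ ∀ i, i ∈ l₂ ↔ (Γ₂ i).isSome) := by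
  refine ⟨l.filter (fun i => (Γ₁ i).isSome), l.filter (fun i => !(Γ₁ i).isSome),
    (List.filter_append_perm _ l).symm, ⟨hl.filter _, fun i => ?_⟩, ⟨hl.filter _, fun i => ?_⟩⟩ <;>
  rcases hs i with ⟨h1, h2⟩ | ⟨h1, h2⟩ <;> cases h : Γ i <;> simp [hm, h, h1, h2]

theorem scons_domain {Γ : Ctx} {l : List ℕ} (hl : l.Nodup) (hm : ∀ i, i ∈ l ↔ (Γ i).isSome)
    (A : Ty) : (0 :: l.map Nat.succ).Nodup ∧
      ∀ i, i ∈ 0 :: l.map Nat.succ ↔ (scons (some A) Γ i).isSome := by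
  refine ⟨List.nodup_cons.2 ⟨by simp, hl.map Nat.succ_injective⟩, ?_⟩
  rintro (_ | i) <;> simp [scons, hm]

theorem Env.edge_scons_map (x : List ℕ × Ty) (ρ : Env) (l : List ℕ) :
    (l.map Nat.succ).map (Env.edge (scons x ρ)) = l.map ρ.edge := by
  rw [List.map_map]; rfl

/-- Contexts are functions, so the list `l` enumerates the domain of `Γ` to give the pending edges
an order. Permutations are compared by the multiplicity of each edge, and every inductive case
becomes linear arithmetic in these multiplicities. -/
theorem HasType.balanced {Γ V} {t : Tm G} {B} (h : HasType Γ V t B) :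
    ∀ {ρ p o}, Agree Γ ρ.tys → ∀ l : List ℕ, l.Nodup → (∀ i, i ∈ l ↔ (Γ i).isSome) →
      ((translate ρ p o t).flatMap Link.prems ++ ⟨o, B.toFormula⟩ :: l.map ρ.edge).Perm
        ((translate ρ p o t).flatMap Link.concls) := by
  have hnil : ∀ {l : List ℕ}, (∀ i, i ∈ l ↔ (Ctx.nil i).isSome) → l = [] := by
    intro l hm
    exact List.eq_nil_iff_forall_not_mem.2 fun i hi => by simpa [Ctx.nil] using (hm i).1 hi
  induction h with
  | var i A =>
    intro ρ p o hρ l hl hm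
    have hi : (ρ i).2 = A := hρ i A (by simp)
    have : l = [i] := by
      have hm' : ∀ j, j ∈ l ↔ j = i := fun j => by
        rw [hm]
        by_cases hj : j = i
        · simp [hj]
        · simp [hj, Ctx.nil]
      exact List.perm_singleton.1 ((List.perm_ext_iff_of_nodup hl (List.nodup_singleton i)).2
        (by simpa using hm'))
    subst this
    simp only [translate, List.flatMap_cons, List.flatMap_nil, Link.prems, Link.concls,
      List.append_nil, List.nil_append, List.map_cons, List.map_nil, Env.edge, hi]
    exact List.Perm.swap _ _ _
  | qvar | new | tt | ff =>
    intro ρ p o hρ l hl hm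
    rw [hnil hm]
    simp [translate, bitNet, Link.prems, Link.concls, Ty.toFormula]
  | meas =>
    intro ρ p o hρ l hl hm
    rw [hnil hm]
    simp [translate, Link.prems, Link.concls, Ty.toFormula, Formula.neg,
      List.perm_iff_count, List.count_cons]
    intros; ring
  | gate u =>
    intro ρ p o hρ l hl hm
    rw [hnil hm]
    simp [translate, Link.prems, Link.concls, Ty.toFormula,
      List.perm_iff_count, List.count_cons]
    intros; ring
  | @lam Γ V A B t h ih =>
    intro ρ p o hρ l hl hm
    have ha : Agree (scons (some A) Γ) (Env.tys (scons (1 :: p, A) ρ)) := by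
      rw [Env.tys_scons]; exact hρ.scons A
    obtain ⟨hl', hm'⟩ := scons_domain hl hm A
    have := ih (ρ := scons (1 :: p, A) ρ) (p := 0 :: p) (o := 0 :: p) ha _ hl' hm'
    simp only [List.map_cons, Env.edge_scons_map] at this
    simp only [translate, h.tyOf_eq ha]
    rw [List.perm_iff_count] at this ⊢
    intro e
    have := this e
    simp [Link.prems, Link.concls, List.count_cons, Env.edge, scons, Ty.toFormula] at this ⊢
    omega
  | app hs _ h1 h2 ih1 ih2 =>
    intro ρ p o hρ l hl hm
    obtain ⟨l₁, l₂, hp, ⟨hl1, hm1⟩, ⟨hl2, hm2⟩⟩ := hs.perm hl hm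
    have t1 := ih1 (p := 0 :: p) (o := 0 :: p) (hρ.left hs) _ hl1 hm1
    have t2 := ih2 (p := 1 :: p) (o := 1 :: p) (hρ.right hs) _ hl2 hm2
    have hp := hp.map ρ.edge
    simp only [translate, tyOf, h1.tyOf_eq (hρ.left hs), h2.tyOf_eq (hρ.right hs)]
    rw [List.perm_iff_count] at t1 t2 hp ⊢
    intro e
    have := t1 e
    have := t2 e
    have := hp e
    simp [Link.prems, Link.concls, List.count_cons] at *
    omega
  | pair hs _ h1 h2 ih1 ih2 =>
    intro ρ p o hρ l hl hm
    obtain ⟨l₁, l₂, hp, ⟨hl1, hm1⟩, ⟨hl2, hm2⟩⟩ := hs.perm hl hm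
    have t1 := ih1 (p := 0 :: p) (o := 0 :: p) (hρ.left hs) _ hl1 hm1
    have t2 := ih2 (p := 1 :: p) (o := 1 :: p) (hρ.right hs) _ hl2 hm2
    have hp := hp.map ρ.edge
    simp only [translate, h1.tyOf_eq (hρ.left hs), h2.tyOf_eq (hρ.right hs)]
    rw [List.perm_iff_count] at t1 t2 hp ⊢
    intro e
    have := t1 e
    have := t2 e
    have := hp e
    simp [Link.prems, Link.concls, List.count_cons, Ty.toFormula] at *
    omega
  | @letp Γ Γ₁ Γ₂ V₁ V₂ A B C t u hs _ h1 h2 ih1 ih2 =>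
    intro ρ p o hρ l hl hm
    obtain ⟨l₁, l₂, hp, ⟨hl1, hm1⟩, ⟨hl2, hm2⟩⟩ := hs.perm hl hm
    have t1 := ih1 (p := 0 :: p) (o := 0 :: p) (hρ.left hs) _ hl1 hm1
    obtain ⟨hl2, hm2⟩ := scons_domain hl2 hm2 A
    obtain ⟨hl2, hm2⟩ := scons_domain hl2 hm2 B
    have ha : Agree (scons (some B) (scons (some A) Γ₂))
        (Env.tys (scons (2 :: p, B) (scons (1 :: p, A) ρ))) := by
      simp only [Env.tys_scons]; exact ((hρ.right hs).scons A).scons B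
    have t2 := ih2 (p := 4 :: p) (o := o) ha _ hl2 hm2
    have hp := hp.map ρ.edge
    simp only [translate, h1.tyOf_eq (hρ.left hs), Ty.components]
    rw [List.map_cons, Env.edge_scons_map, List.map_cons, Env.edge_scons_map] at t2
    rw [List.perm_iff_count] at t1 t2 hp ⊢
    intro e
    have := t1 e
    have := t2 e
    have := hp e
    simp [Link.prems, Link.concls, List.count_cons, Env.edge, scons] at *
    omega
  | ite h1 h2 h3 ih1 ih2 ih3 =>
    intro ρ p o hρ l hl hm
    have t1 := ih1 (p := 0 :: p) (o := 0 :: p) hρ _ hl hm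
    simp only [translate, h2.tyOf_eq (Agree.nil _)]
    rw [List.perm_iff_count] at t1 ⊢
    intro e
    have := t1 e
    simp [Link.prems, Link.concls, List.count_cons, Ty.toFormula] at *
    omega

-- Correctness, boxes included

theorem bitNet_correct (U : QGate 1) {p o : List ℕ} (h : p ≠ o) :
    Correct (bitNet U p o) [⟨o, .one⟩] := by
  refine Correct.intro _ _ ?_ ?_ ?_ (bitNet_acyclic U h).not_switchingCycle ?_ ?_
  · intro x hx
    simp only [bitNet, List.mem_cons, List.not_mem_nil, or_false] at hx
    rcases hx with rfl | rfl <;> simp [Link.Typed, Formula.isPos, Formula.atoms]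
  · simp [bitNet, Link.sourcesList, Link.sources, h]
  · simp [bitNet, Link.prems, Link.concls]
  · simp [bitNet]
  · simp [bitNet]

theorem HasType.correct {Γ V} {t : Tm G} {B} (h : HasType Γ V t B) :
    ∀ {ρ p o}, Fits Γ ρ p o → ∀ l : List ℕ, l.Nodup → (∀ i, i ∈ l ↔ (Γ i).isSome) →
      Correct (translate ρ p o t) (⟨o, B.toFormula⟩ :: l.map ρ.edge) := by
  -- The conditions at depth `0` hold by `typed`, `sources_nodup`, `balanced` and `acyclic`; only
  -- the contents of boxes call for an induction.
  suffices hbox : ∀ {ρ p o}, Fits Γ ρ p o → ∀ l Δ R S,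
      Link.box l Δ R S ∈ translate ρ p o t → Correct R Δ ∧ Correct S Δ from
    fun {_ _ _} hf l hl hm => Correct.intro _ _ (h.typed hf.ty) (h.sources_nodup hf)
      (h.balanced hf.ty l hl hm) (h.acyclic hf).not_switchingCycle
      (fun _ _ _ _ hb => (hbox hf _ _ _ _ hb).1) (fun _ _ _ _ hb => (hbox hf _ _ _ _ hb).2)
  induction h with
  | var | qvar | new | tt | ff | gate =>
    intro ρ p o hf l Δ R S hb; simp [translate, bitNet] at hb
  | meas =>
    intro ρ p o hf l Δ R S hb
    simp [translate] at hb
    obtain ⟨rfl, rfl, rfl, rfl⟩ := hb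
    exact ⟨bitNet_correct _ (by simp), bitNet_correct _ (by simp)⟩
  | lam h ih =>
    intro ρ p o hf l Δ R S hb
    simp [translate] at hb
    exact ih (hf.lam _) _ _ _ _ hb
  | app hs _ _ _ ih1 ih2 =>
    intro ρ p o hf l Δ R S hb
    simp [translate] at hb
    rcases hb with hb | hb
    · exact ih1 ((hf.left hs).child 0) _ _ _ _ hb
    · exact ih2 ((hf.right hs).child 1) _ _ _ _ hb
  | pair hs _ _ _ ih1 ih2 =>
    intro ρ p o hf l Δ R S hb
    simp [translate] at hb
    rcases hb with hb | hb
    · exact ih1 ((hf.left hs).child 0) _ _ _ _ hb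
    · exact ih2 ((hf.right hs).child 1) _ _ _ _ hb
  | letp hs _ h1 _ ih1 ih2 =>
    intro ρ p o hf l Δ R S hb
    simp [translate, h1.tyOf_eq (hf.left hs).ty, Ty.components] at hb
    rcases hb with hb | hb
    · exact ih1 ((hf.left hs).child 0) _ _ _ _ hb
    · exact ih2 ((hf.right hs).letp _ _) _ _ _ _ hb
  | @ite Γ V A t u v h1 h2 h3 ih1 ih2 ih3 =>
    intro ρ p o hf l Δ R S hb
    have fn := Fits.nil (p := p) (o := o) Env.nil hf.out
    simp [translate] at hb
    rcases hb with ⟨rfl, rfl, rfl, rfl⟩ | hb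
    · rw [h2.tyOf_eq fn.ty]
      have key : ∀ {w : Tm G} (c : ℕ), HasType Ctx.nil ∅ w A →
          (∀ {ρ p o}, Fits Ctx.nil ρ p o → ∀ l Δ R S,
            Link.box l Δ R S ∈ translate ρ p o w → Correct R Δ ∧ Correct S Δ) →
          Correct (translate Env.nil (c :: p) o w) [⟨o, A.toFormula⟩] := fun c h ih =>
        have fc := fn.childOut c
        Correct.intro _ _ (h.typed fc.ty) (h.sources_nodup fc)
          (h.balanced fc.ty [] (by simp) (by simp [Ctx.nil])) (h.acyclic fc).not_switchingCycle
          (fun _ _ _ _ hb => (ih fc _ _ _ _ hb).1) (fun _ _ _ _ hb => (ih fc _ _ _ _ hb).2)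
      exact ⟨key 2 h2 ih2, key 3 h3 ih3⟩
    · exact ih1 (hf.child 0) _ _ _ _ hb

/-! ## Quantum variables in translations -/

/-- Box contents are counted here too. The branches of a conditional are typed with no quantum
variables, so for them this shows that nothing in a box is tied to the register. -/
theorem HasType.mem_qvarsList {Γ V} {t : Tm G} {B} (h : HasType Γ V t B) :
    ∀ {ρ p o} {r}, r ∈ Link.qvarsList (translate ρ p o t) → r ∈ V := by
  induction h with
  | var | new | tt | ff | meas | gate =>
    intro ρ p o r hr; simp [translate, bitNet, Link.qvarsList, Link.qvars] at hr
  | qvar => intro ρ p o r hr; simpa [translate, Link.qvarsList, Link.qvars] using hr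
  | lam h ih =>
    intro ρ p o r hr
    simp [translate, Link.qvarsList, Link.qvars] at hr
    exact ih hr
  | app _ _ _ _ ih1 ih2 | pair _ _ _ _ ih1 ih2 | letp _ _ _ _ ih1 ih2 =>
    intro ρ p o r hr
    simp only [translate, Link.qvarsList, Link.qvars, Link.qvarsList_append, List.nil_append,
      List.mem_append] at hr
    exact Finset.mem_union.2 (hr.imp (fun h => ih1 h) (fun h => ih2 h))
  | ite _ _ _ ih1 ih2 ih3 =>
    intro ρ p o r hr
    simp only [translate, Link.qvarsList, Link.qvars, List.nil_append, List.mem_append] at hr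
    rcases hr with (hr | hr) | hr
    · exact absurd (ih2 hr) (by simp)
    · exact absurd (ih3 hr) (by simp)
    · exact ih1 hr

theorem HasType.qvars {Γ V} {t : Tm G} {B} (h : HasType Γ V t B) :
    ∀ {ρ p o}, ((translate ρ p o t).filterMap Link.qvar?).Nodup ∧
      ((translate ρ p o t).filterMap Link.qvar?).toFinset = V := by
  induction h with
  | var | new | tt | ff | meas | gate | qvar =>
    intro ρ p o; simp [translate, bitNet, Link.qvar?, List.filterMap_cons]
  | lam h ih => intro ρ p o; simpa [translate, List.filterMap_cons, Link.qvar?] using ih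
  | app _ hd _ _ ih1 ih2 | pair _ hd _ _ ih1 ih2 | letp _ hd _ _ ih1 ih2 =>
    intro ρ p o
    simp only [translate, List.filterMap_cons, Link.qvar?, List.filterMap_append,
      List.toFinset_append, ih1, ih2, and_true]
    refine List.nodup_append.2 ⟨ih1.1, ih2.1, ?_⟩
    rintro r hr _ hr' rfl
    rw [← List.mem_toFinset, ih1.2] at hr
    rw [← List.mem_toFinset, ih2.2] at hr'
    exact Finset.disjoint_left.1 hd hr hr'
  | ite _ _ _ ih1 _ _ =>
    intro ρ p o; simpa [translate, List.filterMap_cons, Link.qvar?] using ih1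

theorem HasType.box_qvars {Γ V} {t : Tm G} {B} (h : HasType Γ V t B) :
    ∀ {ρ p o} l Δ R S, Link.box l Δ R S ∈ translate ρ p o t →
      Link.qvarsList R = [] ∧ Link.qvarsList S = [] := by
  have hnil : ∀ {A} {u : Tm G}, HasType Ctx.nil ∅ u A → ∀ {ρ p o},
      Link.qvarsList (translate ρ p o u) = [] := fun h _ _ _ =>
    List.eq_nil_iff_forall_not_mem.2 fun r hr => by simpa using h.mem_qvarsList hr
  induction h with
  | var | qvar | new | tt | ff | gate => intro ρ p o l Δ R S hb; simp [translate, bitNet] at hb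
  | meas =>
    intro ρ p o l Δ R S hb
    simp [translate] at hb
    obtain ⟨rfl, rfl, rfl, rfl⟩ := hb
    simp [bitNet, Link.qvarsList, Link.qvars]
  | lam h ih =>
    intro ρ p o l Δ R S hb
    simp [translate] at hb
    exact ih _ _ _ _ hb
  | app _ _ _ _ ih1 ih2 | pair _ _ _ _ ih1 ih2 | letp _ _ _ _ ih1 ih2 =>
    intro ρ p o l Δ R S hb
    simp [translate] at hb
    rcases hb with hb | hb
    · exact ih1 _ _ _ _ hb
    · exact ih2 _ _ _ _ hb
  | ite h1 h2 h3 ih1 _ _ =>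
    intro ρ p o l Δ R S hb
    simp [translate] at hb
    rcases hb with ⟨rfl, rfl, rfl, rfl⟩ | hb
    · exact ⟨hnil h2, hnil h3⟩
    · exact ih1 _ _ _ _ hb

theorem Raw.IsClosure.isNet {A : Ty} {c : Raw G} (h : c.IsClosure A) :
    (c.toQStruct A).IsNet where
  correct := h.2.correct (Fits.nil Env.nil (dig_nil _)) [] List.nodup_nil (by simp [Ctx.nil])
  state := h.1
  nodup := h.2.qvars.1
  vars := h.2.qvars.2
  depth := h.2.box_qvars

theorem Closure.isNet {A : Ty} (C : Closure G A) : C.toNet.IsNet := by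
  induction C using Quot.ind with
  | mk c => exact ⟨_, rfl, c.2.isNet⟩

/-! ## Renaming the edges of translations -/

/-- Rename an edge, keeping its label. -/
def Edge.mapName (g : List ℕ → List ℕ) (e : Edge) : Edge := ⟨g e.name, e.ty⟩

theorem Env.tys_congr_scons {ρ ρ' : Env} (h : ρ.tys = ρ'.tys) (n n' : List ℕ) (A : Ty) :
    Env.tys (scons (n, A) ρ) = Env.tys (scons (n', A) ρ') := by
  simp [h]

/-- Internal names are only ever formed by prepending to the position, so the translation is
equivariant. The condition `g [] = []` is there because box contents are translated in `Env.nil`,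
all of whose names are `[]`. -/
theorem translate_mapName {g : List ℕ → List ℕ} (hg : g [] = []) (t : Tm G) :
    ∀ {ρ ρ' : Env} {p p' o o' : List ℕ}, ρ.tys = ρ'.tys → (∀ i, g (ρ i).1 = (ρ' i).1) →
      (∀ w a, g (w ++ a :: p) = w ++ a :: p') → g o = o' →
      Link.mapList (Edge.mapName g) id (translate ρ p o t) = translate ρ' p' o' t := by
  have hchild : ∀ {p p' : List ℕ}, (∀ w a, g (w ++ a :: p) = w ++ a :: p') →
      ∀ c w a, g (w ++ a :: c :: p) = w ++ a :: c :: p' := by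
    intro p p' h c w a
    simpa using h (w ++ [a]) c
  have hone : ∀ {p p' : List ℕ}, (∀ w a, g (w ++ a :: p) = w ++ a :: p') →
      ∀ c, g (c :: p) = c :: p' := by
    intro p p' h c
    simpa using h [] c
  have hnil : ∀ i, g (Env.nil i).1 = (Env.nil i).1 := fun _ => hg
  induction t with
  | var i =>
    intro ρ ρ' p p' o o' ht hρ hp ho
    have : (ρ i).2 = (ρ' i).2 := congrFun ht i
    simp [translate, Link.mapList, Link.map, Edge.mapName, hρ, ho, this]
  | qvar | new | tt | ff | meas | gate =>
    intro ρ ρ' p p' o o' ht hρ hp ho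
    simp [translate, bitNet, Link.mapList, Link.map, Edge.mapName, ho, hone hp]
  | lam A t ih =>
    intro ρ ρ' p p' o o' ht hρ hp ho
    have ht' := Env.tys_congr_scons ht (1 :: p) (1 :: p') A
    have := ih (p := 0 :: p) (o := 0 :: p) ht'
      (by rintro (_ | i); exacts [hone hp 1, hρ i]) (hchild hp 0) (hone hp 0)
    simp only [translate, Link.mapList, Link.map, Edge.mapName, ho, hone hp, this, ht']
  | app t u ih1 ih2 | pair t u ih1 ih2 =>
    intro ρ ρ' p p' o o' ht hρ hp ho
    have h1 := ih1 ht hρ (hchild hp 0) (hone hp 0)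
    have h2 := ih2 ht hρ (hchild hp 1) (hone hp 1)
    simp only [translate, Link.mapList, Link.map, Edge.mapName, ho, hone hp, h1, h2, ht,
      mapList_append]
  | letp t u ih1 ih2 =>
    intro ρ ρ' p p' o o' ht hρ hp ho
    have h1 := ih1 ht hρ (hchild hp 0) (hone hp 0)
    have h2 := ih2 (Env.tys_congr_scons (Env.tys_congr_scons ht (1 :: p) (1 :: p')
      (tyOf ρ'.tys t).components.1) (2 :: p) (2 :: p') (tyOf ρ'.tys t).components.2)
      (by rintro (_ | _ | i); exacts [hone hp 2, hone hp 1, hρ i]) (hchild hp 4) ho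
    simp only [translate, Link.mapList, Link.map, Edge.mapName, hone hp, h1, h2, ht,
      mapList_append]
  | ite t u v ih1 ih2 ih3 =>
    intro ρ ρ' p p' o o' ht hρ hp ho
    have h1 := ih1 ht hρ (hchild hp 0) (hone hp 0)
    have h2 := ih2 rfl hnil (hchild hp 2) ho
    have h3 := ih3 rfl hnil (hchild hp 3) ho
    simp only [translate, Link.mapList, Link.map, Edge.mapName, hone hp, ho, h1, h2, h3,
      List.map_cons, List.map_nil]

/-- The result of renaming the output of a translation. -/
theorem HasType.translate_rename_out {Γ V} {t : Tm G} {B} (h : HasType Γ V t B) {ρ : Env}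
    {p o o' : List ℕ} (hρ : Agree Γ ρ.tys) (ho : dig p o = none) (hn : o ≠ [])
    (hne : ∀ i, (ρ i).1 ≠ o) :
    Link.mapList (Function.update id ⟨o, B.toFormula⟩ ⟨o', B.toFormula⟩) id (translate ρ p o t) =
      translate ρ p o' t := by
  have hp : ∀ w a, Function.update id o o' (w ++ a :: p) = w ++ a :: p := fun w a => by
    have : w ++ a :: p ≠ o := fun h => by simp [← h] at ho
    simp [this]
  -- Renaming every edge called `o` has the same effect as renaming the single labelled edge,
  -- because the output is the only edge with this name.
  rw [← translate_mapName (g := Function.update id o o') (by simp [hn.symm]) t (o := o) (o' := o')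
    rfl (fun i => by simp [hne i]) hp (by simp)]
  · apply Link.mapList_congr
    intro e he
    rcases h.edges hρ e he with rfl | he | ⟨i, A, _, rfl⟩
    · simp [Edge.mapName]
    · have hne : e.name ≠ o := fun h => he (by rw [h, ho])
      have : e ≠ ⟨o, B.toFormula⟩ := fun h => hne (by rw [h])
      simp [Edge.mapName, hne, this]
    · have : ρ.edge i ≠ ⟨o, B.toFormula⟩ := fun h => hne i (congrArg Edge.name h)
      rw [Function.update_of_ne this]
      simp [Edge.mapName, Env.edge, hne i]

/-- Move the names below `p` to names below `q`. -/
def reloc (p q z : List ℕ) : List ℕ :=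
  if dig p z = none then z else z.take (z.length - p.length) ++ q

theorem reloc_append (p q w : List ℕ) (a : ℕ) : reloc p q (w ++ a :: p) = w ++ a :: q := by
  have : (w ++ a :: p).take ((w ++ a :: p).length - p.length) = w ++ [a] := by
    rw [show w ++ a :: p = (w ++ [a]) ++ p by simp]
    exact List.take_left' (by simp; omega)
  rw [reloc, if_neg (by simp), this]
  simp

theorem reloc_eq_self {p z : List ℕ} (q : List ℕ) (h : dig p z = none) : reloc p q z = z :=
  if_pos h

theorem QNet.mk_perm {L L' : List Link} (h : L.Perm L') (Γ V Q) :
    QNet.mk ⟨L, Γ, V, Q⟩ = QNet.mk ⟨L', Γ, V, Q⟩ :=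
  Quot.sound (QStruct.Iso.same Γ V Q (SameLinks.perm h))

/-- Moving the internal names from below `p` to below `q` is an isomorphism as soon as no edge
outside `p` lies below `q`. One position may be below the other, which is how the net of a reduct is
brought back to the position of the redex. -/
theorem QNet.mk_relocate {W} {t : Tm G} {A} (h : HasType Ctx.nil W t A) {p q o : List ℕ}
    {K : List Link} {Γ : List Edge} (V Q) (hp : dig p o = none) (hq : dig q o = none)
    (hK : ∀ e ∈ Link.edgesList K, dig p e.name = none ∧ dig q e.name = none)
    (hΓ : ∀ e ∈ Γ, dig p e.name = none ∧ dig q e.name = none) :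
    QNet.mk ⟨translate Env.nil p o t ++ K, Γ, V, Q⟩ =
      QNet.mk ⟨translate Env.nil q o t ++ K, Γ, V, Q⟩ := by
  have h1 : ∀ e : Edge, dig p e.name = none → Edge.mapName (reloc p q) e = e :=
    fun e he => by rw [Edge.mapName, reloc_eq_self q he]
  have key : ∀ e, e ∈ Link.edgesList (translate Env.nil p o t ++ K) ∨ e ∈ Γ →
      dig p e.name = none → dig q e.name = none := by
    rintro e (he | he) hd
    · rw [Link.edgesList_append, List.mem_append] at he
      rcases he with he | he
      · rcases h.edges (Agree.nil _) e he with rfl | he | ⟨i, _, hi, _⟩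
        · exact hq
        · exact absurd hd he
        · simp [Ctx.nil] at hi
      · exact (hK e he).2
    · exact (hΓ e he).2
  have hiso := QStruct.Iso.edges (translate Env.nil p o t ++ K) Γ V Q (Edge.mapName (reloc p q))
    (fun _ => rfl) (by
      rintro ⟨e, A⟩ he ⟨e', A'⟩ he' hee
      simp only [Edge.mapName, Edge.mk.injEq] at hee ⊢
      refine ⟨?_, hee.2⟩
      have he := key _ he
      have he' := key _ he'
      simp only at he he'
      have hee := hee.1
      -- A clash of a moved edge with an unmoved one would put the latter below `q`, against `key`.
      rcases hd : dig p e with _ | a <;> rcases hd' : dig p e' with _ | a'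
      · rwa [reloc_eq_self q hd, reloc_eq_self q hd'] at hee
      · obtain ⟨w, rfl⟩ := dig_eq_some.1 hd'
        rw [reloc_eq_self q hd, reloc_append] at hee
        simp [hee] at he hd
        exact absurd hd (by simpa using he)
      · obtain ⟨w, rfl⟩ := dig_eq_some.1 hd
        rw [reloc_eq_self q hd', reloc_append] at hee
        simp [← hee] at he' hd'
        exact absurd hd' (by simpa using he')
      · obtain ⟨w, rfl⟩ := dig_eq_some.1 hd
        obtain ⟨w', rfl⟩ := dig_eq_some.1 hd'
        rw [reloc_append, reloc_append] at hee
        have : (w ++ [a]) ++ q = (w' ++ [a']) ++ q := by simpa using hee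
        have := List.append_cancel_right this
        calc w ++ a :: p = (w ++ [a]) ++ p := by simp
          _ = (w' ++ [a']) ++ p := by rw [this]
          _ = _ := by simp)
  rw [mapList_append, translate_mapName (reloc_eq_self q (dig_nil p)) t rfl
    (fun i => reloc_eq_self q (dig_nil p)) (reloc_append p q) (reloc_eq_self q hp),
    Link.mapList_eq_self fun e he => h1 e (hK e he).1,
    show Γ.map (Edge.mapName (reloc p q)) = Γ from
      (List.map_congr_left fun e he => h1 e (hΓ e he).1).trans (List.map_id Γ)] at hiso
  exact Quot.sound hiso

/-! ## Reductions of probability one -/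

/-- Reduction by steps of probability one. -/
def QNet.Red : QNet → QNet → Prop := Relation.ReflTransGen fun n n' => n.Step [(1, n')]

theorem QNet.Red.trans {n n' n'' : QNet} (h : n.Red n') (h' : n'.Red n'') : n.Red n'' :=
  Relation.ReflTransGen.trans h h'

theorem QNet.Red.refl (n : QNet) : n.Red n := Relation.ReflTransGen.refl

theorem QNet.Red.of_eq {n n' : QNet} (h : n = n') : n.Red n' := h ▸ QNet.Red.refl n

theorem QNet.Red.of_step {N N' : QStruct} (h : N.Step [(1, N')]) : (mk N).Red (mk N') :=
  Relation.ReflTransGen.single ⟨N, _, rfl, h, rfl⟩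

/-- `n` reduces to the distribution `l`, whatever the points of `l` reduce to afterwards. -/
def QNet.Reach (n : QNet) (l : List (ℝ≥0 × QNet)) : Prop :=
  ∀ E : Fin l.length → QNet →₀ ℝ≥0, (∀ i, (l.get i).2.Reduces (E i)) →
    n.Reduces (∑ i, (l.get i).1 • E i)

theorem QNet.Reach.of_step {n : QNet} {l} (h : n.Step l) : n.Reach l :=
  fun E hE => Multi.step n l E h hE

/-- Steps of probability one can be prefixed to any reduction tree, since a one-point distribution
of weight `1` does not change the sum. -/
theorem QNet.Reach.head {n n' : QNet} {l} (h : n.Red n') (h' : n'.Reach l) : n.Reach l := by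
  induction h using Relation.ReflTransGen.head_induction_on with
  | refl => exact h'
  | @head n n' hs _ ih =>
    intro E hE
    have := Multi.step _ _ (fun _ : Fin 1 => ∑ i, (l.get i).1 • E i) hs fun i => by
      have : i = 0 := Subsingleton.elim (α := Fin 1) _ _
      subst this
      exact ih E hE
    have e : ∑ i : Fin 1, (([(1, n')] : List (ℝ≥0 × QNet)).get i).1 • ∑ i, (l.get i).1 • E i =
        ∑ i, (l.get i).1 • E i := by simp
    exact e ▸ this

theorem QNet.Red.reach {n n' : QNet} (h : n.Red n') : n.Reach [(1, n')] :=
  QNet.Reach.head h fun E hE => by simpa using hE 0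

theorem QNet.mk_cut_swap (a b L Γ V Q) :
    QNet.mk ⟨.cut a b :: L, Γ, V, Q⟩ = QNet.mk ⟨.cut b a :: L, Γ, V, Q⟩ :=
  Quot.sound (QStruct.Iso.same Γ V Q (SameLinks.cut a b L))

theorem QNet.Red.axCut {L : List Link} {a b c K} (h : L.Perm (.cut a b :: .ax b c :: K))
    (hac : a ≠ c) (Γ V Q) : (mk ⟨L, Γ, V, Q⟩).Red
      (mk ⟨Link.mapList (Function.update id a c) id K, Γ, V, Q⟩) := by
  rw [mk_perm h]
  exact .of_step (.axCut a b c K Γ V Q hac)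

theorem QNet.Red.axCut_swap {L : List Link} {a b c K} (h : L.Perm (.cut b a :: .ax b c :: K))
    (hac : a ≠ c) (Γ V Q) : (mk ⟨L, Γ, V, Q⟩).Red
      (mk ⟨Link.mapList (Function.update id a c) id K, Γ, V, Q⟩) := by
  rw [mk_perm h, mk_cut_swap]
  exact .of_step (.axCut a b c K Γ V Q hac)

theorem QNet.Red.tensPar {L : List Link} {a b c a' b' c' K}
    (h : L.Perm (.cut c c' :: .tens a b c :: .par a' b' c' :: K)) (Γ V Q) :
    (mk ⟨L, Γ, V, Q⟩).Red (mk ⟨.cut a a' :: .cut b b' :: K, Γ, V, Q⟩) := by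
  rw [mk_perm h]
  exact .of_step (.tensPar a b c a' b' c' K Γ V Q)

theorem QNet.Red.tensPar_swap {L : List Link} {a b c a' b' c' K}
    (h : L.Perm (.cut c' c :: .tens a b c :: .par a' b' c' :: K)) (Γ V Q) :
    (mk ⟨L, Γ, V, Q⟩).Red (mk ⟨.cut a a' :: .cut b b' :: K, Γ, V, Q⟩) := by
  rw [mk_perm h, mk_cut_swap]
  exact .of_step (.tensPar a b c a' b' c' K Γ V Q)

/-- A renaming of one edge leaves links without this edge alone. -/
theorem Link.mapList_update_eq_self {K : List Link} {n : List ℕ} {A : Formula} {c : Edge}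
    (h : ∀ e ∈ Link.edgesList K, e.name ≠ n) :
    Link.mapList (Function.update id ⟨n, A⟩ c) id K = K :=
  Link.mapList_eq_self fun e he => by
    have : e ≠ ⟨n, A⟩ := fun h' => h e he (by rw [h'])
    simp [this]

/-! ## Substitution -/

/-- Leave out the index `k`. -/
def skip {α : Type*} (k : ℕ) (f : ℕ → α) : ℕ → α := fun i => if i < k then f i else f (i + 1)

/-- `skip` does to contexts and environments what `Tm.subst` does to indices; going under a binder
raises the omitted index by one in both. -/
theorem skip_scons {α : Type*} (k : ℕ) (a : α) (f : ℕ → α) :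
    skip (k + 1) (scons a f) = scons a (skip k f) := by
  funext i
  cases i with
  | zero => simp [skip, scons]
  | succ i => simp [skip, scons]

theorem skip_zero_scons {α : Type*} (a : α) (f : ℕ → α) : skip 0 (scons a f) = f := rfl

theorem skip_nil (k : ℕ) : skip k Ctx.nil = Ctx.nil := by funext i; simp [skip, Ctx.nil]

theorem skip_envNil (k : ℕ) : skip k Env.nil = Env.nil := by funext i; simp [skip, Env.nil]

theorem Ctx.Split.skip {Γ Γ₁ Γ₂ : Ctx} (h : Ctx.Split Γ Γ₁ Γ₂) (k : ℕ) :
    Ctx.Split (QSMLL.skip k Γ) (QSMLL.skip k Γ₁) (QSMLL.skip k Γ₂) := by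
  intro i
  simp only [QSMLL.skip]
  split_ifs
  · exact h i
  · exact h (i + 1)

theorem Agree.skip {Γ : Ctx} {ρ : Env} (h : Agree Γ ρ.tys) (k : ℕ) :
    Agree (QSMLL.skip k Γ) (Env.tys (QSMLL.skip k ρ)) := by
  intro i A hi
  simp only [Env.tys, QSMLL.skip] at hi ⊢
  split_ifs at hi ⊢
  · exact h i A hi
  · exact h (i + 1) A hi

theorem Ctx.Split.none {Γ Γ₁ Γ₂ : Ctx} (h : Ctx.Split Γ Γ₁ Γ₂) {k} (hk : Γ k = none) :
    Γ₁ k = .none ∧ Γ₂ k = .none := by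
  rcases h k with ⟨h1, h2⟩ | ⟨h1, h2⟩ <;> simp_all

theorem Ctx.Split.some {Γ Γ₁ Γ₂ : Ctx} (h : Ctx.Split Γ Γ₁ Γ₂) {k A} (hk : Γ k = some A) :
    (Γ₁ k = .some A ∧ Γ₂ k = .none) ∨ (Γ₁ k = .none ∧ Γ₂ k = .some A) := by
  rcases h k with ⟨h1, h2⟩ | ⟨h1, h2⟩ <;> simp_all

theorem skip_update_of_ne {i k : ℕ} (h : i ≠ k) (A : Ty) :
    skip k (Function.update Ctx.nil i (some A)) =
      Function.update Ctx.nil (if k < i then i - 1 else i) (some A) := by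
  funext j
  simp only [skip, Function.update_apply, Ctx.nil]
  grind

theorem HasType.subst_of_none {Γ V} {t : Tm G} {B} (h : HasType Γ V t B) (s : Tm G) :
    ∀ {k}, Γ k = none → HasType (skip k Γ) V (Tm.subst s k t) B := by
  induction h with
  | var i A =>
    intro k hk
    have hik : i ≠ k := fun e => by simp [e] at hk
    rw [skip_update_of_ne hik, Tm.subst, if_neg hik]
    split_ifs <;> exact HasType.var _ _
  | qvar | new | tt | ff | meas | gate =>
    intro k _; rw [skip_nil]; constructor
  | lam _ ih =>
    intro k hk
    exact .lam (by rw [← skip_scons]; exact ih hk)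
  | app hs hd _ _ ih1 ih2 =>
    intro k hk
    exact .app (hs.skip k) hd (ih1 (hs.none hk).1) (ih2 (hs.none hk).2)
  | pair hs hd _ _ ih1 ih2 =>
    intro k hk
    exact .pair (hs.skip k) hd (ih1 (hs.none hk).1) (ih2 (hs.none hk).2)
  | letp hs hd _ _ ih1 ih2 =>
    intro k hk
    exact .letp (hs.skip k) hd (ih1 (hs.none hk).1)
      (by rw [← skip_scons, ← skip_scons]; exact ih2 (hs.none hk).2)
  | ite _ _ _ ih1 ih2 ih3 =>
    intro k hk
    refine .ite (ih1 hk) ?_ ?_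
    · simpa only [skip_nil] using ih2 (k := k) rfl
    · simpa only [skip_nil] using ih3 (k := k) rfl

/-- By linearity the variable belongs to exactly one premise, which also receives `W`; in the other,
`HasType.subst_of_none` applies. In a conditional only the tested term can contain it, the branches
being closed. -/
theorem HasType.subst {Γ V} {t : Tm G} {B} (h : HasType Γ V t B) {W} {s : Tm G} {A}
    (hs : HasType Ctx.nil W s A) :
    ∀ {k}, Γ k = some A → Disjoint V W → HasType (skip k Γ) (V ∪ W) (Tm.subst s k t) B := by
  have hl : ∀ V₁ V₂ : Finset ℕ, V₁ ∪ V₂ ∪ W = V₁ ∪ W ∪ V₂ := fun _ _ => Finset.union_right_comm ..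
  have hr : ∀ V₁ V₂ : Finset ℕ, V₁ ∪ V₂ ∪ W = V₁ ∪ (V₂ ∪ W) := fun _ _ => Finset.union_assoc ..
  induction h with
  | var i C =>
    intro k hk hd
    have hik : i = k := by
      by_contra e
      simp [Ctx.nil, Function.update_of_ne (Ne.symm e)] at hk
    subst hik
    obtain rfl : C = A := by simpa using hk
    have : skip i (Function.update Ctx.nil i (some C)) = Ctx.nil := by
      funext j
      simp only [skip, Function.update_apply, Ctx.nil]
      grind
    rw [this, Tm.subst, if_pos rfl, Finset.empty_union]
    exact hs
  | qvar | new | tt | ff | meas | gate => intro k hk; simp [Ctx.nil] at hk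
  | lam _ ih =>
    intro k hk hd
    exact .lam (by rw [← skip_scons]; exact ih hk hd)
  | app hsp hd h1 h2 ih1 ih2 =>
    intro k hk hW
    rw [Finset.disjoint_union_left] at hW
    rcases hsp.some hk with ⟨hk1, hk2⟩ | ⟨hk1, hk2⟩
    · rw [hl]
      exact .app (hsp.skip k) (Finset.disjoint_union_left.2 ⟨hd, hW.2.symm⟩) (ih1 hk1 hW.1)
        (h2.subst_of_none s hk2)
    · rw [hr]
      exact .app (hsp.skip k) (Finset.disjoint_union_right.2 ⟨hd, hW.1⟩) (h1.subst_of_none s hk1)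
        (ih2 hk2 hW.2)
  | pair hsp hd h1 h2 ih1 ih2 =>
    intro k hk hW
    rw [Finset.disjoint_union_left] at hW
    rcases hsp.some hk with ⟨hk1, hk2⟩ | ⟨hk1, hk2⟩
    · rw [hl]
      exact .pair (hsp.skip k) (Finset.disjoint_union_left.2 ⟨hd, hW.2.symm⟩) (ih1 hk1 hW.1)
        (h2.subst_of_none s hk2)
    · rw [hr]
      exact .pair (hsp.skip k) (Finset.disjoint_union_right.2 ⟨hd, hW.1⟩) (h1.subst_of_none s hk1)
        (ih2 hk2 hW.2)
  | letp hsp hd h1 h2 ih1 ih2 =>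
    intro k hk hW
    rw [Finset.disjoint_union_left] at hW
    rcases hsp.some hk with ⟨hk1, hk2⟩ | ⟨hk1, hk2⟩
    · rw [hl]
      exact .letp (hsp.skip k) (Finset.disjoint_union_left.2 ⟨hd, hW.2.symm⟩) (ih1 hk1 hW.1)
        (by rw [← skip_scons, ← skip_scons]; exact h2.subst_of_none s hk2)
    · rw [hr]
      exact .letp (hsp.skip k) (Finset.disjoint_union_right.2 ⟨hd, hW.1⟩) (h1.subst_of_none s hk1)
        (by rw [← skip_scons, ← skip_scons]; exact ih2 hk2 hW.2)
  | ite h1 h2 h3 ih1 _ _ =>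
    intro k hk hW
    refine .ite (ih1 hk hW) ?_ ?_
    · simpa only [skip_nil] using h2.subst_of_none s (k := k) rfl
    · simpa only [skip_nil] using h3.subst_of_none s (k := k) rfl

/-- Only the entries of `ρ` for the variables of `Γ` matter. A closed term has the same net in any
environment, so it may be inserted anywhere. -/
theorem HasType.translate_congr {Γ V} {t : Tm G} {B} (h : HasType Γ V t B) :
    ∀ {ρ ρ' : Env} {p o}, Agree Γ ρ.tys → (∀ i A, Γ i = some A → ρ i = ρ' i) →
      translate ρ p o t = translate ρ' p o t := by
  have tr : ∀ {Γ : Ctx} {ρ ρ' : Env}, Agree Γ ρ.tys → (∀ i A, Γ i = some A → ρ i = ρ' i) →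
      Agree Γ ρ'.tys := fun h h' i A hi => by
    rw [← h i A hi, Env.tys, Env.tys, h' i A hi]
  have sc : ∀ {Γ : Ctx} {ρ ρ' : Env} x A, (∀ i A, Γ i = some A → ρ i = ρ' i) →
      ∀ i C, scons (some A) Γ i = some C → (scons x ρ : Env) i = (scons x ρ' : Env) i := by
    rintro Γ ρ ρ' x A h (_ | i) C hC
    · rfl
    · exact h i C hC
  induction h with
  | var i A =>
    intro ρ ρ' p o hρ hr
    simp [translate, hr i A (by simp)]
  | qvar | new | tt | ff | meas | gate => intros; rfl
  | lam h ih =>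
    intro ρ ρ' p o hρ hr
    simp only [translate, Env.tys_scons, h.tyOf_eq (hρ.scons _), h.tyOf_eq ((tr hρ hr).scons _)]
    rw [ih (by rw [Env.tys_scons]; exact hρ.scons _) (sc _ _ hr)]
  | app hs _ h1 h2 ih1 ih2 =>
    intro ρ ρ' p o hρ hr
    have hρ' := tr hρ hr
    simp only [translate, tyOf, h1.tyOf_eq (hρ.left hs), h1.tyOf_eq (hρ'.left hs),
      h2.tyOf_eq (hρ.right hs), h2.tyOf_eq (hρ'.right hs)]
    rw [ih1 (hρ.left hs) fun i A hi => hr i A (hs.left hi),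
      ih2 (hρ.right hs) fun i A hi => hr i A (hs.right hi)]
  | pair hs _ h1 h2 ih1 ih2 =>
    intro ρ ρ' p o hρ hr
    have hρ' := tr hρ hr
    simp only [translate, h1.tyOf_eq (hρ.left hs), h1.tyOf_eq (hρ'.left hs),
      h2.tyOf_eq (hρ.right hs), h2.tyOf_eq (hρ'.right hs)]
    rw [ih1 (hρ.left hs) fun i A hi => hr i A (hs.left hi),
      ih2 (hρ.right hs) fun i A hi => hr i A (hs.right hi)]
  | letp hs _ h1 h2 ih1 ih2 =>
    intro ρ ρ' p o hρ hr
    have hρ' := tr hρ hr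
    simp only [translate, h1.tyOf_eq (hρ.left hs), h1.tyOf_eq (hρ'.left hs), Ty.components]
    rw [ih1 (hρ.left hs) fun i A hi => hr i A (hs.left hi),
      ih2 (by simp only [Env.tys_scons]; exact ((hρ.right hs).scons _).scons _)
        (sc _ _ (sc _ _ fun i A hi => hr i A (hs.right hi)))]
  | ite h1 h2 h3 ih1 ih2 ih3 =>
    intro ρ ρ' p o hρ hr
    simp only [translate]
    rw [ih1 hρ hr]

/-- When the variable does not occur, substitution merely lowers indices and `skip` compensates for
it, so the two lists of links are literally equal. -/
theorem HasType.translate_subst_of_none {Γ V} {t : Tm G} {B} (h : HasType Γ V t B) (s : Tm G) :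
    ∀ {k} {ρ : Env} {p o}, Γ k = none → Agree Γ ρ.tys →
      translate (skip k ρ) p o (Tm.subst s k t) = translate ρ p o t := by
  induction h with
  | var i A =>
    intro k ρ p o hk hρ
    have hik : i ≠ k := fun e => by simp [e] at hk
    have : (skip k ρ) (if k < i then i - 1 else i) = ρ i := by
      simp only [skip]
      split_ifs <;> first | rfl | omega | (congr 1; omega)
    rw [Tm.subst, if_neg hik]
    split_ifs at this ⊢ <;> simp [translate, this]
  | qvar | new | tt | ff | meas | gate => intros; rfl
  | lam h ih =>
    intro k ρ p o hk hρ
    have ht := h.subst_of_none s (k := k + 1) hk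
    rw [skip_scons] at ht
    simp only [Tm.subst, translate, Env.tys_scons, h.tyOf_eq (hρ.scons _),
      ht.tyOf_eq ((hρ.skip k).scons _)]
    rw [← skip_scons, ih (k := k + 1) hk (by rw [Env.tys_scons]; exact hρ.scons _)]
  | app hs _ h1 h2 ih1 ih2 =>
    intro k ρ p o hk hρ
    have hk := hs.none hk
    simp only [Tm.subst, translate, tyOf, h1.tyOf_eq (hρ.left hs), h2.tyOf_eq (hρ.right hs),
      (h1.subst_of_none s hk.1).tyOf_eq ((hρ.left hs).skip k),
      (h2.subst_of_none s hk.2).tyOf_eq ((hρ.right hs).skip k)]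
    rw [ih1 hk.1 (hρ.left hs), ih2 hk.2 (hρ.right hs)]
  | pair hs _ h1 h2 ih1 ih2 =>
    intro k ρ p o hk hρ
    have hk := hs.none hk
    simp only [Tm.subst, translate, h1.tyOf_eq (hρ.left hs), h2.tyOf_eq (hρ.right hs),
      (h1.subst_of_none s hk.1).tyOf_eq ((hρ.left hs).skip k),
      (h2.subst_of_none s hk.2).tyOf_eq ((hρ.right hs).skip k)]
    rw [ih1 hk.1 (hρ.left hs), ih2 hk.2 (hρ.right hs)]
  | letp hs _ h1 h2 ih1 ih2 =>
    intro k ρ p o hk hρ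
    have hk := hs.none hk
    simp only [Tm.subst, translate, h1.tyOf_eq (hρ.left hs),
      (h1.subst_of_none s hk.1).tyOf_eq ((hρ.left hs).skip k), Ty.components]
    rw [ih1 hk.1 (hρ.left hs), ← skip_scons, ← skip_scons, ih2 (k := k + 2) hk.2
      (by simp only [Env.tys_scons]; exact ((hρ.right hs).scons _).scons _)]
  | ite h1 h2 h3 ih1 ih2 ih3 =>
    intro k ρ p o hk hρ
    have e2 := h2.subst_of_none s (k := k) rfl
    rw [skip_nil] at e2
    have t2 := fun p o => ih2 (k := k) (ρ := Env.nil) (p := p) (o := o) rfl (Agree.nil _)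
    have t3 := fun p o => ih3 (k := k) (ρ := Env.nil) (p := p) (o := o) rfl (Agree.nil _)
    simp only [skip_envNil] at t2 t3
    simp only [Tm.subst, translate, h2.tyOf_eq (Agree.nil _), e2.tyOf_eq (Agree.nil _), ih1 hk hρ,
      t2, t3]

theorem dig_none_of_suffix {p q z : List ℕ} (h : p <:+ q) (hz : dig p z = none) :
    dig q z = none := by
  obtain ⟨w, rfl⟩ := h
  by_contra h'
  exact dig_ne_none_of_append h' hz

/-- Used when the interesting position `q` lies in branch `c` of `p`: links at `p` and in sibling
branches have no name below `q`. -/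
theorem dig_none_of_cons_suffix {p q z : List ℕ} {c : ℕ} (h : (c :: p) <:+ q)
    (hz : dig p z ≠ some c) : dig q z = none :=
  dig_none_of_suffix h (dig_cons_none hz)

theorem HasType.dig_child {Γ V} {t : Tm G} {B} (h : HasType Γ V t B) {ρ : Env} {p} {c d : ℕ}
    (hρ : Agree Γ ρ.tys) (hρp : ∀ i, dig p (ρ i).1 = none) (hcd : c ≠ d) {e}
    (he : e ∈ Link.edgesList (translate ρ (c :: p) (c :: p) t)) : dig p e.name ≠ some d := by
  rcases h.edges hρ e he with rfl | he | ⟨i, A, hi, rfl⟩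
  · simpa using hcd
  · rw [dig_cons he]; simpa using hcd
  · simp [Env.edge, hρp]

theorem perm_context_nil {α : Type*} {A L X K : List α} (h : L.Perm (X ++ K)) :
    (A ++ L).Perm (X ++ (A ++ K)) := by
  classical
  rw [List.perm_iff_count] at h ⊢
  intro y
  have := h y
  simp only [List.count_append] at this ⊢
  omega

theorem perm_context_left {α : Type*} {A L M X K : List α} (h : L.Perm (X ++ K)) :
    (A ++ (L ++ M)).Perm (X ++ (A ++ (K ++ M))) :=
  perm_context_nil (K := K ++ M) (by simpa only [List.append_assoc] using h.append_right M)

theorem perm_context_right {α : Type*} {A L M X K : List α} (h : L.Perm (X ++ K)) :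
    (A ++ (M ++ L)).Perm (X ++ (A ++ (M ++ K))) := by
  simpa only [List.append_assoc] using perm_context_nil (A := A ++ M) h

/-- The translation of a term with a variable, and of the term with another term substituted for
this variable. -/
theorem HasType.translate_subst {Γ V} {t : Tm G} {B} (h : HasType Γ V t B) {W} {s : Tm G} {A}
    (hs : HasType Ctx.nil W s A) :
    ∀ {k} {ρ : Env} {p o}, Γ k = some A → Disjoint V W → Agree Γ ρ.tys →
      (∀ i, dig p (ρ i).1 = none) → dig p o = none →
      ∃ q x K, (translate ρ p o t).Perm (.ax (ρ.edge k) ⟨x, A.toFormula⟩ :: K) ∧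
        (translate (skip k ρ) p o (Tm.subst s k t)).Perm (translate Env.nil q x s ++ K) ∧
        (∀ e ∈ Link.edgesList K, dig q e.name = none) ∧ dig q x = none ∧ p <:+ q := by
  have hch : ∀ {ρ : Env} {p} c, (∀ i, dig p (ρ i).1 = none) → ∀ i, dig (c :: p) (ρ i).1 = none :=
    fun c h i => dig_cons_none (by simp [h i])
  have hsc : ∀ {ρ : Env} {p n} A, (∀ i, dig p (ρ i).1 = none) → dig p n = none →
      ∀ i, dig p ((scons (n, A) ρ : Env) i).1 = none := by
    rintro ρ p n A h hn (_ | i)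
    exacts [hn, h i]
  induction h with
  | var i C =>
    intro k ρ p o hk hd hρ hρp ho
    have hik : i = k := by
      by_contra e
      simp [Ctx.nil, Function.update_of_ne (Ne.symm e)] at hk
    subst hik
    obtain rfl : C = A := by simpa using hk
    have : (ρ i).2 = C := hρ i C (by simp)
    -- The net of the variable is the axiom itself, so nothing is left over and `s` takes its
    -- position and output.
    refine ⟨p, o, [], ?_, ?_, by simp [Link.edgesList], ho, List.suffix_rfl⟩
    · simp [translate, Env.edge, this]
    · rw [Tm.subst, if_pos rfl, List.append_nil, hs.translate_congr (ρ' := Env.nil) (Agree.nil _)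
        (by simp [Ctx.nil])]
  | qvar | new | tt | ff | meas | gate => intro k ρ p o hk; simp [Ctx.nil] at hk
  | @lam Γ V C D t h ih =>
    intro k ρ p o hk hd hρ hρp ho
    have ha : Agree (scons (some C) Γ) (Env.tys (scons (1 :: p, C) ρ)) := by
      rw [Env.tys_scons]; exact hρ.scons C
    have ht := h.subst hs (k := k + 1) hk hd
    rw [skip_scons] at ht
    obtain ⟨q, x, K, h1, h2, h3, h4, h5⟩ := ih (k := k + 1) (p := 0 :: p) (o := 0 :: p) hk hd ha
      (hsc C (hch 0 hρp) (dig_cons_none (by simp))) (dig_self _)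
    rw [skip_scons] at h2
    simp only [Tm.subst, translate, h.tyOf_eq (hρ.scons C), Env.tys_scons,
      ht.tyOf_eq ((hρ.skip k).scons C)]
    refine ⟨q, x, .par ⟨1 :: p, C.toFormula.neg⟩ ⟨0 :: p, D.toFormula⟩
      ⟨o, .par C.toFormula.neg D.toFormula⟩ :: K, perm_context_nil (A := [_]) (X := [_]) h1,
      perm_context_nil (A := [_]) h2, ?_, h4, (List.suffix_cons 0 p).trans h5⟩
    simp only [Link.edgesList, Link.edges, List.mem_append, List.mem_cons, List.not_mem_nil,
      or_false]
    rintro e ((rfl | rfl | rfl) | he)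
    · exact dig_none_of_cons_suffix h5 (by simp)
    · exact dig_none_of_suffix h5 (dig_self _)
    · exact dig_none_of_cons_suffix h5 (by simp [ho])
    · exact h3 e he
  | @app Γ Γ₁ Γ₂ V₁ V₂ C D t u hsp _ h1 h2 ih1 ih2 =>
    intro k ρ p o hk hd hρ hρp ho
    rw [Finset.disjoint_union_left] at hd
    have hl := hρ.left hsp
    have hr := hρ.right hsp
    -- The axiom comes from the premise that contains the variable; the other premise and the links
    -- of the application are the same before and after and join the remainder `K`.
    rcases hsp.some hk with ⟨hk1, hk2⟩ | ⟨hk1, hk2⟩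
    · obtain ⟨q, x, K, e1, e2, e3, e4, e5⟩ :=
        ih1 (p := 0 :: p) (o := 0 :: p) hk1 hd.1 hl (hch 0 hρp) (dig_self _)
      simp only [Tm.subst, translate, tyOf, h1.tyOf_eq hl, h2.tyOf_eq hr,
        (h1.subst hs hk1 hd.1).tyOf_eq (hl.skip k),
        (h2.subst_of_none s hk2).tyOf_eq (hr.skip k), h2.translate_subst_of_none s hk2 hr]
      refine ⟨q, x, .cut ⟨0 :: p, (C.arr D).toFormula⟩ ⟨3 :: p, .tens C.toFormula D.toFormula.neg⟩ ::
        .tens ⟨1 :: p, C.toFormula⟩ ⟨2 :: p, D.toFormula.neg⟩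
          ⟨3 :: p, .tens C.toFormula D.toFormula.neg⟩ ::
        .ax ⟨2 :: p, D.toFormula.neg⟩ ⟨o, D.toFormula⟩ ::
        (K ++ translate ρ (1 :: p) (1 :: p) u), ?_, ?_, ?_, e4, (List.suffix_cons 0 p).trans e5⟩
      · exact perm_context_left (A := [_, _, _]) (X := [_]) e1
      · exact perm_context_left (A := [_, _, _]) e2
      · simp only [Link.edgesList, Link.edges, List.mem_append, List.mem_cons, List.not_mem_nil,
          or_false, Link.edgesList_append]
        rintro e ((rfl | rfl) | (rfl | rfl | rfl) | (rfl | rfl) | he | he)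
        · exact dig_none_of_suffix e5 (dig_self _)
        · exact dig_none_of_cons_suffix e5 (by simp)
        · exact dig_none_of_cons_suffix e5 (by simp)
        · exact dig_none_of_cons_suffix e5 (by simp)
        · exact dig_none_of_cons_suffix e5 (by simp)
        · exact dig_none_of_cons_suffix e5 (by simp)
        · exact dig_none_of_cons_suffix e5 (by simp [ho])
        · exact e3 e he
        · exact dig_none_of_cons_suffix e5 (h2.dig_child hr hρp (by decide) he)
    · obtain ⟨q, x, K, e1, e2, e3, e4, e5⟩ :=
        ih2 (p := 1 :: p) (o := 1 :: p) hk2 hd.2 hr (hch 1 hρp) (dig_self _)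
      simp only [Tm.subst, translate, tyOf, h1.tyOf_eq hl, h2.tyOf_eq hr,
        (h1.subst_of_none s hk1).tyOf_eq (hl.skip k),
        (h2.subst hs hk2 hd.2).tyOf_eq (hr.skip k), h1.translate_subst_of_none s hk1 hl]
      refine ⟨q, x, .cut ⟨0 :: p, (C.arr D).toFormula⟩ ⟨3 :: p, .tens C.toFormula D.toFormula.neg⟩ ::
        .tens ⟨1 :: p, C.toFormula⟩ ⟨2 :: p, D.toFormula.neg⟩
          ⟨3 :: p, .tens C.toFormula D.toFormula.neg⟩ ::
        .ax ⟨2 :: p, D.toFormula.neg⟩ ⟨o, D.toFormula⟩ ::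
        (translate ρ (0 :: p) (0 :: p) t ++ K), ?_, ?_, ?_, e4, (List.suffix_cons 1 p).trans e5⟩
      · exact perm_context_right (A := [_, _, _]) (X := [_]) e1
      · exact perm_context_right (A := [_, _, _]) e2
      · simp only [Link.edgesList, Link.edges, List.mem_append, List.mem_cons, List.not_mem_nil,
          or_false, Link.edgesList_append]
        rintro e ((rfl | rfl) | (rfl | rfl | rfl) | (rfl | rfl) | he | he)
        · exact dig_none_of_cons_suffix e5 (by simp)
        · exact dig_none_of_cons_suffix e5 (by simp)
        · exact dig_none_of_suffix e5 (dig_self _)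
        · exact dig_none_of_cons_suffix e5 (by simp)
        · exact dig_none_of_cons_suffix e5 (by simp)
        · exact dig_none_of_cons_suffix e5 (by simp)
        · exact dig_none_of_cons_suffix e5 (by simp [ho])
        · exact dig_none_of_cons_suffix e5 (h1.dig_child hl hρp (by decide) he)
        · exact e3 e he
  | @pair Γ Γ₁ Γ₂ V₁ V₂ C D t u hsp _ h1 h2 ih1 ih2 =>
    intro k ρ p o hk hd hρ hρp ho
    rw [Finset.disjoint_union_left] at hd
    have hl := hρ.left hsp
    have hr := hρ.right hsp
    rcases hsp.some hk with ⟨hk1, hk2⟩ | ⟨hk1, hk2⟩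
    · obtain ⟨q, x, K, e1, e2, e3, e4, e5⟩ :=
        ih1 (p := 0 :: p) (o := 0 :: p) hk1 hd.1 hl (hch 0 hρp) (dig_self _)
      simp only [Tm.subst, translate, h1.tyOf_eq hl, h2.tyOf_eq hr,
        (h1.subst hs hk1 hd.1).tyOf_eq (hl.skip k),
        (h2.subst_of_none s hk2).tyOf_eq (hr.skip k), h2.translate_subst_of_none s hk2 hr]
      refine ⟨q, x, .tens ⟨0 :: p, C.toFormula⟩ ⟨1 :: p, D.toFormula⟩
          ⟨o, .tens C.toFormula D.toFormula⟩ ::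
        (K ++ translate ρ (1 :: p) (1 :: p) u), ?_, ?_, ?_, e4, (List.suffix_cons 0 p).trans e5⟩
      · exact perm_context_left (A := [_]) (X := [_]) e1
      · exact perm_context_left (A := [_]) e2
      · simp only [Link.edgesList, Link.edges, List.mem_append, List.mem_cons, List.not_mem_nil,
          or_false, Link.edgesList_append]
        rintro e ((rfl | rfl | rfl) | he | he)
        · exact dig_none_of_suffix e5 (dig_self _)
        · exact dig_none_of_cons_suffix e5 (by simp)
        · exact dig_none_of_cons_suffix e5 (by simp [ho])
        · exact e3 e he
        · exact dig_none_of_cons_suffix e5 (h2.dig_child hr hρp (by decide) he)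
    · obtain ⟨q, x, K, e1, e2, e3, e4, e5⟩ :=
        ih2 (p := 1 :: p) (o := 1 :: p) hk2 hd.2 hr (hch 1 hρp) (dig_self _)
      simp only [Tm.subst, translate, h1.tyOf_eq hl, h2.tyOf_eq hr,
        (h1.subst_of_none s hk1).tyOf_eq (hl.skip k),
        (h2.subst hs hk2 hd.2).tyOf_eq (hr.skip k), h1.translate_subst_of_none s hk1 hl]
      refine ⟨q, x, .tens ⟨0 :: p, C.toFormula⟩ ⟨1 :: p, D.toFormula⟩
          ⟨o, .tens C.toFormula D.toFormula⟩ ::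
        (translate ρ (0 :: p) (0 :: p) t ++ K), ?_, ?_, ?_, e4, (List.suffix_cons 1 p).trans e5⟩
      · exact perm_context_right (A := [_]) (X := [_]) e1
      · exact perm_context_right (A := [_]) e2
      · simp only [Link.edgesList, Link.edges, List.mem_append, List.mem_cons, List.not_mem_nil,
          or_false, Link.edgesList_append]
        rintro e ((rfl | rfl | rfl) | he | he)
        · exact dig_none_of_cons_suffix e5 (by simp)
        · exact dig_none_of_suffix e5 (dig_self _)
        · exact dig_none_of_cons_suffix e5 (by simp [ho])
        · exact dig_none_of_cons_suffix e5 (h1.dig_child hl hρp (by decide) he)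
        · exact e3 e he
  | @letp Γ Γ₁ Γ₂ V₁ V₂ C D E t u hsp _ h1 h2 ih1 ih2 =>
    intro k ρ p o hk hd hρ hρp ho
    rw [Finset.disjoint_union_left] at hd
    have hl := hρ.left hsp
    have hr := hρ.right hsp
    have ha : Agree (scons (some D) (scons (some C) Γ₂))
        (Env.tys (scons (2 :: p, D) (scons (1 :: p, C) ρ))) := by
      simp only [Env.tys_scons]; exact (hr.scons C).scons D
    rcases hsp.some hk with ⟨hk1, hk2⟩ | ⟨hk1, hk2⟩
    · obtain ⟨q, x, K, e1, e2, e3, e4, e5⟩ :=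
        ih1 (p := 0 :: p) (o := 0 :: p) hk1 hd.1 hl (hch 0 hρp) (dig_self _)
      have hu := h2.translate_subst_of_none s (k := k + 2) (p := 4 :: p) (o := o) hk2 ha
      rw [skip_scons, skip_scons] at hu
      simp only [Tm.subst, translate, h1.tyOf_eq hl, (h1.subst hs hk1 hd.1).tyOf_eq (hl.skip k),
        Ty.components, hu]
      refine ⟨q, x, .cut ⟨0 :: p, (C.tens D).toFormula⟩
          ⟨3 :: p, .par C.toFormula.neg D.toFormula.neg⟩ ::
        .par ⟨1 :: p, C.toFormula.neg⟩ ⟨2 :: p, D.toFormula.neg⟩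
          ⟨3 :: p, .par C.toFormula.neg D.toFormula.neg⟩ ::
        (K ++ translate (scons (2 :: p, D) (scons (1 :: p, C) ρ)) (4 :: p) o u), ?_, ?_, ?_, e4,
        (List.suffix_cons 0 p).trans e5⟩
      · exact perm_context_left (A := [_, _]) (X := [_]) e1
      · exact perm_context_left (A := [_, _]) e2
      · simp only [Link.edgesList, Link.edges, List.mem_append, List.mem_cons, List.not_mem_nil,
          or_false, Link.edgesList_append]
        rintro e ((rfl | rfl) | (rfl | rfl | rfl) | he | he)
        · exact dig_none_of_suffix e5 (dig_self _)
        · exact dig_none_of_cons_suffix e5 (by simp)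
        · exact dig_none_of_cons_suffix e5 (by simp)
        · exact dig_none_of_cons_suffix e5 (by simp)
        · exact dig_none_of_cons_suffix e5 (by simp)
        · exact e3 e he
        · apply dig_none_of_cons_suffix e5
          rcases h2.edges ha e he with rfl | he | ⟨_ | _ | i, F, hi, rfl⟩
          · simp [ho]
          · simp [dig_cons he]
          · simp [Env.edge, scons]
          · simp [Env.edge, scons]
          · simp [Env.edge, scons, hρp]
    · obtain ⟨q, x, K, e1, e2, e3, e4, e5⟩ :=
        ih2 (k := k + 2) (p := 4 :: p) (o := o) hk2 hd.2 ha
          (hsc _ (hsc _ (hch 4 hρp) (dig_cons_none (by simp))) (dig_cons_none (by simp)))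
          (dig_cons_none (by simp [ho]))
      rw [skip_scons, skip_scons] at e2
      simp only [Tm.subst, translate, h1.tyOf_eq hl, (h1.subst_of_none s hk1).tyOf_eq (hl.skip k),
        Ty.components, h1.translate_subst_of_none s hk1 hl]
      refine ⟨q, x, .cut ⟨0 :: p, (C.tens D).toFormula⟩
          ⟨3 :: p, .par C.toFormula.neg D.toFormula.neg⟩ ::
        .par ⟨1 :: p, C.toFormula.neg⟩ ⟨2 :: p, D.toFormula.neg⟩
          ⟨3 :: p, .par C.toFormula.neg D.toFormula.neg⟩ ::
        (translate ρ (0 :: p) (0 :: p) t ++ K), ?_, ?_, ?_, e4,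
        (List.suffix_cons 4 p).trans e5⟩
      · exact perm_context_right (A := [_, _]) (X := [_]) e1
      · exact perm_context_right (A := [_, _]) e2
      · simp only [Link.edgesList, Link.edges, List.mem_append, List.mem_cons, List.not_mem_nil,
          or_false, Link.edgesList_append]
        rintro e ((rfl | rfl) | (rfl | rfl | rfl) | he | he)
        · exact dig_none_of_cons_suffix e5 (by simp)
        · exact dig_none_of_cons_suffix e5 (by simp)
        · exact dig_none_of_cons_suffix e5 (by simp)
        · exact dig_none_of_cons_suffix e5 (by simp)
        · exact dig_none_of_cons_suffix e5 (by simp)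
        · exact dig_none_of_cons_suffix e5 (h1.dig_child hl hρp (by decide) he)
        · exact e3 e he
  | @ite Γ V C t u v h1 h2 h3 ih1 _ _ =>
    intro k ρ p o hk hd hρ hρp ho
    obtain ⟨q, x, K, e1, e2, e3, e4, e5⟩ :=
      ih1 (p := 0 :: p) (o := 0 :: p) hk hd hρ (hch 0 hρp) (dig_self _)
    have h2' := h2.subst_of_none s (k := k) rfl
    rw [skip_nil] at h2'
    have t2 := fun p o => h2.translate_subst_of_none s (k := k) (ρ := Env.nil) (p := p) (o := o) rfl
      (Agree.nil _)
    have t3 := fun p o => h3.translate_subst_of_none s (k := k) (ρ := Env.nil) (p := p) (o := o) rfl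
      (Agree.nil _)
    simp only [skip_envNil] at t2 t3
    simp only [Tm.subst, translate, h2.tyOf_eq (Agree.nil _), h2'.tyOf_eq (Agree.nil _), t2, t3]
    refine ⟨q, x, .cut ⟨0 :: p, .one⟩ ⟨1 :: p, .bot⟩ ::
        .box ⟨1 :: p, .bot⟩ [⟨o, C.toFormula⟩]
          (translate Env.nil (2 :: p) o u) (translate Env.nil (3 :: p) o v) :: K, ?_, ?_, ?_, e4,
        (List.suffix_cons 0 p).trans e5⟩
    · exact perm_context_nil (A := [_, _]) (X := [_]) e1
    · exact perm_context_nil (A := [_, _]) e2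
    · simp only [Link.edgesList, Link.edges, List.mem_append, List.mem_cons, List.not_mem_nil,
        or_false]
      rintro e ((rfl | rfl) | (((rfl | rfl) | he) | he) | he)
      · exact dig_none_of_suffix e5 (dig_self _)
      · exact dig_none_of_cons_suffix e5 (by simp)
      · exact dig_none_of_cons_suffix e5 (by simp)
      · exact dig_none_of_cons_suffix e5 (by simp [ho])
      · apply dig_none_of_cons_suffix e5
        rcases h2.edges (Agree.nil _) e he with rfl | he | ⟨i, F, hi, rfl⟩
        · simp [ho]
        · simp [dig_cons he]
        · simp [Ctx.nil] at hi
      · apply dig_none_of_cons_suffix e5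
        rcases h3.edges (Agree.nil _) e he with rfl | he | ⟨i, F, hi, rfl⟩
        · simp [ho]
        · simp [dig_cons he]
        · simp [Ctx.nil] at hi
      · exact e3 e he

/-- Cutting the net of a term against the conclusion for a variable yields the net of the
substitution. -/
theorem QNet.Red.cut_subst {Γ W₁} {t : Tm G} {B} (h : HasType Γ W₁ t B) {W₂} {s : Tm G} {A}
    (hs : HasType Ctx.nil W₂ s A) (hW : Disjoint W₁ W₂) {k} {ρ : Env} {p o q : List ℕ}
    (hk : Γ k = some A) (hρ : Agree Γ ρ.tys) (hρp : ∀ i, dig p (ρ i).1 = none)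
    (ho : dig p o = none) (hq : q ≠ [])
    (ht : ∀ e ∈ Link.edgesList (translate ρ p o t), e.name ≠ q ∧ dig q e.name = none)
    {K : List Link} (hK : ∀ e ∈ Link.edgesList K, e.name ≠ q ∧ dig q e.name = none)
    (hKp : ∀ e ∈ Link.edgesList K, dig p e.name = none) {Δ : List Edge}
    (hΔ : ∀ e ∈ Δ, dig q e.name = none ∧ dig p e.name = none) (V Q) :
    (mk ⟨.cut ⟨q, A.toFormula⟩ (ρ.edge k) ::
      (translate ρ p o t ++ (translate Env.nil q q s ++ K)), Δ, V, Q⟩).Red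
    (mk ⟨translate (skip k ρ) p o (Tm.subst s k t) ++ K, Δ, V, Q⟩) := by
  obtain ⟨r, x, L, h1, h2, h3, h4, h5⟩ := h.translate_subst hs hk hW hρ hρp ho
  have hL : ∀ e ∈ Link.edgesList L, e.name ≠ q ∧ dig q e.name = none := fun e he =>
    ht e ((Link.edgesList_perm h1).2 (by simp [Link.edgesList, he]))
  have hx := ht ⟨x, A.toFormula⟩ ((Link.edgesList_perm h1).2 (by simp [Link.edgesList, Link.edges]))
  have hΔ' : ∀ e ∈ Δ, dig q e.name = none ∧ dig r e.name = none := fun e he =>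
    ⟨(hΔ e he).1, dig_none_of_suffix h5 (hΔ e he).2⟩
  have hKL : ∀ e ∈ Link.edgesList (L ++ K), dig q e.name = none ∧ dig r e.name = none := by
    intro e he
    rw [Link.edgesList_append, List.mem_append] at he
    rcases he with he | he
    · exact ⟨(hL e he).2, h3 e he⟩
    · exact ⟨(hK e he).2, dig_none_of_suffix h5 (hKp e he)⟩
  -- The cut faces the unique axiom for the variable `k`; contracting it identifies the output `q`
  -- of `s` with the other end `x` of the axiom.
  have step := QNet.Red.axCut (L := .cut ⟨q, A.toFormula⟩ (ρ.edge k) ::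
      (translate ρ p o t ++ (translate Env.nil q q s ++ K)))
    (a := ⟨q, A.toFormula⟩) (b := ρ.edge k) (c := ⟨x, A.toFormula⟩)
    (K := translate Env.nil q q s ++ (L ++ K)) (by
      refine List.Perm.cons _ ((h1.append_right _).trans (List.Perm.cons _ ?_))
      change (L ++ (translate Env.nil q q s ++ K)).Perm _
      rw [← List.append_assoc, ← List.append_assoc]
      exact List.perm_append_comm.append_right _) (by simpa using hx.1.symm) Δ V Q
  -- The output of `s` is now `x`, but its internal names are still below `q`; an isomorphism moves
  -- them below `r`, where the translation of the substituted term has them.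
  rw [mapList_append, hs.translate_rename_out (Agree.nil _) (dig_self q) hq
    (fun i => by simpa [Env.nil] using hq.symm), Link.mapList_update_eq_self (by
      intro e he
      rw [Link.edgesList_append, List.mem_append] at he
      exact he.elim (fun he => (hL e he).1) (fun he => (hK e he).1)),
    QNet.mk_relocate hs V Q hx.2 h4 hKL hΔ'] at step
  refine step.trans (.of_eq (QNet.mk_perm ?_ Δ V Q))
  rw [← List.append_assoc]
  exact h2.symm.append_right K

/-! ## Inversion for terms without free λ-variables -/

theorem HasType.app_inv {W} {t u : Tm G} {B} (h : HasType Ctx.nil W (.app t u) B) :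
    ∃ V₁ V₂ A, W = V₁ ∪ V₂ ∧ Disjoint V₁ V₂ ∧ HasType Ctx.nil V₁ t (.arr A B) ∧
      HasType Ctx.nil V₂ u A := by
  generalize hΓ : Ctx.nil = Γ at h
  cases h with
  | app hs hd h1 h2 =>
    subst hΓ
    obtain ⟨rfl, rfl⟩ := hs.nil
    exact ⟨_, _, _, rfl, hd, h1, h2⟩

theorem HasType.pair_inv {W} {t u : Tm G} {B} (h : HasType Ctx.nil W (.pair t u) B) :
    ∃ V₁ V₂ A₁ A₂, W = V₁ ∪ V₂ ∧ Disjoint V₁ V₂ ∧ B = .tens A₁ A₂ ∧ HasType Ctx.nil V₁ t A₁ ∧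
      HasType Ctx.nil V₂ u A₂ := by
  generalize hΓ : Ctx.nil = Γ at h
  cases h with
  | pair hs hd h1 h2 =>
    subst hΓ
    obtain ⟨rfl, rfl⟩ := hs.nil
    exact ⟨_, _, _, _, rfl, hd, rfl, h1, h2⟩

theorem HasType.letp_inv {W} {t u : Tm G} {C} (h : HasType Ctx.nil W (.letp t u) C) :
    ∃ V₁ V₂ A B, W = V₁ ∪ V₂ ∧ Disjoint V₁ V₂ ∧ HasType Ctx.nil V₁ t (.tens A B) ∧
      HasType (scons (some B) (scons (some A) Ctx.nil)) V₂ u C := by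
  generalize hΓ : Ctx.nil = Γ at h
  cases h with
  | letp hs hd h1 h2 =>
    subst hΓ
    obtain ⟨rfl, rfl⟩ := hs.nil
    exact ⟨_, _, _, _, rfl, hd, h1, h2⟩

theorem HasType.lam_inv {Γ W} {t : Tm G} {A B} (h : HasType Γ W (.lam A t) B) :
    ∃ C, B = .arr A C ∧ HasType (scons (some A) Γ) W t C := by
  cases h with
  | lam h => exact ⟨_, rfl, h⟩

theorem HasType.ite_inv {Γ W} {t u v : Tm G} {A} (h : HasType Γ W (.ite t u v) A) :
    HasType Γ W t .bool ∧ HasType Ctx.nil ∅ u A ∧ HasType Ctx.nil ∅ v A := by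
  cases h with
  | ite h1 h2 h3 => exact ⟨h1, h2, h3⟩

/-! ## Evaluation contexts -/

/-- The links around the hole depend on its content only through the type, so one `K` serves both
redex and reduct. An evaluation context never enters the body of a `let` or a branch, so the output
of the hole is always its own position `q`. -/
theorem EvalCtx.translate_fill (E : EvalCtx G) :
    ∀ {W} {u : Tm G} {C} (p : List ℕ), HasType Ctx.nil W (E.fill u) C →
      ∃ W₀ B, HasType Ctx.nil W₀ u B ∧ W₀ ⊆ W ∧ ∃ q K, p <:+ q ∧
        (∀ e ∈ Link.edgesList K, dig q e.name = none) ∧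
        ∀ t, tyOf Env.nil.tys t = B → tyOf Env.nil.tys (E.fill t) = C ∧
          (translate Env.nil p p (E.fill t)).Perm (translate Env.nil q q t ++ K) := by
  have hρp : ∀ p i, dig p (Env.nil i).1 = none := fun p i => dig_nil p
  have hN := Agree.nil Env.nil.tys
  induction E with
  | hole =>
    intro W u C p h
    exact ⟨W, C, h, subset_rfl, p, [], List.suffix_rfl, by simp [Link.edgesList],
      fun t ht => ⟨ht, by simp [EvalCtx.fill]⟩⟩
  | appL E v ih =>
    intro W u C p h
    obtain ⟨V₁, V₂, A, rfl, hd, h1, h2⟩ := h.app_inv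
    obtain ⟨W₀, B, hu, hW, q, K, hq, hK, hE⟩ := ih (0 :: p) h1
    refine ⟨W₀, B, hu, hW.trans Finset.subset_union_left, q,
      .cut ⟨0 :: p, (A.arr C).toFormula⟩ ⟨3 :: p, .tens A.toFormula C.toFormula.neg⟩ ::
        .tens ⟨1 :: p, A.toFormula⟩ ⟨2 :: p, C.toFormula.neg⟩
          ⟨3 :: p, .tens A.toFormula C.toFormula.neg⟩ ::
        .ax ⟨2 :: p, C.toFormula.neg⟩ ⟨p, C.toFormula⟩ ::
        (K ++ translate Env.nil (1 :: p) (1 :: p) v), (List.suffix_cons 0 p).trans hq, ?_, ?_⟩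
    · simp only [Link.edgesList, Link.edges, List.mem_append, List.mem_cons, List.not_mem_nil,
        or_false, Link.edgesList_append]
      rintro e ((rfl | rfl) | (rfl | rfl | rfl) | (rfl | rfl) | he | he)
      · exact dig_none_of_suffix hq (dig_self _)
      · exact dig_none_of_cons_suffix hq (by simp)
      · exact dig_none_of_cons_suffix hq (by simp)
      · exact dig_none_of_cons_suffix hq (by simp)
      · exact dig_none_of_cons_suffix hq (by simp)
      · exact dig_none_of_cons_suffix hq (by simp)
      · exact dig_none_of_cons_suffix hq (by simp)
      · exact hK e he
      · exact dig_none_of_cons_suffix hq (h2.dig_child hN (hρp _) (by decide) he)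
    · intro t ht
      obtain ⟨h3, h4⟩ := hE t ht
      simp only [EvalCtx.fill, translate, tyOf, h3, h2.tyOf_eq hN, true_and]
      exact perm_context_left (A := [_, _, _]) h4
  | appR a ha E ih =>
    intro W u C p h
    obtain ⟨V₁, V₂, A, rfl, hd, h1, h2⟩ := h.app_inv
    obtain ⟨W₀, B, hu, hW, q, K, hq, hK, hE⟩ := ih (1 :: p) h2
    refine ⟨W₀, B, hu, hW.trans Finset.subset_union_right, q,
      .cut ⟨0 :: p, (A.arr C).toFormula⟩ ⟨3 :: p, .tens A.toFormula C.toFormula.neg⟩ ::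
        .tens ⟨1 :: p, A.toFormula⟩ ⟨2 :: p, C.toFormula.neg⟩
          ⟨3 :: p, .tens A.toFormula C.toFormula.neg⟩ ::
        .ax ⟨2 :: p, C.toFormula.neg⟩ ⟨p, C.toFormula⟩ ::
        (translate Env.nil (0 :: p) (0 :: p) a ++ K), (List.suffix_cons 1 p).trans hq, ?_, ?_⟩
    · simp only [Link.edgesList, Link.edges, List.mem_append, List.mem_cons, List.not_mem_nil,
        or_false, Link.edgesList_append]
      rintro e ((rfl | rfl) | (rfl | rfl | rfl) | (rfl | rfl) | he | he)
      · exact dig_none_of_cons_suffix hq (by simp)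
      · exact dig_none_of_cons_suffix hq (by simp)
      · exact dig_none_of_suffix hq (dig_self _)
      · exact dig_none_of_cons_suffix hq (by simp)
      · exact dig_none_of_cons_suffix hq (by simp)
      · exact dig_none_of_cons_suffix hq (by simp)
      · exact dig_none_of_cons_suffix hq (by simp)
      · exact dig_none_of_cons_suffix hq (h1.dig_child hN (hρp _) (by decide) he)
      · exact hK e he
    · intro t ht
      obtain ⟨h3, h4⟩ := hE t ht
      simp only [EvalCtx.fill, translate, tyOf, h3, h1.tyOf_eq hN, true_and]
      exact perm_context_right (A := [_, _, _]) h4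
  | pairL E v ih =>
    intro W u C p h
    obtain ⟨V₁, V₂, A, D, rfl, hd, rfl, h1, h2⟩ := h.pair_inv
    obtain ⟨W₀, B, hu, hW, q, K, hq, hK, hE⟩ := ih (0 :: p) h1
    refine ⟨W₀, B, hu, hW.trans Finset.subset_union_left, q,
      .tens ⟨0 :: p, A.toFormula⟩ ⟨1 :: p, D.toFormula⟩ ⟨p, .tens A.toFormula D.toFormula⟩ ::
        (K ++ translate Env.nil (1 :: p) (1 :: p) v), (List.suffix_cons 0 p).trans hq, ?_, ?_⟩
    · simp only [Link.edgesList, Link.edges, List.mem_append, List.mem_cons, List.not_mem_nil,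
        or_false, Link.edgesList_append]
      rintro e ((rfl | rfl | rfl) | he | he)
      · exact dig_none_of_suffix hq (dig_self _)
      · exact dig_none_of_cons_suffix hq (by simp)
      · exact dig_none_of_cons_suffix hq (by simp)
      · exact hK e he
      · exact dig_none_of_cons_suffix hq (h2.dig_child hN (hρp _) (by decide) he)
    · intro t ht
      obtain ⟨h3, h4⟩ := hE t ht
      simp only [EvalCtx.fill, translate, tyOf, h3, h2.tyOf_eq hN, true_and]
      exact perm_context_left (A := [_]) h4
  | pairR a ha E ih =>
    intro W u C p h
    obtain ⟨V₁, V₂, A, D, rfl, hd, rfl, h1, h2⟩ := h.pair_inv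
    obtain ⟨W₀, B, hu, hW, q, K, hq, hK, hE⟩ := ih (1 :: p) h2
    refine ⟨W₀, B, hu, hW.trans Finset.subset_union_right, q,
      .tens ⟨0 :: p, A.toFormula⟩ ⟨1 :: p, D.toFormula⟩ ⟨p, .tens A.toFormula D.toFormula⟩ ::
        (translate Env.nil (0 :: p) (0 :: p) a ++ K), (List.suffix_cons 1 p).trans hq, ?_, ?_⟩
    · simp only [Link.edgesList, Link.edges, List.mem_append, List.mem_cons, List.not_mem_nil,
        or_false, Link.edgesList_append]
      rintro e ((rfl | rfl | rfl) | he | he)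
      · exact dig_none_of_cons_suffix hq (by simp)
      · exact dig_none_of_suffix hq (dig_self _)
      · exact dig_none_of_cons_suffix hq (by simp)
      · exact dig_none_of_cons_suffix hq (h1.dig_child hN (hρp _) (by decide) he)
      · exact hK e he
    · intro t ht
      obtain ⟨h3, h4⟩ := hE t ht
      simp only [EvalCtx.fill, translate, tyOf, h3, h1.tyOf_eq hN, true_and]
      exact perm_context_right (A := [_]) h4
  | letp E v ih =>
    intro W u C p h
    obtain ⟨V₁, V₂, A, D, rfl, hd, h1, h2⟩ := h.letp_inv
    have ha : Agree (scons (some D) (scons (some A) Ctx.nil))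
        (Env.tys (scons (2 :: p, D) (scons (1 :: p, A) Env.nil))) := by
      simp only [Env.tys_scons]; exact (hN.scons A).scons D
    obtain ⟨W₀, B, hu, hW, q, K, hq, hK, hE⟩ := ih (0 :: p) h1
    refine ⟨W₀, B, hu, hW.trans Finset.subset_union_left, q,
      .cut ⟨0 :: p, (A.tens D).toFormula⟩ ⟨3 :: p, .par A.toFormula.neg D.toFormula.neg⟩ ::
        .par ⟨1 :: p, A.toFormula.neg⟩ ⟨2 :: p, D.toFormula.neg⟩
          ⟨3 :: p, .par A.toFormula.neg D.toFormula.neg⟩ ::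
        (K ++ translate (scons (2 :: p, D) (scons (1 :: p, A) Env.nil)) (4 :: p) p v),
      (List.suffix_cons 0 p).trans hq, ?_, ?_⟩
    · simp only [Link.edgesList, Link.edges, List.mem_append, List.mem_cons, List.not_mem_nil,
        or_false, Link.edgesList_append]
      rintro e ((rfl | rfl) | (rfl | rfl | rfl) | he | he)
      · exact dig_none_of_suffix hq (dig_self _)
      · exact dig_none_of_cons_suffix hq (by simp)
      · exact dig_none_of_cons_suffix hq (by simp)
      · exact dig_none_of_cons_suffix hq (by simp)
      · exact dig_none_of_cons_suffix hq (by simp)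
      · exact hK e he
      · apply dig_none_of_cons_suffix hq
        rcases h2.edges ha e he with rfl | he | ⟨_ | _ | i, F, hi, rfl⟩
        · simp
        · simp [dig_cons he]
        · simp [Env.edge, scons]
        · simp [Env.edge, scons]
        · simp [scons, Ctx.nil] at hi
    · intro t ht
      obtain ⟨h3, h4⟩ := hE t ht
      simp only [EvalCtx.fill, translate, tyOf, h3, Ty.components,
        h2.tyOf_eq ((hN.scons A).scons D), true_and]
      exact perm_context_left (A := [_, _]) h4
  | ite E v w ih =>
    intro W u C p h
    obtain ⟨h1, h2, h3⟩ := h.ite_inv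
    obtain ⟨W₀, B, hu, hW, q, K, hq, hK, hE⟩ := ih (0 :: p) h1
    refine ⟨W₀, B, hu, hW, q, .cut ⟨0 :: p, .one⟩ ⟨1 :: p, .bot⟩ ::
        .box ⟨1 :: p, .bot⟩ [⟨p, C.toFormula⟩]
          (translate Env.nil (2 :: p) p v) (translate Env.nil (3 :: p) p w) :: K,
      (List.suffix_cons 0 p).trans hq, ?_, ?_⟩
    · simp only [Link.edgesList, Link.edges, List.mem_append, List.mem_cons, List.not_mem_nil,
        or_false]
      rintro e ((rfl | rfl) | (((rfl | rfl) | he) | he) | he)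
      · exact dig_none_of_suffix hq (dig_self _)
      · exact dig_none_of_cons_suffix hq (by simp)
      · exact dig_none_of_cons_suffix hq (by simp)
      · exact dig_none_of_cons_suffix hq (by simp)
      · apply dig_none_of_cons_suffix hq
        rcases h2.edges hN e he with rfl | he | ⟨i, F, hi, rfl⟩
        · simp
        · simp [dig_cons he]
        · simp [Ctx.nil] at hi
      · apply dig_none_of_cons_suffix hq
        rcases h3.edges hN e he with rfl | he | ⟨i, F, hi, rfl⟩
        · simp
        · simp [dig_cons he]
        · simp [Ctx.nil] at hi
      · exact hK e he
    · intro t ht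
      obtain ⟨h3, h4⟩ := hE t ht
      have : tyOf (fun _ => Ty.bool) v = C := h2.tyOf_eq (Agree.nil _)
      simp only [EvalCtx.fill, translate, tyOf, h2.tyOf_eq hN, this, true_and]
      exact perm_context_nil (A := [_, _]) h4

/-! ## Redexes without quantum effects -/

section Redexes

variable {p : List ℕ} {K : List Link} {Δ : List Edge}

/-- Cutting the `⅋` of the abstraction against the `⊗` of the application separates the argument
from the result; the result passes through an axiom and the argument is substituted. -/
theorem QNet.Red.beta {W} {A : Ty} {t u : Tm G} {B} (h : HasType Ctx.nil W (.app (.lam A t) u) B)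
    (hK : ∀ e ∈ Link.edgesList K, dig p e.name = none) (hΔ : ∀ e ∈ Δ, dig p e.name = none) (V Q) :
    (mk ⟨translate Env.nil p p (.app (.lam A t) u) ++ K, Δ, V, Q⟩).Red
      (mk ⟨translate Env.nil p p (Tm.subst u 0 t) ++ K, Δ, V, Q⟩) := by
  have hN := Agree.nil Env.nil.tys
  obtain ⟨V₁, V₂, A', rfl, hd, h1, h2⟩ := h.app_inv
  obtain ⟨B', e, h1⟩ := h1.lam_inv
  obtain ⟨rfl, e2⟩ := Ty.arr.inj e.symm
  obtain rfl := e2.symm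
  set ρ : Env := scons (1 :: 0 :: p, A) Env.nil with hρdef
  have ha : Agree (scons (some A) Ctx.nil) ρ.tys := by
    rw [hρdef, Env.tys_scons]; exact hN.scons A
  have hρ : ∀ i, (ρ i).1 = 1 :: 0 :: p ∨ (ρ i).1 = [] := by
    rintro (_ | i)
    exacts [Or.inl rfl, Or.inr rfl]
  have r1 := QNet.Red.tensPar_swap (L := translate Env.nil p p (.app (.lam A t) u) ++ K)
    (a := ⟨1 :: p, A.toFormula⟩) (b := ⟨2 :: p, B.toFormula.neg⟩)
    (c := ⟨3 :: p, .tens A.toFormula B.toFormula.neg⟩) (a' := ⟨1 :: 0 :: p, A.toFormula.neg⟩)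
    (b' := ⟨0 :: 0 :: p, B.toFormula⟩) (c' := ⟨0 :: p, .par A.toFormula.neg B.toFormula⟩)
    (K := .ax ⟨2 :: p, B.toFormula.neg⟩ ⟨p, B.toFormula⟩ ::
      (translate ρ (0 :: 0 :: p) (0 :: 0 :: p) t ++ translate Env.nil (1 :: p) (1 :: p) u ++ K))
    (by
      simp only [translate, ← hρdef, tyOf, h1.tyOf_eq (hN.scons A), h2.tyOf_eq hN, Ty.toFormula,
        h1.tyOf_eq ha]
      exact List.Perm.cons _ (List.Perm.cons _ (List.Perm.swap _ _ _))) Δ V Q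
  -- The axiom on the result is removed, and the body gets the output `p` of the application.
  have r2 := QNet.Red.axCut_swap (L := .cut ⟨1 :: p, A.toFormula⟩ ⟨1 :: 0 :: p, A.toFormula.neg⟩ ::
      .cut ⟨2 :: p, B.toFormula.neg⟩ ⟨0 :: 0 :: p, B.toFormula⟩ ::
      .ax ⟨2 :: p, B.toFormula.neg⟩ ⟨p, B.toFormula⟩ ::
      (translate ρ (0 :: 0 :: p) (0 :: 0 :: p) t ++ translate Env.nil (1 :: p) (1 :: p) u ++ K))
    (a := ⟨0 :: 0 :: p, B.toFormula⟩) (b := ⟨2 :: p, B.toFormula.neg⟩) (c := ⟨p, B.toFormula⟩)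
    (K := translate ρ (0 :: 0 :: p) (0 :: 0 :: p) t ++
      (.cut ⟨1 :: p, A.toFormula⟩ ⟨1 :: 0 :: p, A.toFormula.neg⟩ ::
      (translate Env.nil (1 :: p) (1 :: p) u ++ K)))
    (by
      refine ((List.Perm.swap _ _ _).trans (List.Perm.cons _ (List.Perm.swap _ _ _))).trans
        (List.Perm.cons _ (List.Perm.cons _ ?_))
      rw [List.append_assoc]
      exact List.perm_middle.symm) (by
        intro h
        have := congrArg (dig p) (congrArg Edge.name h)
        simp at this) Δ V Q
  rw [mapList_append, h1.translate_rename_out ha (dig_self _) (by simp) (by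
      intro i; rcases hρ i with h | h <;> rw [h] <;> simp), Link.mapList_update_eq_self (by
      simp only [Link.edgesList, Link.edges, Link.edgesList_append, List.mem_append, List.mem_cons,
        List.not_mem_nil, or_false]
      rintro e ((rfl | rfl) | he | he)
      · intro h
        simpa using congrArg (dig p) h
      · simp
      · have := h2.dig_child (d := 0) hN (fun _ => dig_nil p) (by decide) he
        intro h
        simp [h] at this
      · intro h
        simpa [h] using hK e he)] at r2
  have ht : ∀ e ∈ Link.edgesList (translate ρ (0 :: 0 :: p) p t),
      e.name ≠ 1 :: p ∧ dig (1 :: p) e.name = none := by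
    intro e he
    rcases h1.edges ha e he with rfl | he | ⟨_ | i, C, hi, rfl⟩
    · exact ⟨by simp, dig_cons_none (by simp)⟩
    · have := dig_cons (show dig (0 :: p) e.name ≠ none by rw [dig_cons he]; simp)
      exact ⟨fun h => by simp [h] at this, dig_cons_none (by simp [this])⟩
    · exact ⟨fun h => by simpa using congrArg (dig p) (show 1 :: 0 :: p = 1 :: p from h),
        dig_cons_none (show dig p (1 :: 0 :: p) ≠ some 1 by simp)⟩
    · simp [scons, Ctx.nil] at hi
  have hp0 : ∀ z, dig p z = none → dig (0 :: 0 :: p) z = none := fun z hz =>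
    dig_cons_none (by rw [dig_cons_none (by simp [hz])]; simp)
  -- The remaining cut joins the argument to the conclusion for the bound variable.
  have r3 := QNet.Red.cut_subst h1 h2 hd (k := 0) (ρ := ρ) (p := 0 :: 0 :: p) (o := p)
    (q := 1 :: p) rfl ha (by
      intro i
      rcases hρ i with h | h <;> rw [h]
      · exact dig_cons_none (by simp)
      · exact dig_nil _) (hp0 _ (dig_self p)) (by simp) ht (K := K)
    (fun e he => ⟨fun h => by simpa [h] using hK e he, dig_cons_none (by simp [hK e he])⟩)
    (fun e he => hp0 _ (hK e he))
    (fun e he => ⟨dig_cons_none (by simp [hΔ e he]), hp0 _ (hΔ e he)⟩) V Q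
  refine r1.trans (r2.trans (.trans (.of_eq (QNet.mk_perm ?_ Δ V Q)) (r3.trans (.of_eq ?_))))
  · exact List.perm_middle
  -- The body is still named below `0 :: 0 :: p`, its position inside the redex.
  · exact QNet.mk_relocate (h1.subst h2 (k := 0) rfl hd) V Q (hp0 _ (dig_self p)) (dig_self p)
      (fun e he => ⟨hp0 _ (hK e he), hK e he⟩) (fun e he => ⟨hp0 _ (hΔ e he), hΔ e he⟩)

theorem QNet.Red.letp {W} {t u v : Tm G} {C} (h : HasType Ctx.nil W (.letp (.pair t u) v) C)
    (hK : ∀ e ∈ Link.edgesList K, dig p e.name = none) (hΔ : ∀ e ∈ Δ, dig p e.name = none) (V Q) :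
    (mk ⟨translate Env.nil p p (.letp (.pair t u) v) ++ K, Δ, V, Q⟩).Red
      (mk ⟨translate Env.nil p p (Tm.subst t 0 (Tm.subst u 0 v)) ++ K, Δ, V, Q⟩) := by
  have hN := Agree.nil Env.nil.tys
  obtain ⟨V₁, V₂, A, B, rfl, hd, h1, h2⟩ := h.letp_inv
  have e1 := h1.tyOf_eq hN
  obtain ⟨V₃, V₄, A', B', rfl, hd', e, h3, h4⟩ := h1.pair_inv
  obtain ⟨rfl, rfl⟩ := Ty.tens.inj e
  rw [Finset.disjoint_union_left] at hd
  set ρ₁ : Env := scons (1 :: p, A) Env.nil with hρ₁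
  set ρ₂ : Env := scons (2 :: p, B) ρ₁ with hρ₂
  have ha₁ : Agree (scons (some A) Ctx.nil) ρ₁.tys := by
    rw [hρ₁, Env.tys_scons]; exact hN.scons A
  have ha₂ : Agree (scons (some B) (scons (some A) Ctx.nil)) ρ₂.tys := by
    rw [hρ₂, Env.tys_scons]; exact ha₁.scons B
  have hp4 : ∀ z, dig p z = none → dig (4 :: p) z = none := fun z hz =>
    dig_cons_none (by simp [hz])
  have hp1 : ∀ z, dig p z = none → ∀ c, dig (c :: 0 :: p) z = none := fun z hz c =>
    dig_cons_none (by rw [dig_cons_none (by simp [hz])]; simp)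
  have hρ₁p : ∀ i, dig (4 :: p) (ρ₁ i).1 = none := by
    rintro (_ | i)
    exacts [dig_cons_none (by simp [hρ₁, QSMLL.scons]), dig_nil _]
  have hρ₂p : ∀ i, dig (4 :: p) (ρ₂ i).1 = none := by
    rintro (_ | i)
    exacts [dig_cons_none (by simp [hρ₂, QSMLL.scons]), hρ₁p i]
  have hz : ∀ (z : List ℕ) (c : ℕ), dig p z ≠ some 0 → z ≠ c :: 0 :: p ∧ dig (c :: 0 :: p) z = none :=
    fun z c hz => ⟨fun h => by simp [h] at hz, dig_cons_none (by rw [dig_cons_none hz]; simp)⟩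
  have r1 := QNet.Red.tensPar (L := translate Env.nil p p (.letp (.pair t u) v) ++ K)
    (a := ⟨0 :: 0 :: p, A.toFormula⟩) (b := ⟨1 :: 0 :: p, B.toFormula⟩)
    (c := ⟨0 :: p, .tens A.toFormula B.toFormula⟩) (a' := ⟨1 :: p, A.toFormula.neg⟩)
    (b' := ⟨2 :: p, B.toFormula.neg⟩) (c' := ⟨3 :: p, .par A.toFormula.neg B.toFormula.neg⟩)
    (K := translate Env.nil (0 :: 0 :: p) (0 :: 0 :: p) t ++
      translate Env.nil (1 :: 0 :: p) (1 :: 0 :: p) u ++ translate ρ₂ (4 :: p) p v ++ K)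
    (by
      simp only [translate, e1, h3.tyOf_eq hN, h4.tyOf_eq hN, Ty.toFormula, Ty.components, ← hρ₁,
        ← hρ₂]
      exact List.Perm.cons _ (List.Perm.swap _ _ _)) Δ V Q
  have ht₂ : ∀ e ∈ Link.edgesList (translate ρ₂ (4 :: p) p v), dig p e.name ≠ some 0 := by
    intro e he
    rcases h2.edges ha₂ e he with rfl | he | ⟨_ | _ | i, D, hi, rfl⟩
    · simp
    · simp [dig_cons he]
    · simp [Env.edge, hρ₂, QSMLL.scons]
    · simp [Env.edge, hρ₂, hρ₁, QSMLL.scons]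
    · simp [QSMLL.scons, Ctx.nil] at hi
  -- The two cuts are contracted in the order of the term rule: `u` for the innermost variable `y`
  -- first, after which `x` has index `0` and receives `t`.
  have r2 := QNet.Red.cut_subst h2 h4 hd.2.symm (k := 0) (ρ := ρ₂) (p := 4 :: p) (o := p)
    (q := 1 :: 0 :: p) rfl ha₂ hρ₂p (hp4 _ (dig_self p)) (by simp)
    (fun e he => hz _ _ (ht₂ e he))
    (K := .cut ⟨0 :: 0 :: p, A.toFormula⟩ ⟨1 :: p, A.toFormula.neg⟩ ::
      (translate Env.nil (0 :: 0 :: p) (0 :: 0 :: p) t ++ K))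
    (by
      simp only [Link.edgesList, Link.edges, Link.edgesList_append, List.mem_append, List.mem_cons,
        List.not_mem_nil, or_false]
      rintro e ((rfl | rfl) | he | he)
      · exact ⟨by simp, dig_cons_none (by simp)⟩
      · exact hz _ _ (by simp)
      · have := h3.dig_child (d := 1) hN (fun _ => dig_nil (0 :: p)) (by decide) he
        exact ⟨fun h => by simp [h] at this, dig_cons_none this⟩
      · exact hz _ _ (by simp [hK e he]))
    (by
      simp only [Link.edgesList, Link.edges, Link.edgesList_append, List.mem_append, List.mem_cons,
        List.not_mem_nil, or_false]
      rintro e ((rfl | rfl) | he | he)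
      · exact dig_cons_none (by simp)
      · exact dig_cons_none (by simp)
      · rcases h3.edges hN e he with rfl | he | ⟨i, D, hi, rfl⟩
        · exact dig_cons_none (by simp)
        · refine dig_cons_none ?_
          rw [dig_cons (a := 0) (by rw [dig_cons he]; simp)]
          simp
        · simp [Ctx.nil] at hi
      · exact hp4 _ (hK e he))
    (fun e he => ⟨hp1 _ (hΔ e he) 1, hp4 _ (hΔ e he)⟩) V Q
  have h2' := h2.subst h4 (k := 0) rfl hd.2.symm
  rw [skip_zero_scons] at h2'
  have ht₁ : ∀ e ∈ Link.edgesList (translate ρ₁ (4 :: p) p (Tm.subst u 0 v)),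
      dig p e.name ≠ some 0 := by
    intro e he
    rcases h2'.edges ha₁ e he with rfl | he | ⟨_ | i, D, hi, rfl⟩
    · simp
    · simp [dig_cons he]
    · simp [Env.edge, hρ₁, QSMLL.scons]
    · simp [QSMLL.scons, Ctx.nil] at hi
  have hd2 : Disjoint (V₂ ∪ V₄) V₃ := Finset.disjoint_union_left.2 ⟨hd.1.symm, hd'.symm⟩
  have r3 := QNet.Red.cut_subst h2' h3 hd2 (k := 0) (ρ := ρ₁) (p := 4 :: p) (o := p)
    (q := 0 :: 0 :: p) rfl ha₁ hρ₁p (hp4 _ (dig_self p)) (by simp)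
    (fun e he => hz _ _ (ht₁ e he)) (K := K) (fun e he => hz _ _ (by simp [hK e he]))
    (fun e he => hp4 _ (hK e he)) (fun e he => ⟨hp1 _ (hΔ e he) 0, hp4 _ (hΔ e he)⟩) V Q
  refine r1.trans (.trans (.of_eq (QNet.mk_perm ?_ Δ V Q)) (r2.trans
    (.trans (.of_eq (QNet.mk_perm ?_ Δ V Q)) (r3.trans (.of_eq ?_)))))
  · classical
    rw [List.perm_iff_count]
    intro y
    simp only [List.count_cons, List.count_append, show ρ₂.edge 0 = ⟨2 :: p, B.toFormula.neg⟩ from rfl]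
    omega
  · exact List.perm_middle
  · exact QNet.mk_relocate (h2'.subst h3 (k := 0) rfl hd2) V Q (hp4 _ (dig_self p)) (dig_self p)
      (fun e he => ⟨hp4 _ (hK e he), hK e he⟩) (fun e he => ⟨hp4 _ (hΔ e he), hΔ e he⟩)

end Redexes

/-! ## Registers with a variable in a basis state -/

/-- `Q ⊗ |r ← b⟩`. -/
def Reg.bit (b : Bool) (r : ℕ) (Q : Reg) : Reg :=
  fun s => if decide (r ∈ s) = b then Q (s.erase r) else 0

theorem Reg.addZero_eq_bit (Q : Reg) (r : ℕ) : Reg.addZero Q r = Reg.bit false r Q := by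
  funext s
  by_cases h : r ∈ s <;> simp [Reg.addZero, Reg.bit, h]

/-- For one qubit, overwriting the bit of `r` amounts to inserting or erasing `r`. -/
theorem Reg.apply_one (U : Matrix (Fin 1 → Bool) (Fin 1 → Bool) ℂ) (r : ℕ) (Q : Reg)
    (s : Finset ℕ) : Reg.apply U (fun _ : Fin 1 => r) Q s =
      U (fun _ => decide (r ∈ s)) (fun _ => true) * Q (insert r s) +
        U (fun _ => decide (r ∈ s)) (fun _ => false) * Q (s.erase r) := by
  have e : ∀ f : (Fin 1 → Bool) → ℂ, ∑ y, f y = f (fun _ => true) + f (fun _ => false) := fun f => by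
    rw [← (Equiv.funUnique (Fin 1) Bool).symm.sum_comp]
    have h : ∀ b : Bool, (Equiv.funUnique (Fin 1) Bool).symm b = fun _ => b := fun b => by
      ext i; rw [Subsingleton.elim i default]; rfl
    simp [h]
  have h1 : Reg.setBits (fun _ : Fin 1 => r) (fun _ => true) s = insert r s := by
    ext x; simp [Reg.setBits]
  have h2 : Reg.setBits (fun _ : Fin 1 => r) (fun _ => false) s = s.erase r := by
    ext x; simp [Reg.setBits]; grind
  rw [Reg.apply, e, h1, h2]

theorem Reg.apply_gateI (r : ℕ) (Q : Reg) :
    Reg.apply gateI.1 (fun _ : Fin 1 => r) (Reg.bit false r Q) = Reg.bit false r Q := by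
  funext s
  rw [Reg.apply_one]
  by_cases h : r ∈ s <;> simp [Reg.bit, gateI, h, funext_iff]

theorem Reg.apply_gateX (r : ℕ) (Q : Reg) :
    Reg.apply gateX.1 (fun _ : Fin 1 => r) (Reg.bit false r Q) = Reg.bit true r Q := by
  funext s
  rw [Reg.apply_one]
  by_cases h : r ∈ s <;> simp [Reg.bit, gateX, h, matX]

theorem Reg.IsState.sum_nnnorm {V : Finset ℕ} {Q : Reg} (h : Q.IsState V) :
    ∑ s ∈ V.powerset, ‖Q s‖₊ ^ 2 = 1 := by
  apply NNReal.coe_injective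
  push_cast
  exact h.2

/-- The whole squared norm of `Q`, which is `1`, sits on the basis vectors that assign `b` to `r`.
The sum over subsets of `insert r V` is split into those without `r` (`h0`) and those with `r`
(`h1`). -/
theorem Reg.prob_bit {V : Finset ℕ} {Q : Reg} {r : ℕ} (h : Q.IsState V) (hr : r ∉ V) (b c : Bool) :
    Reg.prob (insert r V) (Reg.bit b r Q) r c = if c = b then 1 else 0 := by
  have hs : ∀ s ∈ V.powerset, r ∉ s := fun s hs hrs => hr (Finset.mem_powerset.1 hs hrs)
  have h0 : ∑ s ∈ V.powerset, (if decide (r ∈ s) = c then ‖Reg.bit b r Q s‖₊ ^ 2 else 0) =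
      if b = false ∧ c = false then 1 else 0 := by
    split_ifs with hbc
    · rw [← h.sum_nnnorm]
      refine Finset.sum_congr rfl fun s hss => ?_
      simp [Reg.bit, hs s hss, hbc]
    · refine Finset.sum_eq_zero fun s hss => ?_
      cases b <;> cases c <;> simp_all [Reg.bit]
  have h1 : ∑ s ∈ V.powerset, (if decide (r ∈ insert r s) = c then
      ‖Reg.bit b r Q (insert r s)‖₊ ^ 2 else 0) = if b = true ∧ c = true then 1 else 0 := by
    split_ifs with hbc
    · rw [← h.sum_nnnorm]
      refine Finset.sum_congr rfl fun s hss => ?_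
      simp [Reg.bit, hs s hss, hbc]
    · refine Finset.sum_eq_zero fun s hss => ?_
      cases b <;> cases c <;> simp_all [Reg.bit]
  rw [Reg.prob, Finset.sum_filter, Finset.sum_powerset_insert hr, h0, h1]
  cases b <;> cases c <;> simp

theorem Reg.proj_bit {V : Finset ℕ} {Q : Reg} {r : ℕ} (h : Q.IsState V) (hr : r ∉ V) (b : Bool) :
    Reg.proj (insert r V) (Reg.bit b r Q) r b = Q := by
  funext s
  rw [Reg.proj, Reg.prob_bit h hr]
  by_cases hs : r ∈ s
  -- Both sides vanish: the projection on sets that contain `r` by definition, `Q` because its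
  -- support consists of subsets of `V`.
  · rw [if_pos hs, h.1 s fun hsV => hr (hsV hs)]
  · cases b <;> simp [Reg.bit, hs]

/-- Omitting outcomes of probability `0` turns a certain measurement into an ordinary step of
probability one. -/
theorem measList_single {X : Type*} {p : Bool → ℝ≥0} (x : Bool → X) (b : Bool)
    (h : ∀ c, p c = if c = b then 1 else 0) : measList p x = [(1, x b)] := by
  cases b <;> simp [measList, h]

theorem mapList_measList {X Y : Type*} (f : X → Y) (p : Bool → ℝ≥0) (x : Bool → X) :
    mapList f (measList p x) = measList p (fun b => f (x b)) := by
  simp [mapList, measList]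

/-! ## Redexes with quantum effects -/

section Redexes

variable {p : List ℕ} {K : List Link} {Δ : List Edge}

theorem QNet.Red.bitNet {U : QGate 1} {q o : List ℕ} {r : ℕ} {V : Finset ℕ} (hr : r ∉ V) (Q : Reg) :
    (mk ⟨QSMLL.bitNet U q o ++ K, Δ, V, Q⟩).Red (mk ⟨.one (some r) ⟨o, .one⟩ :: K, Δ, insert r V,
      Reg.apply U.1 (fun _ : Fin 1 => r) (Reg.bit false r Q)⟩) := by
  have h1 := QStruct.Step.new ⟨q, .one⟩ r (.sync U [(⟨q, .one⟩, ⟨o, .one⟩)] :: K) Δ V Q hr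
  have h2 := QStruct.Step.syncOne U (fun _ => r) (fun _ => ⟨q, .one⟩) (fun _ => ⟨o, .one⟩) K Δ
    (insert r V) (Reg.addZero Q r)
  simp only [List.ofFn_succ, List.ofFn_zero, List.singleton_append, Reg.addZero_eq_bit] at h1 h2
  exact (QNet.Red.of_step h1).trans
    (.trans (.of_eq (QNet.mk_perm (List.Perm.swap _ _ _) _ _ _)) (.of_step h2))

/-- The truth value prepares a fresh variable in the state `b`. Opening the box measures it, gets
`b` with certainty and leaves the register as it was before the preparation. -/
theorem QNet.Red.ite {u v : Tm G} {A} (hu : HasType Ctx.nil ∅ u A) (hv : HasType Ctx.nil ∅ v A)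
    (hK : ∀ e ∈ Link.edgesList K, dig p e.name = none) (hΔ : ∀ e ∈ Δ, dig p e.name = none)
    {V : Finset ℕ} {Q : Reg} (hQ : Q.IsState V) {U : QGate 1} {b : Bool}
    (hU : ∀ r, Reg.apply U.1 (fun _ : Fin 1 => r) (Reg.bit false r Q) = Reg.bit b r Q) :
    (mk ⟨.cut ⟨0 :: p, .one⟩ ⟨1 :: p, .bot⟩ :: .box ⟨1 :: p, .bot⟩ [⟨p, A.toFormula⟩]
        (translate Env.nil (2 :: p) p u) (translate Env.nil (3 :: p) p v) ::
        (QSMLL.bitNet U (0 :: 0 :: p) (0 :: p) ++ K), Δ, V, Q⟩).Red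
      (mk ⟨translate Env.nil p p (if b then v else u) ++ K, Δ, V, Q⟩) := by
  obtain ⟨r, hr⟩ := Infinite.exists_notMem_finset V
  have h1 := QNet.Red.bitNet (K := .cut ⟨0 :: p, .one⟩ ⟨1 :: p, .bot⟩ ::
    .box ⟨1 :: p, .bot⟩ [⟨p, A.toFormula⟩] (translate Env.nil (2 :: p) p u)
      (translate Env.nil (3 :: p) p v) :: K) (Δ := Δ) (U := U) (q := 0 :: 0 :: p) (o := 0 :: p) hr Q
  rw [hU] at h1
  have h2 := QStruct.Step.box r ⟨0 :: p, .one⟩ ⟨1 :: p, .bot⟩ [⟨p, A.toFormula⟩]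
    (translate Env.nil (2 :: p) p u) (translate Env.nil (3 :: p) p v) K Δ (insert r V)
    (Reg.bit b r Q)
  rw [measList_single _ b (Reg.prob_bit hQ hr b), Reg.proj_bit hQ hr, Finset.erase_insert hr] at h2
  have hp : ∀ c z, dig p z = none → dig (c :: p) z = none := fun c z hz =>
    dig_cons_none (by simp [hz])
  refine .trans (.of_eq (QNet.mk_perm ?_ _ _ _)) (h1.trans (.trans (.of_eq
    (QNet.mk_perm (List.Perm.swap _ _ _) _ _ _)) ((QNet.Red.of_step h2).trans (.of_eq ?_))))
  · exact perm_context_nil (A := [_, _]) (List.Perm.refl _)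
  · have key : ∀ {w : Tm G} (c : ℕ), HasType Ctx.nil ∅ w A →
        mk ⟨translate Env.nil (c :: p) p w ++ K, Δ, V, Q⟩ =
          mk ⟨translate Env.nil p p w ++ K, Δ, V, Q⟩ := fun c h =>
      QNet.mk_relocate h V Q (hp _ _ (dig_self p)) (dig_self p)
        (fun e he => ⟨hp _ _ (hK e he), hK e he⟩) (fun e he => ⟨hp _ _ (hΔ e he), hΔ e he⟩)
    cases b
    · exact key 2 hu
    · exact key 3 hv

/-- The inner edge of a truth value can be called anything fresh. This is needed because the copies
in the box of `meas` name it differently from the translations of `tt` and `ff`. -/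
theorem QNet.mk_bitNet_rename {U : QGate 1} {q q' o : List ℕ} (hq : q ≠ o) (hq' : q' ≠ o)
    (hK : ∀ e ∈ Link.edgesList K, e.name ≠ q ∧ e.name ≠ q')
    (hΔ : ∀ e ∈ Δ, e.name ≠ q ∧ e.name ≠ q') (V Q) :
    mk ⟨bitNet U q o ++ K, Δ, V, Q⟩ = mk ⟨bitNet U q' o ++ K, Δ, V, Q⟩ := by
  by_cases hqq : q = q'
  · rw [hqq]
  set f : Edge → Edge := Function.update id ⟨q, .one⟩ ⟨q', .one⟩ with hf
  have hfe : ∀ e : Edge, e.name ≠ q → f e = e := fun e he => by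
    have : e ≠ ⟨q, .one⟩ := fun h => he (by rw [h])
    simp [hf, this]
  have hfq : f ⟨q, .one⟩ = ⟨q', .one⟩ := by simp [hf]
  have key : ∀ e, e ∈ Link.edgesList (bitNet U q o ++ K) ∨ e ∈ Δ →
      e = ⟨q, .one⟩ ∨ (e.name ≠ q ∧ e.name ≠ q') := by
    simp only [bitNet, Link.edgesList, Link.edges, Link.edgesList_append, List.mem_append,
      List.mem_cons, List.not_mem_nil, or_false, List.map_cons, List.map_nil]
    rintro e ((((rfl | rfl | rfl)) | he) | he)
    · simp
    · simp
    · exact Or.inr ⟨hq.symm, hq'.symm⟩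
    · exact Or.inr (hK e he)
    · exact Or.inr (hΔ e he)
  have hiso := QStruct.Iso.edges (bitNet U q o ++ K) Δ V Q f (by
    intro e
    by_cases he : e = ⟨q, .one⟩
    · rw [he, hfq]
    · simp [hf, he]) (by
    intro e he e' he' hee
    rcases key e he with rfl | ⟨h1, h2⟩ <;> rcases key e' he' with rfl | ⟨h3, h4⟩
    · rfl
    · rw [hfq, hfe _ h3] at hee
      exact absurd (by rw [← hee]) h4
    · rw [hfq, hfe _ h1] at hee
      exact absurd (by rw [hee]) h2
    · rwa [hfe _ h1, hfe _ h3] at hee)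
  rw [mapList_append, Link.mapList_eq_self fun e he => hfe e (hK e he).1,
    show Δ.map f = Δ from (List.map_congr_left fun e he => hfe e (hΔ e he).1).trans
      (List.map_id Δ)] at hiso
  have : Link.mapList f id (bitNet U q o) = bitNet U q' o := by
    simp [bitNet, Link.mapList, Link.map, hfq, hfe ⟨o, .one⟩ hq.symm]
  rw [this] at hiso
  exact Quot.sound hiso

/-- Two steps bring the lock of the box against the `one` link of `r`. Opening the box then has the
same list of outcomes as the term rule, so the branches only have to be matched one by one. -/
theorem QNet.Reach.meas (r : ℕ) (hK : ∀ e ∈ Link.edgesList K, dig p e.name = none)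
    (hΔ : ∀ e ∈ Δ, dig p e.name = none) (V Q) :
    (mk ⟨translate (G := G) Env.nil p p (.app .meas (.qvar r)) ++ K, Δ, V, Q⟩).Reach
      (measList (Reg.prob V Q r) fun b =>
        mk ⟨translate (G := G) Env.nil p p (if b then .ff else .tt) ++ K, Δ, V.erase r,
          Reg.proj V Q r b⟩) := by
  have h1 := QNet.Red.tensPar_swap
    (L := translate (G := G) Env.nil p p (.app .meas (.qvar r)) ++ K)
    (a := ⟨1 :: p, .one⟩) (b := ⟨2 :: p, .bot⟩) (c := ⟨3 :: p, .tens .one .bot⟩)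
    (a' := ⟨0 :: 0 :: p, .bot⟩) (b' := ⟨1 :: 0 :: p, .one⟩) (c' := ⟨0 :: p, .par .bot .one⟩)
    (K := .ax ⟨2 :: p, .bot⟩ ⟨p, .one⟩ :: .box ⟨0 :: 0 :: p, .bot⟩ [⟨1 :: 0 :: p, .one⟩]
      (bitNet gateI (2 :: 0 :: p) (1 :: 0 :: p)) (bitNet gateX (3 :: 0 :: p) (1 :: 0 :: p)) ::
      .one (some r) ⟨1 :: p, .one⟩ :: K)
    (by
      simp only [translate, tyOf, Ty.toFormula, Formula.neg]
      exact List.Perm.cons _ (List.Perm.cons _ (List.Perm.swap _ _ _))) Δ V Q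
  have h2 := QNet.Red.axCut_swap (L := .cut ⟨1 :: p, .one⟩ ⟨0 :: 0 :: p, .bot⟩ ::
      .cut ⟨2 :: p, .bot⟩ ⟨1 :: 0 :: p, .one⟩ :: .ax ⟨2 :: p, .bot⟩ ⟨p, .one⟩ ::
      .box ⟨0 :: 0 :: p, .bot⟩ [⟨1 :: 0 :: p, .one⟩]
      (bitNet gateI (2 :: 0 :: p) (1 :: 0 :: p)) (bitNet gateX (3 :: 0 :: p) (1 :: 0 :: p)) ::
      .one (some r) ⟨1 :: p, .one⟩ :: K)
    (a := ⟨1 :: 0 :: p, .one⟩) (b := ⟨2 :: p, .bot⟩) (c := ⟨p, .one⟩)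
    ((List.Perm.swap _ _ _).trans (List.Perm.cons _ (List.Perm.swap _ _ _)))
    (by
      intro h
      simpa using congrArg (dig p) (congrArg Edge.name h)) Δ V Q
  -- The renamed edge is a conclusion of the box and hence also of both its contents.
  have e : Link.mapList (Function.update id ⟨1 :: 0 :: p, .one⟩ ⟨p, .one⟩) id
      (.cut ⟨1 :: p, .one⟩ ⟨0 :: 0 :: p, .bot⟩ :: .box ⟨0 :: 0 :: p, .bot⟩ [⟨1 :: 0 :: p, .one⟩]
      (bitNet gateI (2 :: 0 :: p) (1 :: 0 :: p)) (bitNet gateX (3 :: 0 :: p) (1 :: 0 :: p)) ::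
      .one (some r) ⟨1 :: p, .one⟩ :: K) =
      .cut ⟨1 :: p, .one⟩ ⟨0 :: 0 :: p, .bot⟩ :: .box ⟨0 :: 0 :: p, .bot⟩ [⟨p, .one⟩]
      (bitNet gateI (2 :: 0 :: p) p) (bitNet gateX (3 :: 0 :: p) p) ::
      .one (some r) ⟨1 :: p, .one⟩ :: K := by
    have := Link.mapList_update_eq_self (K := K) (n := 1 :: 0 :: p) (A := .one) (c := ⟨p, .one⟩)
      fun e he h => by simpa [h] using hK e he
    have hne : 1 :: p ≠ 1 :: 0 :: p := fun h => by simpa using congrArg (dig p) h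
    simp [Link.mapList, Link.map, this, bitNet, Function.update_apply, hne]
  rw [e] at h2
  have h3 := QStruct.Step.box r ⟨1 :: p, .one⟩ ⟨0 :: 0 :: p, .bot⟩ [⟨p, .one⟩]
    (bitNet gateI (2 :: 0 :: p) p) (bitNet gateX (3 :: 0 :: p) p) K Δ V Q
  have h4 : (mk _).Step _ := ⟨_, _, rfl, h3, rfl⟩
  rw [mapList_measList] at h4
  refine QNet.Reach.head (h1.trans (h2.trans (.of_eq (QNet.mk_perm
    (List.Perm.cons _ (List.Perm.swap _ _ _)) _ _ _)))) ?_
  convert QNet.Reach.of_step h4 using 3 with b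
  have hn : ∀ c d, c :: d :: p ≠ p := fun c d h => by simpa using congrArg (dig p) h
  have hz : ∀ z c, dig p z = none → z ≠ c :: 0 :: p ∧ z ≠ 0 :: p := fun z c hz =>
    ⟨fun h => by simp [h] at hz, fun h => by simp [h] at hz⟩
  have key : ∀ (U : QGate 1) c, mk ⟨bitNet U (c :: 0 :: p) p ++ K, Δ, V.erase r,
      Reg.proj V Q r b⟩ = mk ⟨bitNet U (0 :: p) p ++ K, Δ, V.erase r, Reg.proj V Q r b⟩ :=
    fun U c => QNet.mk_bitNet_rename (hn _ _) (by simp) (fun e he => hz _ _ (hK e he))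
      (fun e he => hz _ _ (hΔ e he)) _ _
  cases b
  · exact (key gateI 2).symm
  · exact (key gateX 3).symm

/-! ### Unitary operators -/

/-- The edges at the leaves of the net of a tuple of `n + 1` variables. -/
def leaves : ℕ → List ℕ → List ℕ → List Edge
  | 0, _, x => [⟨x, .one⟩]
  | n + 1, q, _ => ⟨0 :: q, .one⟩ :: leaves n (1 :: q) (1 :: q)

/-- The `⊗` links of the net of a tuple of `n + 1` variables. -/
def tensTree : ℕ → List ℕ → List ℕ → List Link
  | 0, _, _ => []
  | n + 1, q, x => .tens ⟨0 :: q, .one⟩ ⟨1 :: q, (Ty.pow .qbit (n + 1)).toFormula⟩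
      ⟨x, (Ty.pow .qbit (n + 2)).toFormula⟩ :: tensTree n (1 :: q) (1 :: q)

theorem length_leaves : ∀ n q x, (leaves n q x).length = n + 1
  | 0, _, _ => rfl
  | n + 1, q, _ => by simp [leaves, length_leaves n]

theorem leaves_edges : ∀ {n q x} {e : Edge}, e ∈ leaves n q x → e.name = x ∨ dig q e.name ≠ none
  | 0, q, x, e, he => by
    rw [leaves, List.mem_singleton] at he
    exact Or.inl (by rw [he])
  | n + 1, q, x, e, he => by
    rw [leaves, List.mem_cons] at he
    rcases he with rfl | he
    · simp
    · rcases leaves_edges he with h | h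
      · simp [h]
      · simp [dig_cons h]

theorem tensTree_edges : ∀ {n q x} {e : Edge}, e ∈ Link.edgesList (tensTree n q x) →
    e.name = x ∨ dig q e.name ≠ none
  | 0, q, x, e, he => by simp [tensTree, Link.edgesList] at he
  | n + 1, q, x, e, he => by
    simp only [tensTree, Link.edgesList, Link.edges, List.mem_append, List.mem_cons,
      List.not_mem_nil, or_false] at he
    rcases he with (rfl | rfl | rfl) | he
    · simp
    · simp
    · simp
    · rcases tensTree_edges he with h | h
      · simp [h]
      · simp [dig_cons h]

theorem tyOf_tuple (τ : ℕ → Ty) : ∀ (r : ℕ) (rs : List ℕ),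
    tyOf τ (Tm.tuple (G := G) (r :: rs)) = Ty.pow .qbit (rs.length + 1)
  | r, [] => rfl
  | r, r' :: rs => by simp [Tm.tuple, tyOf, Ty.pow, tyOf_tuple τ r' rs]

theorem translate_tuple : ∀ (r : ℕ) (rs : List ℕ) (q x : List ℕ),
    (translate Env.nil q x (Tm.tuple (G := G) (r :: rs))).Perm (tensTree rs.length q x ++
      List.zipWith (fun r e => Link.one (some r) e) (r :: rs) (leaves rs.length q x))
  | r, [], q, x => by simp [Tm.tuple, translate, tensTree, leaves]
  | r, r' :: rs, q, x => by
    have ih := translate_tuple r' rs (1 :: q) (1 :: q)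
    simp only [Tm.tuple, translate, tyOf_tuple, tyOf, List.length_cons, tensTree, leaves,
      List.zipWith_cons_cons, Ty.toFormula, Ty.pow]
    exact List.Perm.cons _ ((ih.cons _).trans List.perm_middle.symm)

/-- The sync link commutes with the `⊗` links from the root upwards, replacing the tree above it by
a copy below it, named under `q'`. The list `io` collects the leaves already reached, which makes
the induction on the remaining right subtree possible. -/
theorem QNet.Red.sync_tensTree {m : ℕ} (U : QGate m) (V Q) : ∀ (n : ℕ) {q x q' y : List ℕ}
    {io : List (Edge × Edge)} {K : List Link},
    (∀ z, dig q z ≠ none → dig q' z = none) → dig q' x = none → dig q' y = none →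
    (∀ e ∈ io, dig q' e.1.name = none ∧ dig q' e.2.name = none) →
    (∀ e ∈ Link.edgesList K, dig q' e.name = none) → (∀ e ∈ Δ, dig q' e.name = none) →
    (mk ⟨.sync U (io ++ [(⟨x, (Ty.pow .qbit (n + 1)).toFormula⟩,
        ⟨y, (Ty.pow .qbit (n + 1)).toFormula⟩)]) :: (tensTree n q x ++ K), Δ, V, Q⟩).Red
      (mk ⟨.sync U (io ++ (leaves n q x).zip (leaves n q' y)) :: (tensTree n q' y ++ K), Δ, V, Q⟩)
  | 0, q, x, q', y, io, K, _, _, _, _, _, _ => QNet.Red.refl _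
  | n + 1, q, x, q', y, io, K, hq, hx, hy, hio, hK, hΔ => by
    set F := (Ty.pow .qbit (n + 1)).toFormula with hF
    set F' := (Ty.pow .qbit (n + 2)).toFormula with hF'
    have hall : ∀ e, e ∈ Link.edgesList (.tens ⟨0 :: q, .one⟩ ⟨1 :: q, F⟩ ⟨x, F'⟩ ::
        .sync U (io ++ (⟨x, F'⟩, ⟨y, F'⟩) :: []) :: (tensTree n (1 :: q) (1 :: q) ++ K)) →
        dig q' e.name = none := by
      intro e he
      simp only [Link.edgesList, Link.edges, List.map_append, List.map_cons, List.map_nil,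
        Link.edgesList_append, List.mem_append, List.mem_cons, List.not_mem_nil, or_false,
        List.mem_map] at he
      rcases he with (rfl | rfl | rfl) | ((⟨a, ha, rfl⟩ | rfl) | ⟨a, ha, rfl⟩ | rfl) | he | he
      · exact hq _ (by simp)
      · exact hq _ (by simp)
      · exact hx
      · exact (hio a ha).1
      · exact hx
      · exact (hio a ha).2
      · exact hy
      · rcases tensTree_edges he with h | h
        · rw [h]; exact hq _ (by simp)
        · exact hq _ (by rw [dig_cons h]; simp)
      · exact hK e he
    have hfresh : ∀ c A, FreshEdge ⟨c :: q', A⟩ (.tens ⟨0 :: q, .one⟩ ⟨1 :: q, F⟩ ⟨x, F'⟩ ::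
        .sync U (io ++ (⟨x, F'⟩, ⟨y, F'⟩) :: []) :: (tensTree n (1 :: q) (1 :: q) ++ K)) Δ :=
      fun c A => ⟨fun h => by simpa using hall _ h, fun h => by simpa using hΔ _ h⟩
    have h1 := QStruct.Step.syncTens ⟨0 :: q, .one⟩ ⟨1 :: q, F⟩ ⟨x, F'⟩ ⟨y, F'⟩ ⟨0 :: q', .one⟩
      ⟨1 :: q', F⟩ (tensTree n (1 :: q) (1 :: q) ++ K) Δ V Q U io [] rfl rfl (by simp)
      (hfresh _ _) (hfresh _ _)
    have hc : ∀ z, dig q' z = none → dig (1 :: q') z = none := fun z hz =>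
      dig_cons_none (by simp [hz])
    -- The left component is a single qubit and is finished, so its pair joins `io`; the recursion
    -- continues on the right component, with the new `⊗` link as part of the context.
    have h2 := sync_tensTree U V Q n (q := 1 :: q) (x := 1 :: q) (q' := 1 :: q') (y := 1 :: q')
      (io := io ++ [(⟨0 :: q, .one⟩, ⟨0 :: q', .one⟩)])
      (K := .tens ⟨0 :: q', .one⟩ ⟨1 :: q', F⟩ ⟨y, F'⟩ :: K)
      (fun z hz => hc _ (hq z (by rw [dig_cons hz]; simp))) (hc _ (hq _ (by simp))) (dig_self _)
      (by
        intro e he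
        rw [List.mem_append, List.mem_singleton] at he
        rcases he with he | rfl
        · exact ⟨hc _ (hio e he).1, hc _ (hio e he).2⟩
        · exact ⟨hc _ (hq _ (by simp)), dig_cons_none (by simp)⟩)
      (by
        simp only [Link.edgesList, Link.edges, List.mem_append, List.mem_cons, List.not_mem_nil,
          or_false]
        rintro e ((rfl | rfl | rfl) | he)
        · exact dig_cons_none (by simp)
        · exact dig_self _
        · exact hc _ hy
        · exact hc _ (hK e he))
      (fun e he => hc _ (hΔ e he))
    simp only [List.append_assoc, List.singleton_append] at h2
    refine .trans (.of_eq (QNet.mk_perm (List.Perm.swap _ _ _) _ _ _)) ((QNet.Red.of_step h1).trans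
      (.trans (.of_eq (QNet.mk_perm ?_ _ _ _)) (h2.trans (.of_eq (QNet.mk_perm ?_ _ _ _)))))
    · exact (List.Perm.swap _ _ _).trans (List.Perm.cons _ List.perm_middle.symm)
    · exact List.Perm.cons _ List.perm_middle

theorem exists_ofFn {α : Type*} {n : ℕ} {l : List α} (h : l.length = n) :
    ∃ f : Fin n → α, l = List.ofFn f := by
  subst h
  exact ⟨l.get, (List.ofFn_get l).symm⟩

theorem zipWith_ofFn {α β γ : Type*} {n : ℕ} (g : α → β → γ) (f : Fin n → α) (f' : Fin n → β) :
    List.zipWith g (List.ofFn f) (List.ofFn f') = List.ofFn fun i => g (f i) (f' i) := by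
  apply List.ext_getElem <;> simp

/-- Once the sync link rests on the leaves, all its premises come from `one` links and it acts on
the register in a single step. -/
theorem QNet.Red.sync_tuple {n : ℕ} (hn : 0 < n) (U : QGate n) (rs : Fin n → ℕ) {q x q' y : List ℕ}
    (hq : ∀ z, dig q z ≠ none → dig q' z = none) (hx : dig q' x = none) (hy : dig q' y = none)
    (hK : ∀ e ∈ Link.edgesList K, dig q' e.name = none) (hΔ : ∀ e ∈ Δ, dig q' e.name = none) (V Q) :
    (mk ⟨.sync U [(⟨x, (Ty.pow .qbit n).toFormula⟩, ⟨y, (Ty.pow .qbit n).toFormula⟩)] ::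
        (translate Env.nil q x (Tm.tuple (G := G) (List.ofFn rs)) ++ K), Δ, V, Q⟩).Red
      (mk ⟨translate Env.nil q' y (Tm.tuple (G := G) (List.ofFn rs)) ++ K, Δ, V,
        Reg.apply U.1 rs Q⟩) := by
  obtain ⟨m, rfl⟩ := Nat.exists_eq_add_of_le' hn
  have htr := fun q x => translate_tuple (G := G) (rs 0) (List.ofFn fun i => rs i.succ) q x
  rw [← List.ofFn_succ, List.length_ofFn] at htr
  obtain ⟨es, he⟩ := exists_ofFn (length_leaves m q x)
  obtain ⟨fs, hf⟩ := exists_ofFn (length_leaves m q' y)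
  have h1 := QNet.Red.sync_tensTree (Δ := Δ) U V Q m (io := [])
    (K := List.zipWith (fun r e => Link.one (some r) e) (List.ofFn rs) (leaves m q x) ++ K)
    hq hx hy (by simp) (by
      intro e hee
      rw [Link.edgesList_append, List.mem_append] at hee
      rcases hee with hee | hee
      · have hl : e.name = x ∨ dig q e.name ≠ none := by
          refine leaves_edges (n := m) ?_
          rw [he, zipWith_ofFn, Link.mem_edgesList] at hee
          obtain ⟨l, hl, hel⟩ := hee
          obtain ⟨i, rfl⟩ := (List.mem_ofFn' _ _).1 hl
          simp only [Link.edges, List.mem_singleton] at hel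
          rw [he, hel]
          exact (List.mem_ofFn' _ _).2 ⟨i, rfl⟩
        rcases hl with h | h
        · rw [h]; exact hx
        · exact hq _ h
      · exact hK e hee) hΔ
  have h2 := QStruct.Step.syncOne U rs es fs (tensTree m q' y ++ K) Δ V Q
  rw [List.nil_append, List.nil_append, he, hf, List.zip, zipWith_ofFn, zipWith_ofFn] at h1
  refine .trans (.of_eq (QNet.mk_perm ?_ _ _ _)) (h1.trans (.trans (.of_eq (QNet.mk_perm ?_ _ _ _))
    ((QNet.Red.of_step h2).trans (.of_eq (QNet.mk_perm ?_ _ _ _)))))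
  · refine List.Perm.cons _ ?_
    rw [← List.append_assoc, ← zipWith_ofFn (fun r e => Link.one (some r) e), ← he]
    exact (htr q x).append_right K
  · exact List.Perm.cons _ (perm_context_nil (A := tensTree m q' y) (List.Perm.refl _))
  · refine .trans ?_ ((htr q' y).append_right K).symm
    rw [hf, zipWith_ofFn, List.append_assoc]
    exact (perm_context_nil (A := tensTree m q' y) (List.Perm.refl _)).symm

end Redexes

theorem HasType.gate_app_inv {W} {a : G.Op} {t : Tm G} {B} (h : HasType Ctx.nil W (.app (.gate a) t) B) :
    B = Ty.pow .qbit (G.arity a) ∧ ∃ V, HasType Ctx.nil V t B := by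
  obtain ⟨V₁, V₂, A, rfl, -, h1, h2⟩ := h.app_inv
  generalize hF : Ty.arr A B = F, hΓ : Ctx.nil = Γ at h1
  cases h1
  obtain ⟨rfl, rfl⟩ := Ty.arr.inj hF
  exact ⟨rfl, _, h2⟩

theorem HasType.meas_app_inv {W} {t : Tm G} {B} (h : HasType Ctx.nil W (.app .meas t) B) :
    B = .bool := by
  obtain ⟨V₁, V₂, A, rfl, -, h1, -⟩ := h.app_inv
  generalize hΓ : Ctx.nil = Γ at h1
  cases h1
  rfl

/-- A `⊗/⅋` step and two axiom steps plug the tuple directly into the sync link of the gate and the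
sync link into the output; `QNet.Red.sync_tuple` does the rest. -/
theorem QNet.Red.gate {p : List ℕ} {K : List Link} {Δ : List Edge} {W} {a : G.Op}
    {rs : Fin (G.arity a) → ℕ} {B}
    (h : HasType Ctx.nil W (.app (.gate a) (Tm.tuple (List.ofFn rs))) B)
    (hK : ∀ e ∈ Link.edgesList K, dig p e.name = none) (hΔ : ∀ e ∈ Δ, dig p e.name = none) (V Q) :
    (mk ⟨translate Env.nil p p (.app (.gate a) (Tm.tuple (List.ofFn rs))) ++ K, Δ, V, Q⟩).Red
      (mk ⟨translate (G := G) Env.nil p p (Tm.tuple (List.ofFn rs)) ++ K, Δ, V,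
        Reg.apply (G.den a).1 rs Q⟩) := by
  have hN := Agree.nil Env.nil.tys
  obtain ⟨rfl, W', ht⟩ := h.gate_app_inv
  have hρp : ∀ i, dig p (Env.nil i).1 = none := fun i => dig_nil p
  have e0 := h.tyOf_eq hN
  have e1 := ht.tyOf_eq hN
  set t : Tm G := Tm.tuple (List.ofFn rs) with htdef
  set P := (Ty.pow .qbit (G.arity a)).toFormula with hP
  have hs : ∀ c d : List ℕ, dig p c ≠ dig p d → c ≠ d := fun c d h e => h (by rw [e])
  have h1 := QNet.Red.tensPar_swap (L := translate Env.nil p p (.app (.gate a) t) ++ K)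
    (a := ⟨1 :: p, P⟩) (b := ⟨2 :: p, P.neg⟩) (c := ⟨3 :: p, .tens P P.neg⟩)
    (a' := ⟨0 :: 0 :: p, P.neg⟩) (b' := ⟨2 :: 0 :: p, P⟩) (c' := ⟨0 :: p, .par P.neg P⟩)
    (K := .ax ⟨2 :: p, P.neg⟩ ⟨p, P⟩ :: .ax ⟨0 :: 0 :: p, P.neg⟩ ⟨1 :: 0 :: p, P⟩ ::
      .sync (G.den a) [(⟨1 :: 0 :: p, P⟩, ⟨2 :: 0 :: p, P⟩)] ::
      (translate Env.nil (1 :: p) (1 :: p) t ++ K))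
    (by
      rw [translate]
      simp only [e0, e1, ← hP, translate, List.cons_append, List.nil_append]
      exact List.Perm.cons _ (List.Perm.cons _ (List.Perm.swap _ _ _))) Δ V Q
  have h2 := QNet.Red.axCut_swap (L := .cut ⟨1 :: p, P⟩ ⟨0 :: 0 :: p, P.neg⟩ ::
      .cut ⟨2 :: p, P.neg⟩ ⟨2 :: 0 :: p, P⟩ ::
      .ax ⟨2 :: p, P.neg⟩ ⟨p, P⟩ :: .ax ⟨0 :: 0 :: p, P.neg⟩ ⟨1 :: 0 :: p, P⟩ ::
      .sync (G.den a) [(⟨1 :: 0 :: p, P⟩, ⟨2 :: 0 :: p, P⟩)] ::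
      (translate Env.nil (1 :: p) (1 :: p) t ++ K))
    (a := ⟨2 :: 0 :: p, P⟩) (b := ⟨2 :: p, P.neg⟩) (c := ⟨p, P⟩)
    ((List.Perm.swap _ _ _).trans (List.Perm.cons _ (List.Perm.swap _ _ _)))
    (fun h => hs (2 :: 0 :: p) p (by simp) (congrArg Edge.name h)) Δ V Q
  have h3 := QNet.Red.axCut (L := .cut ⟨1 :: p, P⟩ ⟨0 :: 0 :: p, P.neg⟩ ::
      .ax ⟨0 :: 0 :: p, P.neg⟩ ⟨1 :: 0 :: p, P⟩ ::
      .sync (G.den a) [(⟨1 :: 0 :: p, P⟩, ⟨p, P⟩)] ::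
      (translate Env.nil (1 :: p) (1 :: p) t ++ K)) (List.Perm.refl _)
    (fun h => hs (1 :: p) (1 :: 0 :: p) (by simp) (congrArg Edge.name h)) Δ V Q
  have m2 : Link.mapList (Function.update id ⟨2 :: 0 :: p, P⟩ ⟨p, P⟩) id
      (translate Env.nil (1 :: p) (1 :: p) t ++ K) = translate Env.nil (1 :: p) (1 :: p) t ++ K := by
    refine Link.mapList_update_eq_self fun e he hn => ?_
    rw [Link.edgesList_append, List.mem_append] at he
    rcases he with he | he
    · exact ht.dig_child hN hρp (c := 1) (d := 0) (by simp) he (by simp [hn])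
    · simpa [hn] using hK e he
  have m3 : Link.mapList (Function.update id ⟨1 :: p, P⟩ ⟨1 :: 0 :: p, P⟩) id
      (translate Env.nil (1 :: p) (1 :: p) t ++ K) = translate Env.nil (1 :: p) (1 :: 0 :: p) t ++ K := by
    rw [mapList_append, ht.translate_rename_out hN (dig_self _) (by simp)
      (fun i => by simp [Env.nil]), Link.mapList_update_eq_self fun e he hn => by
        simpa [hn] using hK e he]
  have hd : ∀ c z, dig p z = none → dig (c :: p) z = none := fun c z hz =>
    dig_cons_none (by simp [hz])
  -- The position `4 :: p` is free, as the application uses only directions `0` to `3`; the net is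
  -- relocated to `p` afterwards.
  have h4 := QNet.Red.sync_tuple (G := G) (G.arity_pos a) (G.den a) rs (q := 1 :: p) (x := 1 :: 0 :: p)
    (q' := 4 :: p) (y := p) (K := K) (Δ := Δ)
    (fun z hz => dig_cons_none (by rw [dig_cons hz]; simp)) (dig_cons_none (by simp))
    (dig_cons_none (by simp)) (fun e he => hd _ _ (hK e he)) (fun e he => hd _ _ (hΔ e he)) V Q
  have n1 : 1 :: p ≠ 2 :: 0 :: p := hs _ _ (by simp)
  have n2 : p ≠ 1 :: p := hs _ _ (by simp)
  have n3 : 1 :: 0 :: p ≠ 1 :: p := hs _ _ (by simp)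
  simp only [Link.mapList, Link.map, m2, m3, List.map_cons, List.map_nil, Function.update_apply,
    Edge.mk.injEq, List.cons.injEq, n1, n2, n3, id, and_true, false_and, if_true,
    if_false, OfNat.one_ne_ofNat, OfNat.zero_ne_ofNat] at h2 h3
  refine h1.trans (h2.trans (.trans ?_ (h4.trans (.of_eq (QNet.mk_relocate ht V _
    (hd _ _ (dig_self p)) (dig_self p) (fun e he => ⟨hd _ _ (hK e he), hK e he⟩)
    (fun e he => ⟨hd _ _ (hΔ e he), hΔ e he⟩))))))
  convert h3 using 1

/-- A step of a closure is simulated by the reduction of its translation. -/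
theorem Raw.Step.reach {A : Ty} {c : Raw G} {l} (h : c.Step l) (hc : c.IsClosure A) :
    (QNet.mk (c.toQStruct A)).Reach (mapList (fun d => QNet.mk (d.toQStruct A)) l) := by
  have hN := Agree.nil Env.nil.tys
  have hΔ : ∀ q : List ℕ, ∀ e ∈ [(⟨[], A.toFormula⟩ : Edge)], dig q e.name = none := by
    simp
  -- Reduces every case to its redex: for all terms of the type of the redex, the closure translates
  -- to the net at `q` beside a fixed `K`.
  have key : ∀ (E : EvalCtx G) {V Q t}, IsClosure A ⟨V, Q, E.fill t⟩ → ∃ W B, HasType Ctx.nil W t B ∧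
      ∃ q K, (∀ e ∈ Link.edgesList K, dig q e.name = none) ∧ ∀ t, tyOf Env.nil.tys t = B →
        ∀ V Q, QNet.mk (Raw.toQStruct A ⟨V, Q, E.fill t⟩) =
          QNet.mk ⟨translate Env.nil q q t ++ K, [⟨[], A.toFormula⟩], V, Q⟩ := by
    intro E V Q t h
    obtain ⟨W, B, hB, -, q, K, -, hK, hE⟩ := E.translate_fill [] h.2
    exact ⟨W, B, hB, q, K, hK, fun t ht V Q => QNet.mk_perm (hE t ht).2 _ _ _⟩
  cases h with
  | beta V Q E C t u =>
    obtain ⟨W, B, hB, q, K, hK, hE⟩ := key E hc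
    obtain ⟨V₁, V₂, C', rfl, hd, h1, h2⟩ := hB.app_inv
    obtain ⟨B', e, h1⟩ := h1.lam_inv
    obtain ⟨rfl, rfl⟩ := Ty.arr.inj e
    have hs := h1.subst h2 (k := 0) rfl hd
    rw [skip_zero_scons] at hs
    refine QNet.Red.reach ?_
    dsimp only
    rw [hE _ (hB.tyOf_eq hN), hE _ (hs.tyOf_eq hN)]
    exact QNet.Red.beta hB hK (hΔ q) V Q
  | letp V Q E t u v =>
    obtain ⟨W, C, hC, q, K, hK, hE⟩ := key E hc
    obtain ⟨V₁, V₂, A, B, rfl, hd, h1, h2⟩ := hC.letp_inv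
    obtain ⟨V₃, V₄, A', B', rfl, hd', e, h3, h4⟩ := h1.pair_inv
    obtain ⟨rfl, rfl⟩ := Ty.tens.inj e
    rw [Finset.disjoint_union_left] at hd
    have hs := h2.subst h4 (k := 0) rfl hd.2.symm
    rw [skip_zero_scons] at hs
    have hs := hs.subst h3 (k := 0) rfl (Finset.disjoint_union_left.2 ⟨hd.1.symm, hd'.symm⟩)
    rw [skip_zero_scons] at hs
    refine QNet.Red.reach ?_
    dsimp only
    rw [hE _ (hC.tyOf_eq hN), hE _ (hs.tyOf_eq hN)]
    exact QNet.Red.letp hC hK (hΔ q) V Q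
  | iteTT V Q E t u =>
    obtain ⟨W, B, hB, q, K, hK, hE⟩ := key E hc
    obtain ⟨-, h1, h2⟩ := hB.ite_inv
    refine QNet.Red.reach ?_
    dsimp only
    rw [hE _ (hB.tyOf_eq hN), hE _ (h1.tyOf_eq hN), translate, h1.tyOf_eq hN]
    exact QNet.Red.ite h1 h2 hK (hΔ q) hc.1 (b := false) (fun r => Reg.apply_gateI r Q)
  | iteFF V Q E t u =>
    obtain ⟨W, B, hB, q, K, hK, hE⟩ := key E hc
    obtain ⟨-, h1, h2⟩ := hB.ite_inv
    refine QNet.Red.reach ?_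
    dsimp only
    rw [hE _ (hB.tyOf_eq hN), hE _ (h2.tyOf_eq hN), translate, h1.tyOf_eq hN]
    exact QNet.Red.ite h1 h2 hK (hΔ q) hc.1 (b := true) (fun r => Reg.apply_gateX r Q)
  | new V Q E r hr =>
    obtain ⟨W, B, hB, q, K, hK, hE⟩ := key E hc
    have hB' := hB.tyOf_eq hN
    refine QNet.Red.reach ?_
    dsimp only
    rw [hE _ hB', hE (.qvar r) hB']
    exact .of_step (.new _ r K _ V Q hr)
  | gate V Q E a rs =>
    obtain ⟨W, B, hB, q, K, hK, hE⟩ := key E hc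
    obtain ⟨-, W', ht⟩ := hB.gate_app_inv
    refine QNet.Red.reach ?_
    dsimp only
    rw [hE _ (hB.tyOf_eq hN), hE _ (ht.tyOf_eq hN)]
    exact QNet.Red.gate hB hK (hΔ q) V Q
  | meas V Q E r =>
    obtain ⟨W, B, hB, q, K, hK, hE⟩ := key E hc
    obtain rfl := hB.meas_app_inv
    rw [mapList_measList, hE _ (hB.tyOf_eq hN)]
    have e : ∀ b : Bool, QNet.mk (Raw.toQStruct A ⟨V.erase r, Reg.proj V Q r b,
        E.fill (if b then .ff else .tt)⟩) = QNet.mk ⟨translate (G := G) Env.nil q q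
          (if b then .ff else .tt) ++ K, [⟨[], A.toFormula⟩], V.erase r, Reg.proj V Q r b⟩ :=
      fun b => hE _ (by cases b <;> rfl) _ _
    simp only [e]
    exact QNet.Reach.meas r hK (hΔ q) V Q

theorem Closure.Step.reach {A : Ty} {C : Closure G A} {l} (h : C.Step l) :
    C.toNet.Reach (mapList Closure.toNet l) := by
  obtain ⟨c, m, rfl, hs, rfl⟩ := h
  have := hs.reach c.2
  simp only [mapList, List.map_map] at this ⊢
  exact this

/-- `Finsupp.mapDomain` is linear, so the image of a weighted sum is the weighted sum of the images,
to which `QNet.Reach` applies with the inductive hypotheses as continuations. -/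
theorem Closure.Reduces.toNet {A : Ty} {C : Closure G A} {𝒟 : Closure G A →₀ ℝ≥0}
    (h : C.Reduces 𝒟) : C.toNet.Reduces (Finsupp.mapDomain Closure.toNet 𝒟) := by
  induction h with
  | refl C =>
    rw [Finsupp.mapDomain_single]
    exact .refl _
  | step C l E hl _ ih =>
    -- The branches are indexed by `Fin` of the length of a list, so passing to the mapped list
    -- requires a cast of indices.
    have hlen : (mapList Closure.toNet l).length = l.length := List.length_map _
    have hget : ∀ i, (mapList Closure.toNet l).get i =
        ((l.get (i.cast hlen)).1, (l.get (i.cast hlen)).2.toNet) :=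
      fun i => List.getElem_map _
    have := Closure.Step.reach hl
      (fun i => Finsupp.mapDomain Closure.toNet (E (i.cast hlen))) fun i => by
        rw [hget]
        exact ih (i.cast hlen)
    rw [Finsupp.mapDomain_finsetSum]
    simp only [Finsupp.mapDomain_smul]
    rw [← (finCongr hlen).sum_comp]
    convert this using 1
    exact Finset.sum_congr rfl fun i _ => by rw [hget]; rfl

end QSMLL

end

theorem mainTheorem8 (G : QSMLL.GateSet) (A : QSMLL.Ty) :
    (∀ C : QSMLL.Closure G A, C.toNet.IsNet) ∧
    ∀ (C : QSMLL.Closure G A) (𝒟 : QSMLL.Closure G A →₀ ℝ≥0),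
      C.Reduces 𝒟 → C.toNet.Reduces (Finsupp.mapDomain QSMLL.Closure.toNet 𝒟) :=
  ⟨QSMLL.Closure.isNet, fun _ _ h => h.toNet⟩
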